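/- \textbf{Setting.} Let $\beta\in(0,1]$, $\delta\in(0,1)$, and let $0<s(1)<\dots<s(I)<1$, $I\ge 2$, be the possible endowment shares of the young, drawn i.i.d. with probabilities $\pi(i)>0$, $\sum_i\pi(i)=1$. We write $s$ or $r$ both for a state and for its share, and index by $i$ for $s(i)$. For an initial state $s_0$, a \emph{sustainable rule} assigns to every history $s^t=(s_0,\dots,s_t)$ a consumption share $c(s^t)\in(0,s_t]$ of the young such that $$\log c(s^t)-\log s_t+\beta\sum_r\pi(r)\bigl(\log(1-c(s^t,r))-\log(1-r)\bigr)\ge 0 .$$ Let $\omega_{\min}(s)=\log(1-s)$, let $\omega_{\max}(s)$ be the largest value of $\log(1-c(s_0))$ over sustainable rules with $s_0=s$, and let $\Omega(s)=[\omega_{\min}(s),\omega_{\max}(s)]$. For $\omega\in\Omega(s)$ let $V(s,\omega)$ be the supremum of $$\mathbb E\sum_{t\ge0}\delta^t\Bigl(\tfrac{\beta}{\delta}\log(1-c(s^t))+\log c(s^t)\Bigr)$$ over sustainable rules with $s_0=s$ and $\log(1-c(s_0))\ge\omega$. Let $\omega^0(s)=\sup\{\omega\in\Omega(s): V_\omega(s,\omega)=0\}$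 if $V_\omega(s,\omega_{\min}(s))=0$, and $\omega^0(s)=\omega_{\min}(s)$ otherwise (derivatives relative to $\Omega(s)$). Let $c^*(s)=\min\{\delta/(\beta+\delta),s\}$ and $\omega^*(s)=\max\{\omega_{\min}(s),\log(\beta/(\beta+\delta))\}$ be the first-best consumption of the young and utility of the old. Assume (a) $\sum_s \pi(s)\,\beta s/(1-s)>1$; (b) $s(1)\le\delta/(\beta+\delta)$; (c) $\log c^*(s(I))+\beta\sum_r\pi(r)\log(1-c^*(r))<\log s(I)+\beta\sum_r\pi(r)\log(1-r)$. The recursive planner problem at $(s,\omega)$, $\omega\in\Omega(s)$, is $$V(s,\omega)=\max_{c,(\omega_r)}\ \tfrac{\beta}{\delta}\log(1-c)+\log c+\delta\sum_r\pi(r)V(r,\omega_r)\tag{P1}$$ subject to $c>0$, $\log(1-c)\ge\omega$, $c\le s$, $\omega_{\min}(r)\le\omega_r\le\omega_{\max}(r)$ for every $r$, and $\log c+\beta\sum_r\pi(r)\omega_r\ge\log s+\beta\sum_r\pi(r)\log(1-r)$. The policy functions $f(s,\omega)$ and $g_r(s,\omega)$ are the maximizing $c$ and $\omega_r$; if there are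 several solutions, the one with the largest promises $\omega_r$ (for every $r$ simultaneously) is chosen. \textbf{Lemma.} For all $s$ and $\omega\in\Omega(s)$ equation (P1) holds and the policy choice exists and is unique. Moreover: (i) For all $r,s$, $g_r(s,\cdot)$ maps $\Omega(s)$ into $[\omega^0(r),\omega_{\max}(r)]$, is continuous and weakly increasing, and is strictly increasing on the set of $\omega\in\Omega(s)$ with $\omega\ge\omega^0(s)$ and $g_r(s,\omega)\in(\omega^0(r),\omega_{\max}(r))$. (ii) For each $r$, each $i=2,\dots,I$ and each $\omega\in(\omega_{\min}(s(i-1)),\omega_{\max}(s(i)))$, $g_r(s(i),\omega)\ge g_r(s(i-1),\omega)$; and for each $r$ and each $\omega$ that lies in all these intervals, the inequality is strict for at least one $i$. For each $s$ and each $\omega\in\Omega(s)$, $g_{r(i)}(s,\omega)\le g_{r(i-1)}(s,\omega)$ for $i=2,\dots,I$, with strict inequality for at least one $i$. (iii) There is $\omega^c$ with $\omega^0(s(1))<\omega^c\le\omega_{\max}(s(1))$ such that $g_r(s(1),\omega)=\omega^0(r)$ for all $\omega\in[\omega^0(s(1)),\omega^c]$ and all $r$. (iv) For each $s$, $\omega^f(s):=\min\{\omega^*(s),\omega_{\max}(s)\}$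 lies in $\Omega(s)$ and is a fixed point of $g_s(s,\cdot)$, and the only other possible fixed point in $\Omega(s)$ is the upper endpoint $\omega_{\max}(s)$. For $\omega\in\Omega(s)$: $g_s(s,\omega)>\omega$ if $\omega<\omega^f(s)$, and $g_s(s,\omega)<\omega$ if $\omega^f(s)<\omega<\omega_{\max}(s)$. Finally $\omega^f(s(I))>\omega^0(s(I))$. -/

import Mathlib

open Set

/-- Primitives of the economy with `n + 1` endowment states `0, …, n`, ordered by the endowment
share of the young. Shares are fractions of the aggregate endowment, shocks to them are i.i.d.,
and utility is logarithmic. -/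
structure Economy (n : ℕ) where
  /-- generational discount factor -/
  β : ℝ
  /-- discount factor of the planner -/
  δ : ℝ
  /-- endowment share of the young in each state -/
  s : Fin (n + 1) → ℝ
  /-- probability of each state -/
  prob : Fin (n + 1) → ℝ
  β_pos : 0 < β
  β_le_one : β ≤ 1
  δ_pos : 0 < δ
  δ_lt_one : δ < 1
  s_pos : ∀ i, 0 < s i
  s_lt_one : ∀ i, s i < 1
  s_strictMono : StrictMono s
  prob_pos : ∀ i, 0 < prob i
  prob_sum : ∑ i, prob i = 1

namespace Economy

variable {n : ℕ} (E : Economy n)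

/-! ### History-contingent rules, promises and the planner's value

The initial state `i` is given. A history is the list `[s₁, …, s_t]` of the later states in
chronological order (empty at date `0`), and a rule assigns to every history the consumption share
of the young. -/

/-- The current state after history `h` when the initial state is `i`. -/
def currentState (i : Fin (n + 1)) (h : List (Fin (n + 1))) : Fin (n + 1) :=
  h.getLastD i

/-- Sustainable rules: the consumption share of the young is positive, the old never make a
transfer to the young, and the young of every history weakly prefer the rule to autarky. -/
def IsSustainable (i : Fin (n + 1)) (c : List (Fin (n + 1)) → ℝ) : Prop :=
  ∀ h, 0 < c h ∧ c h ≤ E.s (currentState i h) ∧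
    0 ≤ Real.log (c h) - Real.log (E.s (currentState i h)) +
      E.β * ∑ r, E.prob r * (Real.log (1 - c (h ++ [r])) - Real.log (1 - E.s r))

/-- Per-period payoff of the planner when the young consume the share `c`. -/
noncomputable def periodPayoff (c : ℝ) : ℝ :=
  E.β / E.δ * Real.log (1 - c) + Real.log c

/-- Expected discounted payoff of the planner under the rule `c`. -/
noncomputable def payoff (c : List (Fin (n + 1)) → ℝ) : ℝ :=
  ∑' t : ℕ, E.δ ^ t * ∑ h : Fin t → Fin (n + 1),
    (∏ j, E.prob (h j)) * E.periodPayoff (c (List.ofFn h))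

/-- Utility of the old in autarky. -/
noncomputable def ωmin (i : Fin (n + 1)) : ℝ := Real.log (1 - E.s i)

/-- Largest feasible promise: the largest utility that a sustainable rule gives to the initial old
when the initial state is `i`. -/
noncomputable def ωmax (i : Fin (n + 1)) : ℝ :=
  sSup {ω | ∃ c, E.IsSustainable i c ∧ ω = Real.log (1 - c [])}

/-- The set of feasible promises in state `i`. -/
noncomputable def Ω (i : Fin (n + 1)) : Set ℝ := Icc (E.ωmin i) (E.ωmax i)

/-- The value function: the optimal payoff over sustainable rules that give the initial old a
utility of at least `ω`. -/
noncomputable def V (i : Fin (n + 1)) (ω : ℝ) : ℝ :=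
  sSup {v | ∃ c, E.IsSustainable i c ∧ ω ≤ Real.log (1 - c []) ∧ v = E.payoff c}

open Classical in
/-- `ω⁰`: the largest promise at which the derivative of the value function vanishes, if the
derivative vanishes at the lowest promise, and the lowest promise otherwise. -/
noncomputable def ω0 (i : Fin (n + 1)) : ℝ :=
  if HasDerivWithinAt (E.V i) 0 (E.Ω i) (E.ωmin i) then
    sSup {ω | ω ∈ E.Ω i ∧ HasDerivWithinAt (E.V i) 0 (E.Ω i) ω}
  else E.ωmin i

/-! ### First best -/

/-- First-best consumption share of the young. -/
noncomputable def cstar (i : Fin (n + 1)) : ℝ := min (E.δ / (E.β + E.δ)) (E.s i)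

/-- Utility of the old at the first best. -/
noncomputable def ωstar (i : Fin (n + 1)) : ℝ :=
  max (E.ωmin i) (Real.log (E.β / (E.β + E.δ)))

/-! ### The recursive problem -/

/-- Constraint set in state `i` with current promise `ω`: promise keeping, participation of the
old, feasibility of the future promises `w`, and participation of the young. -/
structure Feasible (i : Fin (n + 1)) (ω : ℝ) (c : ℝ) (w : Fin (n + 1) → ℝ) : Prop where
  c_pos : 0 < c
  promise_keeping : ω ≤ Real.log (1 - c)
  old_participation : c ≤ E.s i
  le_ωmax : ∀ r, w r ≤ E.ωmax r
  ωmin_le : ∀ r, E.ωmin r ≤ w r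
  young_participation :
    Real.log (E.s i) + E.β * ∑ r, E.prob r * Real.log (1 - E.s r) ≤
      Real.log c + E.β * ∑ r, E.prob r * w r

/-- Objective of the recursive problem. -/
noncomputable def objective (c : ℝ) (w : Fin (n + 1) → ℝ) : ℝ :=
  E.β / E.δ * Real.log (1 - c) + Real.log c + E.δ * ∑ r, E.prob r * E.V r (w r)

/-- `(c, w)` solves the recursive problem in state `i` with current promise `ω`. -/
def IsOptimal (i : Fin (n + 1)) (ω : ℝ) (c : ℝ) (w : Fin (n + 1) → ℝ) : Prop :=
  E.Feasible i ω c w ∧ ∀ c' w', E.Feasible i ω c' w' → E.objective c' w' ≤ E.objective c w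

/-- `(c, w)` is the choice made by the policy functions: it solves the recursive problem, and its
promises are the largest ones among all solutions. The tie-break matters only if the participation
constraint of the young does not bind. -/
def IsPolicyChoice (i : Fin (n + 1)) (ω : ℝ) (c : ℝ) (w : Fin (n + 1) → ℝ) : Prop :=
  E.IsOptimal i ω c w ∧ ∀ c' w', E.IsOptimal i ω c' w' → ∀ r, w' r ≤ w r

/-- `f i ω` and `g r i ω` are the policy functions: the consumption share of the young and the
utility promised for state `r` next period, given current state `i` and current promise `ω`. -/
def IsPolicy (f : Fin (n + 1) → ℝ → ℝ) (g : Fin (n + 1) → Fin (n + 1) → ℝ → ℝ) : Prop :=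
  ∀ i, ∀ ω ∈ E.Ω i, E.IsPolicyChoice i ω (f i ω) (fun r => g r i ω)

/-- The candidate fixed point `min {ω*, ω_max}`. -/
noncomputable def ωf (i : Fin (n + 1)) : ℝ := min (E.ωstar i) (E.ωmax i)

end Economy

namespace Economy

variable {n : ℕ} (E : Economy n)

open Filter Topology

/-! ### The largest feasible promise -/

/-! Measure consumption by the utility `x = log (1 - c)` of the old. Promises are then linear, and
`log c = log (1 - exp x)` is concave. Sustainable rules form a compact set closed under mixing, so
`V` is attained, concave and weakly decreasing. The recursive problem splits in two: `exactValue i x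
= pay x + δ * W (need i x)` is the value of giving the old exactly `x`, and `W A` is the best
expected continuation value when the expected promise is at least `A`. Strict concavity of
`exactValue` makes `V` flat up to `ω0` and equal to `exactValue`, strictly decreasing, beyond it.
The policy promise is `G (need i (max ω ω0))`, where `G A` is the largest solution of the inner
problem.

The rest is read off the multipliers `ν = 1 - (δ/β) F'`, which are at least one. If all functions
were smooth, one would have `ν_V(x) = R(x) ν_W(need i x)` and `ν_W(A) = ν_V(G A r)` at interior
promises, where `R` increases and crosses one at the first best `ωfb`. Without smoothness these
equalities survive as inequalities between one-sided derivatives (`νr_V_le`, `le_νl_V`, `νr_W_le`,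
`νl_V_le`). Promises stay interior because multipliers are unbounded near the largest promise
(`exists_lt_νl_W`, `G_lt_ωmax`). The inequalities suffice for weak monotonicity, for the order of
promises across states, and for the dynamics in a constant state, which are decided by the sign of
`R - 1`.

Strict monotonicity requires `W` to be differentiable (`no_kink`). A kink is an interval of
multipliers; each transition carries it, shifted on the logarithmic scale by `-log R`, into the
interval at the next required promise. Intervals at different points do not overlap, so small
nonzero shifts are impossible, but recurrence produces them. Strictness across current shares also
needs every promise after the highest state to exceed `ω0`; this is a quantitative estimate using `δ
< 1` (`ω0_lt_G_need_last`). -/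

lemma one_sub_s_pos (i : Fin (n + 1)) : 0 < 1 - E.s i := sub_pos.2 (E.s_lt_one i)

/-- Slack of the participation constraint of the young when they always consume the fraction `k`
of their endowment. -/
noncomputable def proportionalSlack (k : ℝ) : ℝ :=
  Real.log k + E.β * ∑ r, E.prob r * (Real.log (1 - k * E.s r) - Real.log (1 - E.s r))

lemma one_sub_mul_s_pos {k : ℝ} (hk : k ≤ 1) (i : Fin (n + 1)) : 0 < 1 - k * E.s i := by
  have h1 := E.s_pos i
  have h2 := E.s_lt_one i
  nlinarith

lemma proportionalSlack_one : E.proportionalSlack 1 = 0 := by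
  simp [proportionalSlack]

lemma continuousAt_proportionalSlack {k : ℝ} (h0 : 0 < k) (h1 : k ≤ 1) :
    ContinuousAt E.proportionalSlack k := by
  unfold proportionalSlack
  refine (Real.continuousAt_log h0.ne').add (continuousAt_const.mul ?_)
  refine tendsto_finsetSum _ fun r _ => ?_
  refine (continuousAt_const.mul (ContinuousAt.sub (ContinuousAt.log ?_ ?_) continuousAt_const))
  · fun_prop
  · exact (E.one_sub_mul_s_pos h1 r).ne'

lemma proportionalSlack_le {k : ℝ} (h0 : 0 < k) (h1 : k ≤ 1) :
    E.proportionalSlack k ≤ Real.log k - E.β * ∑ r, E.prob r * Real.log (1 - E.s r) := by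
  have : ∑ r, E.prob r * (Real.log (1 - k * E.s r) - Real.log (1 - E.s r)) ≤
      - ∑ r, E.prob r * Real.log (1 - E.s r) := by
    rw [← Finset.sum_neg_distrib]
    refine Finset.sum_le_sum fun r _ => ?_
    have : Real.log (1 - k * E.s r) ≤ 0 :=
      Real.log_nonpos (E.one_sub_mul_s_pos h1 r).le (by nlinarith [E.s_pos r])
    nlinarith [E.prob_pos r]
  unfold proportionalSlack
  nlinarith [E.β_pos]

/-- The slack vanishes at `k = 1` (autarky), and assumption (a) says precisely that its derivative
there is negative. It is therefore positive just to the left of one. -/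
lemma exists_proportionalSlack_pos
    (h_sustain : 1 < ∑ i, E.prob i * (E.β * E.s i / (1 - E.s i))) :
    ∃ k, 0 < k ∧ k < 1 ∧ 0 < E.proportionalSlack k := by
  have hd : HasDerivAt E.proportionalSlack
      (1 - ∑ i, E.prob i * (E.β * E.s i / (1 - E.s i))) 1 := by
    have h1 : ∀ r ∈ (Finset.univ : Finset (Fin (n + 1))),
        HasDerivAt (fun k : ℝ => E.prob r * (Real.log (1 - k * E.s r) - Real.log (1 - E.s r)))
          (E.prob r * (-(E.s r) / (1 - 1 * E.s r))) 1 := fun r _ => by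
      refine HasDerivAt.const_mul _ (HasDerivAt.sub_const _ (HasDerivAt.log ?_ ?_))
      · simpa using ((hasDerivAt_id (1 : ℝ)).mul_const (E.s r)).const_sub 1
      · exact (E.one_sub_mul_s_pos le_rfl r).ne'
    have h2 := (Real.hasDerivAt_log one_ne_zero).add
      ((HasDerivAt.fun_sum h1).const_mul E.β)
    refine h2.congr_deriv ?_
    rw [inv_one, sub_eq_add_neg, ← Finset.sum_neg_distrib, Finset.mul_sum]
    congr 1
    refine Finset.sum_congr rfl fun r _ => ?_
    rw [one_mul]
    ring
  have hneg : 1 - ∑ i, E.prob i * (E.β * E.s i / (1 - E.s i)) < 0 := by linarith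
  rw [hasDerivAt_iff_tendsto_slope] at hd
  have hsub : Iio (1 : ℝ) ⊆ {1}ᶜ := fun x (hx : x < 1) => hx.ne
  have hd' := hd.mono_left (nhdsWithin_mono (1 : ℝ) hsub)
  have hev := (hd'.eventually_lt_const hneg).and
    (Ioo_mem_nhdsLT (zero_lt_one : (0 : ℝ) < 1))
  obtain ⟨k, hk, hk0, hk1⟩ := hev.exists
  refine ⟨k, hk0, hk1, ?_⟩
  rw [slope_def_field, proportionalSlack_one, sub_zero] at hk
  by_contra hcon
  exact absurd (div_nonneg_of_nonpos (not_lt.1 hcon) (by linarith : k - 1 ≤ 0)) (not_le.2 hk)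

/-- The smallest fraction of their endowment that the young accept to consume. -/
lemma exists_minimal_fraction (h_sustain : 1 < ∑ i, E.prob i * (E.β * E.s i / (1 - E.s i))) :
    ∃ κ, 0 < κ ∧ κ < 1 ∧ E.proportionalSlack κ = 0 ∧
      ∀ k, 0 < k → k ≤ 1 → 0 ≤ E.proportionalSlack k → κ ≤ k := by
  obtain ⟨k₁, hk0, hk1, hk⟩ := E.exists_proportionalSlack_pos h_sustain
  set C := E.β * ∑ r, E.prob r * Real.log (1 - E.s r)
  -- Every acceptable fraction is at least `exp C`, by `proportionalSlack_le`. This confines the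
  -- minimization to a compact interval away from the singularity of `log` at zero.
  set ε := Real.exp C
  have hε : 0 < ε := Real.exp_pos _
  have hlow : ∀ k, 0 < k → k ≤ 1 → 0 ≤ E.proportionalSlack k → ε ≤ k := fun k h0 h1 h => by
    have := E.proportionalSlack_le h0 h1
    rw [← Real.le_log_iff_exp_le h0]
    linarith
  have hcont : ContinuousOn E.proportionalSlack (Icc ε 1) := fun k hk =>
    (E.continuousAt_proportionalSlack (hε.trans_le hk.1) hk.2).continuousWithinAt
  have hcpt : IsCompact (Icc ε 1 ∩ E.proportionalSlack ⁻¹' Ici 0) :=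
    isCompact_Icc.of_isClosed_subset
      (hcont.preimage_isClosed_of_isClosed isClosed_Icc isClosed_Ici) inter_subset_left
  obtain ⟨κ, ⟨hκI, hκ⟩, hmin⟩ := hcpt.exists_isLeast ⟨k₁, ⟨hlow k₁ hk0 hk1.le hk.le, hk1.le⟩, hk.le⟩
  have hκ0 : 0 < κ := hε.trans_le hκI.1
  have hle : ∀ k, 0 < k → k ≤ 1 → 0 ≤ E.proportionalSlack k → κ ≤ k := fun k h0 h1 h =>
    hmin ⟨⟨hlow k h0 h1 h, h1⟩, h⟩
  refine ⟨κ, hκ0, (hle k₁ hk0 hk1.le hk.le).trans_lt hk1, ?_, hle⟩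
  refine le_antisymm (not_lt.1 fun hpos => ?_) hκ
  -- Positive slack at the minimum would persist at slightly smaller fractions.
  have hev := (E.continuousAt_proportionalSlack hκ0 hκI.2).eventually_const_lt hpos
  have hev' := (hev.filter_mono (nhdsWithin_le_nhds (s := Iio κ))).and (Ioo_mem_nhdsLT hκ0)
  obtain ⟨k, h1, h2, h3⟩ := hev'.exists
  exact absurd (hle k h2 (h3.le.trans hκI.2) h1.le) (not_le.2 h3)

variable {E}

lemma currentState_cons (i r : Fin (n + 1)) (h : List (Fin (n + 1))) :
    currentState i (r :: h) = currentState r h := by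
  simp only [currentState, List.getLastD_cons]

lemma currentState_append (i r : Fin (n + 1)) (h : List (Fin (n + 1))) :
    currentState i (h ++ [r]) = r := by
  simp [currentState]

lemma IsSustainable.shift {i : Fin (n + 1)} {c : List (Fin (n + 1)) → ℝ}
    (hc : E.IsSustainable i c) (r : Fin (n + 1)) : E.IsSustainable r fun h => c (r :: h) :=
  fun h => by simpa only [currentState_cons, List.cons_append] using hc (r :: h)

lemma IsSustainable.pos {i : Fin (n + 1)} {c : List (Fin (n + 1)) → ℝ}
    (hc : E.IsSustainable i c) (h) : 0 < c h := (hc h).1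

lemma IsSustainable.le {i : Fin (n + 1)} {c : List (Fin (n + 1)) → ℝ}
    (hc : E.IsSustainable i c) (h) : c h ≤ E.s (currentState i h) := (hc h).2.1

lemma IsSustainable.lt_one {i : Fin (n + 1)} {c : List (Fin (n + 1)) → ℝ}
    (hc : E.IsSustainable i c) (h) : c h < 1 := (hc.le h).trans_lt (E.s_lt_one _)

/-- A sustainable rule never gives the young less than the minimal fraction. -/
lemma IsSustainable.fraction_le {κ : ℝ} (hκ : ∀ k, 0 < k → k ≤ 1 → 0 ≤ E.proportionalSlack k → κ ≤ k)
    {i : Fin (n + 1)} {c : List (Fin (n + 1)) → ℝ} (hc : E.IsSustainable i c) (h) :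
    κ * E.s (currentState i h) ≤ c h := by
  set q : List (Fin (n + 1)) → ℝ := fun h => c h / E.s (currentState i h)
  have hlogq : ∀ h, Real.log (q h) = Real.log (c h) - Real.log (E.s (currentState i h)) := fun h =>
    Real.log_div (hc.pos h).ne' (E.s_pos _).ne'
  have hq0 : ∀ h, 0 < q h := fun h => div_pos (hc.pos h) (E.s_pos _)
  have hq1 : ∀ h, q h ≤ 1 := fun h => (div_le_one (E.s_pos _)).2 (hc.le h)
  -- A uniform lower bound on next period's fractions limits what the young can receive when old,
  -- hence bounds today's fraction from below. Applied to `k = 0` it makes the infimum positive;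
  -- applied to the infimum it shows that the infimum has nonnegative slack.
  have hbound : ∀ k, 0 ≤ k → k ≤ 1 → (∀ h, k ≤ q h) → ∀ h,
      -(E.β * ∑ r, E.prob r * (Real.log (1 - k * E.s r) - Real.log (1 - E.s r))) ≤
        Real.log (q h) := fun k hk0 hk1 hk h => by
    have h1 := (hc h).2.2
    rw [hlogq]
    have : ∑ r, E.prob r * (Real.log (1 - c (h ++ [r])) - Real.log (1 - E.s r)) ≤
        ∑ r, E.prob r * (Real.log (1 - k * E.s r) - Real.log (1 - E.s r)) := by
      refine Finset.sum_le_sum fun r _ => mul_le_mul_of_nonneg_left ?_ (E.prob_pos r).le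
      have h3 : k * E.s r ≤ c (h ++ [r]) := by
        have := hk (h ++ [r])
        rw [le_div_iff₀ (E.s_pos _), currentState_append] at this
        exact this
      have := Real.log_le_log (by linarith [hc.lt_one (h ++ [r])] : 0 < 1 - c (h ++ [r]))
        (by linarith : 1 - c (h ++ [r]) ≤ 1 - k * E.s r)
      linarith
    nlinarith [E.β_pos]
  set k := ⨅ h, q h
  have hbdd : BddBelow (range q) := ⟨0, by rintro _ ⟨h, rfl⟩; exact (hq0 h).le⟩
  have hk_le : ∀ h, k ≤ q h := fun h => ciInf_le hbdd h
  have hk_pos : 0 < k := by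
    refine lt_of_lt_of_le (Real.exp_pos (-(E.β * ∑ r, E.prob r *
      (Real.log (1 - 0 * E.s r) - Real.log (1 - E.s r))))) (le_ciInf fun h => ?_)
    rw [← Real.le_log_iff_exp_le (hq0 h)]
    exact hbound 0 le_rfl zero_le_one (fun h => (hq0 h).le) h
  have hk1 : k ≤ 1 := (hk_le h).trans (hq1 h)
  have hslack : 0 ≤ E.proportionalSlack k := by
    have : -(E.β * ∑ r, E.prob r * (Real.log (1 - k * E.s r) - Real.log (1 - E.s r))) ≤
        Real.log k := by
      rw [Real.le_log_iff_exp_le hk_pos]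
      refine le_ciInf fun h => ?_
      rw [← Real.le_log_iff_exp_le (hq0 h)]
      exact hbound k hk_pos.le hk1 hk_le h
    unfold proportionalSlack
    linarith
  have := (hκ k hk_pos hk1 hslack).trans (hk_le h)
  rwa [le_div_iff₀ (E.s_pos _)] at this

lemma isSustainable_proportional {κ : ℝ} (h0 : 0 < κ) (h1 : κ ≤ 1)
    (hκ : 0 ≤ E.proportionalSlack κ) (i : Fin (n + 1)) :
    E.IsSustainable i fun h => κ * E.s (currentState i h) := fun h => by
  refine ⟨mul_pos h0 (E.s_pos _), by nlinarith [E.s_pos (currentState i h)], ?_⟩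
  simp only [currentState_append]
  rw [Real.log_mul h0.ne' (E.s_pos _).ne']
  unfold proportionalSlack at hκ
  linarith

lemma isGreatest_ωmax {κ : ℝ} (h0 : 0 < κ) (h1 : κ ≤ 1) (hκ : 0 ≤ E.proportionalSlack κ)
    (hmin : ∀ k, 0 < k → k ≤ 1 → 0 ≤ E.proportionalSlack k → κ ≤ k) (i : Fin (n + 1)) :
    IsGreatest {ω | ∃ c, E.IsSustainable i c ∧ ω = Real.log (1 - c [])}
      (Real.log (1 - κ * E.s i)) := by
  refine ⟨⟨_, isSustainable_proportional h0 h1 hκ i, rfl⟩, ?_⟩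
  rintro _ ⟨c, hc, rfl⟩
  have h : κ * E.s i ≤ c [] := hc.fraction_le hmin []
  exact Real.log_le_log (by linarith [hc.lt_one []]) (by linarith)

variable (E) in
/-- `κ` is the smallest fraction of their endowment that the young accept to consume. -/
structure IsMinimalFraction (κ : ℝ) : Prop where
  pos : 0 < κ
  lt_one : κ < 1
  slack : E.proportionalSlack κ = 0
  ωmax_eq : ∀ i, E.ωmax i = Real.log (1 - κ * E.s i)
  le : ∀ i c, E.IsSustainable i c → ∀ h, κ * E.s (currentState i h) ≤ c h

lemma exists_isMinimalFraction
    (h_sustain : 1 < ∑ i, E.prob i * (E.β * E.s i / (1 - E.s i))) :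
    ∃ κ, E.IsMinimalFraction κ := by
  obtain ⟨κ, h0, h1, hκ, hmin⟩ := E.exists_minimal_fraction h_sustain
  exact ⟨κ, h0, h1, hκ, fun i => (isGreatest_ωmax h0 h1.le hκ.ge hmin i).csSup_eq,
    fun i c hc h => hc.fraction_le hmin h⟩

end Economy

namespace Economy

variable {n : ℕ} {E : Economy n}

open Filter Topology

/-! ### Sustainable rules: compactness, payoffs, mixtures -/

/-- This is the source of all concavity in the model: it is the utility of the young as a function
of the utility of the old. It holds because `exp` is strictly convex and `log` is increasing and
concave. -/
lemma strictConcaveOn_log_one_sub_exp :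
    StrictConcaveOn ℝ (Iio (0 : ℝ)) fun x => Real.log (1 - Real.exp x) := by
  refine ⟨convex_Iio 0, fun x hx y hy hxy a b ha hb hab => ?_⟩
  have hx' : 0 < 1 - Real.exp x := sub_pos.2 (Real.exp_lt_one_iff.2 hx)
  have hy' : 0 < 1 - Real.exp y := sub_pos.2 (Real.exp_lt_one_iff.2 hy)
  have h1 := strictConvexOn_exp.2 (mem_univ x) (mem_univ y) hxy ha hb hab
  have h2 := strictConcaveOn_log_Ioi.concaveOn.2 hx' hy' ha.le hb.le hab
  simp only [smul_eq_mul] at h1 h2 ⊢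
  refine h2.trans_lt (Real.log_lt_log (by positivity) ?_)
  have : a * (1 - Real.exp x) + b * (1 - Real.exp y) =
      (a + b) - (a * Real.exp x + b * Real.exp y) := by ring
  rw [this, hab]
  linarith

lemma IsMinimalFraction.exists_abs_periodPayoff_le {κ : ℝ} (H : E.IsMinimalFraction κ) :
    ∃ M, ∀ i c, E.IsSustainable i c → ∀ h, |E.periodPayoff (c h)| ≤ M := by
  have hcont : ContinuousOn E.periodPayoff (Icc (κ * E.s 0) (E.s (Fin.last n))) := by
    intro x hx
    have h0 : 0 < x := (mul_pos H.pos (E.s_pos 0)).trans_le hx.1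
    have h1 : 0 < 1 - x := by linarith [hx.2, E.s_lt_one (Fin.last n)]
    unfold periodPayoff
    refine ContinuousAt.continuousWithinAt ?_
    refine (continuousAt_const.mul (ContinuousAt.log (by fun_prop) h1.ne')).add
      (Real.continuousAt_log h0.ne')
  obtain ⟨M, hM⟩ := isCompact_Icc.exists_bound_of_continuousOn hcont
  refine ⟨M, fun i c hc h => hM _ ⟨?_, ?_⟩⟩
  · refine le_trans ?_ (H.le i c hc h)
    exact mul_le_mul_of_nonneg_left (E.s_strictMono.monotone (Fin.zero_le _)) H.pos.le
  · exact (hc.le h).trans (E.s_strictMono.monotone (Fin.le_last _))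

lemma sum_prod_prob (t : ℕ) : ∑ h : Fin t → Fin (n + 1), ∏ j, E.prob (h j) = 1 := by
  rw [← Fintype.sum_pow, E.prob_sum, one_pow]

/-- Expected payoff at date `t`. -/
noncomputable def datePayoff (E : Economy n) (c : List (Fin (n + 1)) → ℝ) (t : ℕ) : ℝ :=
  ∑ h : Fin t → Fin (n + 1), (∏ j, E.prob (h j)) * E.periodPayoff (c (List.ofFn h))

lemma abs_datePayoff_le {M : ℝ} {c : List (Fin (n + 1)) → ℝ}
    (hM : ∀ h, |E.periodPayoff (c h)| ≤ M) (t : ℕ) : |E.datePayoff c t| ≤ M := by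
  have hp : ∀ h : Fin t → Fin (n + 1), 0 ≤ ∏ j, E.prob (h j) := fun h =>
    Finset.prod_nonneg fun j _ => (E.prob_pos _).le
  refine (Finset.abs_sum_le_sum_abs _ _).trans ?_
  calc ∑ h : Fin t → Fin (n + 1), |(∏ j, E.prob (h j)) * E.periodPayoff (c (List.ofFn h))|
      ≤ ∑ h : Fin t → Fin (n + 1), (∏ j, E.prob (h j)) * M := by
        refine Finset.sum_le_sum fun h _ => ?_
        rw [abs_mul, abs_of_nonneg (hp h)]
        exact mul_le_mul_of_nonneg_left (hM _) (hp h)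
    _ = M := by rw [← Finset.sum_mul, sum_prod_prob, one_mul]

lemma summable_bound (M : ℝ) : Summable fun t : ℕ => E.δ ^ t * M :=
  (summable_geometric_of_lt_one E.δ_pos.le E.δ_lt_one).mul_right M

lemma norm_discounted_le {M : ℝ} {c : List (Fin (n + 1)) → ℝ}
    (hM : ∀ h, |E.periodPayoff (c h)| ≤ M) (t : ℕ) : ‖E.δ ^ t * E.datePayoff c t‖ ≤ E.δ ^ t * M := by
  rw [Real.norm_eq_abs, abs_mul, abs_of_nonneg (pow_nonneg E.δ_pos.le t)]
  exact mul_le_mul_of_nonneg_left (abs_datePayoff_le hM t) (pow_nonneg E.δ_pos.le t)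

lemma summable_payoff {M : ℝ} {c : List (Fin (n + 1)) → ℝ}
    (hM : ∀ h, |E.periodPayoff (c h)| ≤ M) : Summable fun t => E.δ ^ t * E.datePayoff c t :=
  Summable.of_norm_bounded (summable_bound M) (norm_discounted_le hM)

lemma datePayoff_zero (c : List (Fin (n + 1)) → ℝ) :
    E.datePayoff c 0 = E.periodPayoff (c []) := by
  simp [datePayoff]

lemma datePayoff_succ (c : List (Fin (n + 1)) → ℝ) (t : ℕ) :
    E.datePayoff c (t + 1) = ∑ r, E.prob r * E.datePayoff (fun h => c (r :: h)) t := by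
  unfold datePayoff
  rw [← (Fin.consEquiv fun _ : Fin (t + 1) => Fin (n + 1)).sum_comp, Fintype.sum_prod_type]
  refine Finset.sum_congr rfl fun r _ => ?_
  rw [Finset.mul_sum]
  refine Finset.sum_congr rfl fun h _ => ?_
  simp [Fin.consEquiv, Fin.prod_univ_succ, List.ofFn_succ, mul_assoc]

/-- The payoff is the current payoff plus the discounted expected continuation payoff. -/
lemma payoff_eq {M : ℝ} {c : List (Fin (n + 1)) → ℝ} (hM : ∀ h, |E.periodPayoff (c h)| ≤ M) :
    E.payoff c = E.periodPayoff (c []) +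
      E.δ * ∑ r, E.prob r * E.payoff fun h => c (r :: h) := by
  have hs := summable_payoff hM
  have hsr : ∀ r, Summable fun t => E.δ ^ t * E.datePayoff (fun h => c (r :: h)) t := fun r =>
    summable_payoff fun h => hM (r :: h)
  change ∑' t, E.δ ^ t * E.datePayoff c t = _
  rw [hs.tsum_eq_zero_add, pow_zero, one_mul, datePayoff_zero]
  congr 1
  have : ∀ t, E.δ ^ (t + 1) * E.datePayoff c (t + 1) =
      E.δ * ∑ r, E.prob r * (E.δ ^ t * E.datePayoff (fun h => c (r :: h)) t) := fun t => by
    rw [datePayoff_succ, pow_succ, Finset.mul_sum, Finset.mul_sum]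
    refine Finset.sum_congr rfl fun r _ => by ring
  simp_rw [this]
  rw [tsum_mul_left, Summable.tsum_finsetSum fun r _ => (hsr r).mul_left _]
  simp_rw [tsum_mul_left]
  rfl

/-- The product topology is used. Rules lie in a product of intervals `[κ s, s]`, on which all
logarithms are continuous, and each participation constraint involves finitely many coordinates, so
it is a closed condition. -/
lemma IsMinimalFraction.isCompact_sustainable {κ : ℝ} (H : E.IsMinimalFraction κ)
    (i : Fin (n + 1)) : IsCompact {c | E.IsSustainable i c} := by
  set B : Set (List (Fin (n + 1)) → ℝ) :=
    univ.pi fun h => Icc (κ * E.s (currentState i h)) (E.s (currentState i h))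
  have hB : IsCompact B := isCompact_univ_pi fun h => isCompact_Icc
  have hBc : IsClosed B := isClosed_set_pi fun h _ => isClosed_Icc
  have hpos : ∀ c ∈ B, ∀ h, 0 < c h := fun c hc h =>
    (mul_pos H.pos (E.s_pos _)).trans_le (hc h trivial).1
  have hlt : ∀ c ∈ B, ∀ h, c h < 1 := fun c hc h => (hc h trivial).2.trans_lt (E.s_lt_one _)
  let F : List (Fin (n + 1)) → (List (Fin (n + 1)) → ℝ) → ℝ := fun h c =>
    Real.log (c h) - Real.log (E.s (currentState i h)) +
      E.β * ∑ r, E.prob r * (Real.log (1 - c (h ++ [r])) - Real.log (1 - E.s r))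
  have hF : ∀ h, ContinuousOn (F h) B := fun h c hc => by
    refine ContinuousAt.continuousWithinAt ?_
    have hcont : ∀ h, ContinuousAt (fun c : List (Fin (n + 1)) → ℝ => c h) c := fun h =>
      (continuous_apply h).continuousAt
    refine (((hcont h).log (hpos c hc h).ne').sub
      continuousAt_const).add (continuousAt_const.mul (tendsto_finsetSum _ fun r _ => ?_))
    refine continuousAt_const.mul (ContinuousAt.sub (ContinuousAt.log ?_ ?_) continuousAt_const)
    · exact continuousAt_const.sub (hcont (h ++ [r]))
    · exact (sub_pos.2 (hlt c hc (h ++ [r]))).ne'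
  have hcl : IsClosed (B ∩ ⋂ h, (B ∩ F h ⁻¹' Ici 0)) :=
    hBc.inter (isClosed_iInter fun h => (hF h).preimage_isClosed_of_isClosed hBc isClosed_Ici)
  convert hB.of_isClosed_subset hcl inter_subset_left using 1
  ext c
  simp only [mem_ofPred_eq, mem_inter_iff, mem_iInter, mem_preimage, mem_Ici]
  refine ⟨fun hc => ?_, fun hc h => ⟨hpos c hc.1 h, (hc.1 h trivial).2, (hc.2 h).2⟩⟩
  have hcB : c ∈ B := fun h _ => ⟨H.le i c hc h, hc.le h⟩
  exact ⟨hcB, fun h => ⟨hcB, (hc h).2.2⟩⟩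

lemma IsMinimalFraction.continuousOn_payoff {κ : ℝ} (H : E.IsMinimalFraction κ)
    (i : Fin (n + 1)) : ContinuousOn E.payoff {c | E.IsSustainable i c} := by
  obtain ⟨M, hM⟩ := H.exists_abs_periodPayoff_le
  change ContinuousOn (fun c => ∑' t, E.δ ^ t * E.datePayoff c t) _
  refine continuousOn_tsum (fun t => ?_) (summable_bound (E := E) M)
    fun t c hc => norm_discounted_le (hM i c hc) t
  intro c hc
  refine ContinuousAt.continuousWithinAt (continuousAt_const.mul ?_)
  refine tendsto_finsetSum _ fun h _ => continuousAt_const.mul ?_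
  have hcont : ContinuousAt (fun c : List (Fin (n + 1)) → ℝ => c (List.ofFn h)) c :=
    (continuous_apply _).continuousAt
  unfold periodPayoff
  exact (continuousAt_const.mul ((continuousAt_const.sub hcont).log
    (sub_pos.2 (IsSustainable.lt_one hc _)).ne')).add
    (hcont.log (IsSustainable.pos hc _).ne')

lemma continuousOn_initial_promise (i : Fin (n + 1)) :
    ContinuousOn (fun c : List (Fin (n + 1)) → ℝ => Real.log (1 - c []))
      {c | E.IsSustainable i c} := fun c hc => by
  have hcont : ContinuousAt (fun c : List (Fin (n + 1)) → ℝ => c []) c :=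
    (continuous_apply _).continuousAt
  exact ((continuousAt_const.sub hcont).log
    (sub_pos.2 (IsSustainable.lt_one hc _)).ne').continuousWithinAt

/-- Geometric mixture, in terms of the consumption of the old, of two rules. -/
noncomputable def mix (a b : ℝ) (c₁ c₂ : List (Fin (n + 1)) → ℝ) (h : List (Fin (n + 1))) : ℝ :=
  1 - Real.exp (a * Real.log (1 - c₁ h) + b * Real.log (1 - c₂ h))

section Mix

variable {i : Fin (n + 1)} {c₁ c₂ : List (Fin (n + 1)) → ℝ} {a b : ℝ}

lemma log_one_sub_mix (h) : Real.log (1 - mix a b c₁ c₂ h) =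
    a * Real.log (1 - c₁ h) + b * Real.log (1 - c₂ h) := by
  simp [mix]

lemma log_one_sub_neg (h₁ : E.IsSustainable i c₁) (h) : Real.log (1 - c₁ h) < 0 :=
  Real.log_neg (by linarith [h₁.lt_one h]) (by linarith [h₁.pos h])

lemma le_log_mix (h₁ : E.IsSustainable i c₁) (h₂ : E.IsSustainable i c₂) (ha : 0 ≤ a) (hb : 0 ≤ b)
    (hab : a + b = 1) (h) :
    a * Real.log (c₁ h) + b * Real.log (c₂ h) ≤ Real.log (mix a b c₁ c₂ h) := by
  have := strictConcaveOn_log_one_sub_exp.concaveOn.2 (log_one_sub_neg h₁ h) (log_one_sub_neg h₂ h)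
    ha hb hab
  simp only [smul_eq_mul] at this
  rwa [Real.exp_log (by linarith [h₁.lt_one h]), Real.exp_log (by linarith [h₂.lt_one h]),
    sub_sub_cancel, sub_sub_cancel] at this

lemma isSustainable_mix (h₁ : E.IsSustainable i c₁) (h₂ : E.IsSustainable i c₂) (ha : 0 ≤ a)
    (hb : 0 ≤ b) (hab : a + b = 1) : E.IsSustainable i (mix a b c₁ c₂) := fun h => by
  have hl₁ := log_one_sub_neg h₁ h
  have hl₂ := log_one_sub_neg h₂ h
  refine ⟨?_, ?_, ?_⟩
  · refine sub_pos.2 (Real.exp_lt_one_iff.2 ?_)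
    rcases ha.eq_or_lt with rfl | ha'
    · have : b = 1 := by linarith
      subst this
      linarith
    · nlinarith
  · have k₁ := Real.log_le_log (E.one_sub_s_pos (currentState i h)) (sub_le_sub_left (h₁.le h) 1)
    have k₂ := Real.log_le_log (E.one_sub_s_pos (currentState i h)) (sub_le_sub_left (h₂.le h) 1)
    have : Real.log (1 - E.s (currentState i h)) ≤
        a * Real.log (1 - c₁ h) + b * Real.log (1 - c₂ h) := by
      have e : Real.log (1 - E.s (currentState i h)) = a * Real.log (1 - E.s (currentState i h)) +
        b * Real.log (1 - E.s (currentState i h)) := by rw [← add_mul, hab, one_mul]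
      rw [e]
      gcongr
    rw [Real.log_le_iff_le_exp (E.one_sub_s_pos _)] at this
    unfold mix
    linarith
  · have k₁ := (h₁ h).2.2
    have k₂ := (h₂ h).2.2
    have k := le_log_mix h₁ h₂ ha hb hab h
    simp only [log_one_sub_mix]
    have e : ∑ r, E.prob r * (a * Real.log (1 - c₁ (h ++ [r])) + b * Real.log (1 - c₂ (h ++ [r])) -
        Real.log (1 - E.s r)) =
        a * ∑ r, E.prob r * (Real.log (1 - c₁ (h ++ [r])) - Real.log (1 - E.s r)) +
        b * ∑ r, E.prob r * (Real.log (1 - c₂ (h ++ [r])) - Real.log (1 - E.s r)) := by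
      rw [Finset.mul_sum, Finset.mul_sum, ← Finset.sum_add_distrib]
      refine Finset.sum_congr rfl fun r _ => ?_
      have : b = 1 - a := by linarith
      subst this
      ring
    rw [e]
    have e2 : Real.log (E.s (currentState i h)) = a * Real.log (E.s (currentState i h)) +
        b * Real.log (E.s (currentState i h)) := by rw [← add_mul, hab, one_mul]
    have := add_nonneg (mul_nonneg ha k₁) (mul_nonneg hb k₂)
    rw [e2]
    linarith

lemma le_payoff_mix {M : ℝ} (hM : ∀ i c, E.IsSustainable i c → ∀ h, |E.periodPayoff (c h)| ≤ M)
    (h₁ : E.IsSustainable i c₁) (h₂ : E.IsSustainable i c₂) (ha : 0 ≤ a)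
    (hb : 0 ≤ b) (hab : a + b = 1) :
    a * E.payoff c₁ + b * E.payoff c₂ ≤ E.payoff (mix a b c₁ c₂) := by
  have s₁ := summable_payoff (hM i c₁ h₁)
  have s₂ := summable_payoff (hM i c₂ h₂)
  have s := summable_payoff (hM i _ (isSustainable_mix h₁ h₂ ha hb hab))
  have hp : ∀ h, a * E.periodPayoff (c₁ h) + b * E.periodPayoff (c₂ h) ≤
      E.periodPayoff (mix a b c₁ c₂ h) := fun h => by
    unfold periodPayoff
    rw [log_one_sub_mix]
    linarith [le_log_mix h₁ h₂ ha hb hab h]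
  change a * ∑' t, E.δ ^ t * E.datePayoff c₁ t + b * ∑' t, E.δ ^ t * E.datePayoff c₂ t ≤
    ∑' t, E.δ ^ t * E.datePayoff _ t
  rw [← tsum_mul_left, ← tsum_mul_left, ← (s₁.mul_left a).tsum_add (s₂.mul_left b)]
  refine ((s₁.mul_left a).add (s₂.mul_left b)).tsum_le_tsum (fun t => ?_) s
  have : a * E.datePayoff c₁ t + b * E.datePayoff c₂ t ≤ E.datePayoff (mix a b c₁ c₂) t := by
    unfold datePayoff
    rw [Finset.mul_sum, Finset.mul_sum, ← Finset.sum_add_distrib]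
    refine Finset.sum_le_sum fun h _ => ?_
    have := mul_le_mul_of_nonneg_left (hp (List.ofFn h))
      (Finset.prod_nonneg fun j _ => (E.prob_pos (h j)).le : 0 ≤ ∏ j, E.prob (h j))
    linarith
  have := mul_le_mul_of_nonneg_left this (pow_nonneg E.δ_pos.le t)
  linarith

end Mix

end Economy

namespace Economy

variable {n : ℕ} {E : Economy n} {κ : ℝ}

open Filter Topology

/-! ### The value function -/

variable (E) in
/-- Expected autarky utility of the old. -/
noncomputable def Amin : ℝ := ∑ r, E.prob r * E.ωmin r

variable (E) in
/-- Largest feasible expected promise. -/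
noncomputable def Amax : ℝ := ∑ r, E.prob r * E.ωmax r

variable (E) in
/-- Expected future promise that the young require in state `i` when the old get utility `x`. -/
noncomputable def need (i : Fin (n + 1)) (x : ℝ) : ℝ :=
  E.Amin + (Real.log (E.s i) - Real.log (1 - Real.exp x)) / E.β

variable (E) in
/-- Current payoff of the planner as a function of the utility of the old. -/
noncomputable def pay (x : ℝ) : ℝ := E.β / E.δ * x + Real.log (1 - Real.exp x)

lemma periodPayoff_eq {c : ℝ} (hc : c < 1) : E.periodPayoff c = E.pay (Real.log (1 - c)) := by
  rw [periodPayoff, pay, Real.exp_log (sub_pos.2 hc), sub_sub_cancel]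

lemma ωmin_neg (i : Fin (n + 1)) : E.ωmin i < 0 :=
  Real.log_neg (E.one_sub_s_pos i) (by linarith [E.s_pos i])

lemma IsMinimalFraction.ωmin_lt_ωmax (H : E.IsMinimalFraction κ) (i : Fin (n + 1)) :
    E.ωmin i < E.ωmax i := by
  rw [H.ωmax_eq]
  exact Real.log_lt_log (E.one_sub_s_pos i) (by nlinarith [E.s_pos i, H.lt_one])

lemma IsMinimalFraction.ωmax_neg (H : E.IsMinimalFraction κ) (i : Fin (n + 1)) :
    E.ωmax i < 0 := by
  rw [H.ωmax_eq]
  exact Real.log_neg (E.one_sub_mul_s_pos H.lt_one.le i)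
    (by linarith [mul_pos H.pos (E.s_pos i)])

lemma ωmin_strictAnti : StrictAnti E.ωmin := fun i j hij =>
  Real.log_lt_log (E.one_sub_s_pos j) (by linarith [E.s_strictMono hij])

lemma IsMinimalFraction.ωmax_strictAnti (H : E.IsMinimalFraction κ) : StrictAnti E.ωmax :=
  fun i j hij => by
    rw [H.ωmax_eq, H.ωmax_eq]
    exact Real.log_lt_log (E.one_sub_mul_s_pos H.lt_one.le j)
      (by nlinarith [E.s_strictMono hij, H.pos])

lemma need_ωmin (i : Fin (n + 1)) : E.need i (E.ωmin i) = E.Amin := by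
  rw [need, ωmin, Real.exp_log (E.one_sub_s_pos i), sub_sub_cancel]
  simp

lemma IsMinimalFraction.need_ωmax (H : E.IsMinimalFraction κ) (i : Fin (n + 1)) :
    E.need i (E.ωmax i) = E.Amax := by
  have h := H.slack
  have hβ := E.β_pos.ne'
  have e : ∑ r, E.prob r * (Real.log (1 - κ * E.s r) - Real.log (1 - E.s r)) =
      E.Amax - E.Amin := by
    rw [Amax, Amin, ← Finset.sum_sub_distrib]
    refine Finset.sum_congr rfl fun r _ => ?_
    rw [H.ωmax_eq, ωmin]
    ring
  rw [proportionalSlack, e] at h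
  rw [need, H.ωmax_eq, Real.exp_log (E.one_sub_mul_s_pos H.lt_one.le i), sub_sub_cancel,
    Real.log_mul H.pos.ne' (E.s_pos i).ne']
  field_simp
  linarith

lemma need_strictMonoOn (i : Fin (n + 1)) : StrictMonoOn (E.need i) (Iio 0) := fun x hx y hy hxy => by
  have h1 : 0 < 1 - Real.exp y := sub_pos.2 (Real.exp_lt_one_iff.2 hy)
  have h2 := Real.log_lt_log h1 (by linarith [Real.exp_lt_exp.2 hxy] : _ < 1 - Real.exp x)
  unfold need
  have := div_lt_div_of_pos_right (sub_lt_sub_left h2 (Real.log (E.s i))) E.β_pos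
  linarith

lemma need_lt_need {i j : Fin (n + 1)} (hij : i < j) (x : ℝ) : E.need i x < E.need j x := by
  have h2 := Real.log_lt_log (E.s_pos i) (E.s_strictMono hij)
  unfold need
  have := div_lt_div_of_pos_right (sub_lt_sub_right h2 (Real.log (1 - Real.exp x))) E.β_pos
  linarith

/-- Participation of the young in terms of the required future promise. -/
lemma need_le_iff (i : Fin (n + 1)) {c : ℝ} (hc : c < 1) (A : ℝ) :
    E.need i (Real.log (1 - c)) ≤ A ↔
      Real.log (E.s i) + E.β * ∑ r, E.prob r * Real.log (1 - E.s r) ≤ Real.log c + E.β * A := by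
  have : E.Amin = ∑ r, E.prob r * Real.log (1 - E.s r) := rfl
  rw [need, Real.exp_log (sub_pos.2 hc), sub_sub_cancel, ← this, ← le_sub_iff_add_le',
    div_le_iff₀ E.β_pos]
  constructor <;> intro h <;> linarith

lemma IsMinimalFraction.promise_mem (H : E.IsMinimalFraction κ) {i : Fin (n + 1)}
    {c : List (Fin (n + 1)) → ℝ} (hc : E.IsSustainable i c) :
    Real.log (1 - c []) ∈ Icc (E.ωmin i) (E.ωmax i) := by
  have h1 : κ * E.s i ≤ c [] := H.le i c hc []
  have h2 : c [] ≤ E.s i := hc.le []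
  rw [H.ωmax_eq]
  exact ⟨Real.log_le_log (E.one_sub_s_pos i) (by linarith),
    Real.log_le_log (by linarith [hc.lt_one []]) (by linarith)⟩

lemma IsMinimalFraction.exists_rule_promise (H : E.IsMinimalFraction κ) (i : Fin (n + 1)) :
    ∃ c, E.IsSustainable i c ∧ Real.log (1 - c []) = E.ωmax i :=
  ⟨_, isSustainable_proportional H.pos H.lt_one.le H.slack.ge i, (H.ωmax_eq i).symm⟩

/-- The value is attained. -/
lemma IsMinimalFraction.exists_optimal_rule (H : E.IsMinimalFraction κ) {i : Fin (n + 1)} {ω : ℝ}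
    (hω : ω ≤ E.ωmax i) : ∃ c, E.IsSustainable i c ∧ ω ≤ Real.log (1 - c []) ∧
      E.V i ω = E.payoff c ∧
      ∀ c', E.IsSustainable i c' → ω ≤ Real.log (1 - c' []) → E.payoff c' ≤ E.V i ω := by
  have hK := H.isCompact_sustainable i
  have hcl := (continuousOn_initial_promise (E := E) i).preimage_isClosed_of_isClosed hK.isClosed
    (isClosed_Ici (a := ω))
  have hK' := hK.of_isClosed_subset hcl inter_subset_left
  obtain ⟨c₀, hc₀, hp₀⟩ := H.exists_rule_promise i
  obtain ⟨c, hc, hmax⟩ := hK'.exists_isMaxOn ⟨c₀, hc₀, hω.trans hp₀.ge⟩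
    ((H.continuousOn_payoff i).mono inter_subset_left)
  have hgr : IsGreatest {v | ∃ c, E.IsSustainable i c ∧ ω ≤ Real.log (1 - c []) ∧
      v = E.payoff c} (E.payoff c) :=
    ⟨⟨c, hc.1, hc.2, rfl⟩, by rintro _ ⟨c', h1, h2, rfl⟩; exact hmax ⟨h1, h2⟩⟩
  have hV : E.V i ω = E.payoff c := hgr.csSup_eq
  exact ⟨c, hc.1, hc.2, hV, fun c' h1 h2 => hV ▸ hmax ⟨h1, h2⟩⟩

lemma IsMinimalFraction.payoff_le_V (H : E.IsMinimalFraction κ) {i : Fin (n + 1)} {ω : ℝ}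
    {c : List (Fin (n + 1)) → ℝ} (hc : E.IsSustainable i c) (hω : ω ≤ Real.log (1 - c [])) :
    E.payoff c ≤ E.V i ω := by
  obtain ⟨_, _, _, _, h⟩ := H.exists_optimal_rule (hω.trans (H.promise_mem hc).2)
  exact h c hc hω

lemma IsMinimalFraction.V_antitoneOn (H : E.IsMinimalFraction κ) (i : Fin (n + 1)) :
    AntitoneOn (E.V i) (Iic (E.ωmax i)) := fun ω _ ω' hω' h => by
  obtain ⟨c, hc, hp, hV, _⟩ := H.exists_optimal_rule hω'
  rw [hV]
  exact H.payoff_le_V hc (h.trans hp)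

lemma IsMinimalFraction.V_concaveOn (H : E.IsMinimalFraction κ) (i : Fin (n + 1)) :
    ConcaveOn ℝ (Iic (E.ωmax i)) (E.V i) := by
  obtain ⟨M, hM⟩ := H.exists_abs_periodPayoff_le
  refine ⟨convex_Iic _, fun x hx y hy a b ha hb hab => ?_⟩
  obtain ⟨c, hc, hp, hV, _⟩ := H.exists_optimal_rule hx
  obtain ⟨c', hc', hp', hV', _⟩ := H.exists_optimal_rule hy
  simp only [smul_eq_mul]
  rw [hV, hV']
  refine (le_payoff_mix hM hc hc' ha hb hab).trans
    (H.payoff_le_V (isSustainable_mix hc hc' ha hb hab) ?_)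
  rw [log_one_sub_mix]
  gcongr

/-- Feasible choices of the recursive problem do not exceed the value. -/
lemma IsMinimalFraction.bellman_le (H : E.IsMinimalFraction κ) {i : Fin (n + 1)} {ω x : ℝ}
    {w : Fin (n + 1) → ℝ} (hωx : ω ≤ x) (hx : E.ωmin i ≤ x) (hx0 : x < 0)
    (hw : ∀ r, w r ≤ E.ωmax r) (hneed : E.need i x ≤ ∑ r, E.prob r * w r) :
    E.pay x + E.δ * ∑ r, E.prob r * E.V r (w r) ≤ E.V i ω := by
  obtain ⟨M, hM⟩ := H.exists_abs_periodPayoff_le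
  choose c hc hp hV _ using fun r => H.exists_optimal_rule (hw r)
  set x' : ℝ := 1 - Real.exp x
  have hx' : 0 < x' := sub_pos.2 (Real.exp_lt_one_iff.2 hx0)
  have hx1 : x' < 1 := by linarith [Real.exp_pos x]
  have hlx : Real.log (1 - x') = x := by simp [x']
  -- Paste optimal continuation rules after a first period in which the old get exactly `x`.
  let C : List (Fin (n + 1)) → ℝ := fun h => match h with
    | [] => x'
    | r :: h => c r h
  have hC : E.IsSustainable i C := fun h => by
    match h with
    | [] =>
      refine ⟨hx', ?_, ?_⟩
      · change x' ≤ E.s i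
        have := Real.exp_le_exp.2 hx
        rw [ωmin, Real.exp_log (E.one_sub_s_pos i)] at this
        linarith
      · change 0 ≤ Real.log x' - Real.log (E.s i) +
          E.β * ∑ r, E.prob r * (Real.log (1 - c r []) - Real.log (1 - E.s r))
        have h1 : ∑ r, E.prob r * w r ≤ ∑ r, E.prob r * Real.log (1 - c r []) :=
          Finset.sum_le_sum fun r _ => mul_le_mul_of_nonneg_left (hp r) (E.prob_pos r).le
        rw [← hlx, need_le_iff i hx1] at hneed
        simp only [mul_sub, Finset.sum_sub_distrib]
        nlinarith [E.β_pos]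
    | r :: h =>
      have := hc r h
      rw [currentState_cons]
      exact this
  have hle := H.payoff_le_V (ω := ω) hC (by change ω ≤ Real.log (1 - x'); rwa [hlx])
  rw [payoff_eq (hM i C hC)] at hle
  have e1 : E.periodPayoff (C []) = E.pay x := by
    change E.periodPayoff x' = _
    rw [periodPayoff_eq hx1, hlx]
  have e2 : ∀ r, E.payoff (fun h => C (r :: h)) = E.V r (w r) := fun r => (hV r).symm
  rw [e1] at hle
  simpa only [e2] using hle

/-- The value is attained in the recursive problem. -/
lemma IsMinimalFraction.bellman_exists (H : E.IsMinimalFraction κ) {i : Fin (n + 1)} {ω : ℝ}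
    (hω : ω ≤ E.ωmax i) : ∃ (x : ℝ) (w : Fin (n + 1) → ℝ), ω ≤ x ∧ x ∈ Icc (E.ωmin i) (E.ωmax i) ∧
      (∀ r, w r ∈ Icc (E.ωmin r) (E.ωmax r)) ∧ E.need i x ≤ ∑ r, E.prob r * w r ∧
      E.V i ω = E.pay x + E.δ * ∑ r, E.prob r * E.V r (w r) := by
  obtain ⟨M, hM⟩ := H.exists_abs_periodPayoff_le
  obtain ⟨c, hc, hp, hV, _⟩ := H.exists_optimal_rule hω
  have hx := H.promise_mem hc
  have hw := fun r => H.promise_mem (hc.shift r)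
  have hneed : E.need i (Real.log (1 - c [])) ≤ ∑ r, E.prob r * Real.log (1 - c [r]) := by
    rw [need_le_iff i (hc.lt_one [])]
    have h2 : 0 ≤ Real.log (c []) - Real.log (E.s i) +
        E.β * ∑ r, E.prob r * (Real.log (1 - c [r]) - Real.log (1 - E.s r)) := (hc []).2.2
    simp only [mul_sub, Finset.sum_sub_distrib] at h2 ⊢
    linarith
  refine ⟨_, fun r => Real.log (1 - c [r]), hp, hx, hw, hneed, le_antisymm ?_ ?_⟩
  · rw [hV, payoff_eq (hM i c hc), periodPayoff_eq (hc.lt_one [])]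
    have := fun r => H.payoff_le_V (hc.shift r) le_rfl
    have hs : ∑ r, E.prob r * E.payoff (fun h => c (r :: h)) ≤
        ∑ r, E.prob r * E.V r (Real.log (1 - c [r])) :=
      Finset.sum_le_sum fun r _ => mul_le_mul_of_nonneg_left (this r) (E.prob_pos r).le
    have := mul_le_mul_of_nonneg_left hs E.δ_pos.le
    linarith
  · exact H.bellman_le hp hx.1 (hx.2.trans_lt (H.ωmax_neg i)) (fun r => (hw r).2) hneed

variable (E) in
/-- `w` maximizes the expected continuation value among promises with expectation at least `A`. -/
def IsInner (A : ℝ) (w : Fin (n + 1) → ℝ) : Prop :=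
  (∀ r, w r ≤ E.ωmax r) ∧ A ≤ ∑ r, E.prob r * w r ∧
    ∀ w' : Fin (n + 1) → ℝ, (∀ r, w' r ≤ E.ωmax r) → A ≤ ∑ r, E.prob r * w' r →
      ∑ r, E.prob r * E.V r (w' r) ≤ ∑ r, E.prob r * E.V r (w r)

/-- The maximization runs over tuples of continuation rules, which form a compact set, and not over
promises. Continuity of `V` at the largest promise is thus never needed. -/
lemma IsMinimalFraction.exists_isInner (H : E.IsMinimalFraction κ) {A : ℝ} (hA : A ≤ E.Amax) :
    ∃ w, E.IsInner A w := by
  set K : Set (Fin (n + 1) → List (Fin (n + 1)) → ℝ) := univ.pi fun r => {c | E.IsSustainable r c}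
  have hK : IsCompact K := isCompact_univ_pi fun r => H.isCompact_sustainable r
  have hmem : ∀ c ∈ K, ∀ r, E.IsSustainable r (c r) := fun c hc r => hc r trivial
  have hcomp : ∀ (F : (List (Fin (n + 1)) → ℝ) → ℝ) (r), ContinuousOn F {c | E.IsSustainable r c} →
      ContinuousOn (fun c : Fin (n + 1) → List (Fin (n + 1)) → ℝ => F (c r)) K := fun F r hF =>
    hF.comp (continuous_apply r).continuousOn fun c hc => hc r trivial
  have hP : ContinuousOn (fun c : Fin (n + 1) → List (Fin (n + 1)) → ℝ =>
      ∑ r, E.prob r * Real.log (1 - c r [])) K :=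
    continuousOn_finsetSum _ fun r _ => continuousOn_const.mul
      (hcomp (fun c => Real.log (1 - c [])) r (continuousOn_initial_promise r))
  have hV : ContinuousOn (fun c : Fin (n + 1) → List (Fin (n + 1)) → ℝ =>
      ∑ r, E.prob r * E.payoff (c r)) K :=
    continuousOn_finsetSum _ fun r _ => continuousOn_const.mul
      (hcomp E.payoff r (H.continuousOn_payoff r))
  have hcl := hP.preimage_isClosed_of_isClosed hK.isClosed (isClosed_Ici (a := A))
  choose c₀ hc₀ hp₀ using H.exists_rule_promise
  obtain ⟨c, hc, hmax⟩ := (hK.of_isClosed_subset hcl inter_subset_left).exists_isMaxOn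
    ⟨c₀, fun r _ => hc₀ r, by
      change A ≤ ∑ r, E.prob r * Real.log (1 - c₀ r [])
      simp only [hp₀]
      exact hA⟩ (hV.mono inter_subset_left)
  refine ⟨fun r => Real.log (1 - c r []), fun r => (H.promise_mem (hmem c hc.1 r)).2, hc.2,
    fun w' hw' hA' => ?_⟩
  choose c' h1 h2 h3 _ using fun r => H.exists_optimal_rule (hw' r)
  have hle : ∑ r, E.prob r * E.payoff (c' r) ≤ ∑ r, E.prob r * E.payoff (c r) :=
    hmax ⟨fun r _ => h1 r, hA'.trans
      (Finset.sum_le_sum fun r _ => mul_le_mul_of_nonneg_left (h2 r) (E.prob_pos r).le)⟩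
  simp only [h3]
  exact hle.trans (Finset.sum_le_sum fun r _ => mul_le_mul_of_nonneg_left
    (H.payoff_le_V (hmem c hc.1 r) le_rfl) (E.prob_pos r).le)

end Economy

namespace Economy

variable {n : ℕ} {E : Economy n} {κ : ℝ}

open Filter Topology

/-! ### The problem of allocating future promises, and the shape of the value function -/

variable (E) in
/-- Largest expected continuation value when the expected promise is at least `A`. -/
noncomputable def W (A : ℝ) : ℝ :=
  sSup {v | ∃ w : Fin (n + 1) → ℝ, (∀ r, w r ≤ E.ωmax r) ∧ A ≤ ∑ r, E.prob r * w r ∧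
    v = ∑ r, E.prob r * E.V r (w r)}

lemma IsInner.W_eq {A : ℝ} {w : Fin (n + 1) → ℝ} (hw : E.IsInner A w) :
    E.W A = ∑ r, E.prob r * E.V r (w r) :=
  IsGreatest.csSup_eq ⟨⟨w, hw.1, hw.2.1, rfl⟩, by rintro _ ⟨w', h1, h2, rfl⟩; exact hw.2.2 w' h1 h2⟩

lemma sum_le_Amax {w : Fin (n + 1) → ℝ} (hw : ∀ r, w r ≤ E.ωmax r) :
    ∑ r, E.prob r * w r ≤ E.Amax :=
  Finset.sum_le_sum fun r _ => mul_le_mul_of_nonneg_left (hw r) (E.prob_pos r).le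

lemma IsMinimalFraction.le_W (H : E.IsMinimalFraction κ) {A : ℝ} {w : Fin (n + 1) → ℝ}
    (hw : ∀ r, w r ≤ E.ωmax r) (hA : A ≤ ∑ r, E.prob r * w r) :
    ∑ r, E.prob r * E.V r (w r) ≤ E.W A := by
  obtain ⟨w', hw'⟩ := H.exists_isInner (hA.trans (sum_le_Amax hw))
  rw [hw'.W_eq]
  exact hw'.2.2 w hw hA

lemma IsMinimalFraction.W_antitoneOn (H : E.IsMinimalFraction κ) :
    AntitoneOn E.W (Iic E.Amax) := fun A _ B hB hAB => by
  obtain ⟨w, hw⟩ := H.exists_isInner hB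
  rw [hw.W_eq]
  exact H.le_W hw.1 (hAB.trans hw.2.1)

lemma IsMinimalFraction.W_concaveOn (H : E.IsMinimalFraction κ) :
    ConcaveOn ℝ (Iic E.Amax) E.W := by
  refine ⟨convex_Iic _, fun A hA B hB a b ha hb hab => ?_⟩
  obtain ⟨w, hw⟩ := H.exists_isInner hA
  obtain ⟨w', hw'⟩ := H.exists_isInner hB
  simp only [smul_eq_mul]
  rw [hw.W_eq, hw'.W_eq]
  have hsum : ∀ f g : Fin (n + 1) → ℝ, a * ∑ r, E.prob r * f r + b * ∑ r, E.prob r * g r =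
      ∑ r, E.prob r * (a * f r + b * g r) := fun f g => by
    rw [Finset.mul_sum, Finset.mul_sum, ← Finset.sum_add_distrib]
    exact Finset.sum_congr rfl fun r _ => by ring
  have hfeas : ∀ r, a * w r + b * w' r ≤ E.ωmax r := fun r => by
    have : E.ωmax r = a * E.ωmax r + b * E.ωmax r := by rw [← add_mul, hab, one_mul]
    rw [this]
    have h1 := hw.1 r
    have h2 := hw'.1 r
    gcongr
  refine le_trans ?_ (H.le_W hfeas ?_)
  · rw [hsum]
    exact Finset.sum_le_sum fun r _ => mul_le_mul_of_nonneg_left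
      ((H.V_concaveOn r).2 (hw.1 r) (hw'.1 r) ha hb hab) (E.prob_pos r).le
  · rw [← hsum]
    exact add_le_add (mul_le_mul_of_nonneg_left hw.2.1 ha) (mul_le_mul_of_nonneg_left hw'.2.1 hb)

variable (E) in
/-- Value of giving the old exactly the utility `x`. -/
noncomputable def exactValue (i : Fin (n + 1)) (x : ℝ) : ℝ := E.pay x + E.δ * E.W (E.need i x)

lemma IsMinimalFraction.need_le_Amax (H : E.IsMinimalFraction κ) {i : Fin (n + 1)} {x : ℝ}
    (hx : x ≤ E.ωmax i) : E.need i x ≤ E.Amax := by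
  rw [← H.need_ωmax i]
  exact (need_strictMonoOn i).monotoneOn (hx.trans_lt (H.ωmax_neg i)) (H.ωmax_neg i) hx

lemma IsMinimalFraction.exactValue_le (H : E.IsMinimalFraction κ) {i : Fin (n + 1)} {ω x : ℝ}
    (hωx : ω ≤ x) (hx : x ∈ Icc (E.ωmin i) (E.ωmax i)) : E.exactValue i x ≤ E.V i ω := by
  obtain ⟨w, hw⟩ := H.exists_isInner (H.need_le_Amax hx.2)
  rw [exactValue, hw.W_eq]
  exact H.bellman_le hωx hx.1 (hx.2.trans_lt (H.ωmax_neg i)) hw.1 hw.2.1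

lemma IsMinimalFraction.exists_exactValue (H : E.IsMinimalFraction κ) {i : Fin (n + 1)} {ω : ℝ}
    (hω : ω ≤ E.ωmax i) :
    ∃ x, ω ≤ x ∧ x ∈ Icc (E.ωmin i) (E.ωmax i) ∧ E.V i ω = E.exactValue i x := by
  obtain ⟨x, w, h1, hx, hw, hn, hV⟩ := H.bellman_exists hω
  refine ⟨x, h1, hx, le_antisymm ?_ (H.exactValue_le h1 hx)⟩
  rw [hV, exactValue]
  have := mul_le_mul_of_nonneg_left (H.le_W (fun r => (hw r).2) hn) E.δ_pos.le
  linarith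

lemma need_convexOn (i : Fin (n + 1)) : ConvexOn ℝ (Iio 0) (E.need i) := by
  refine ⟨convex_Iio _, fun x hx y hy a b ha hb hab => ?_⟩
  have := strictConcaveOn_log_one_sub_exp.concaveOn.2 hx hy ha hb hab
  simp only [smul_eq_mul] at this ⊢
  unfold need
  have hb' : b = 1 - a := by linarith
  have := div_le_div_of_nonneg_right this E.β_pos.le
  subst hb'
  simp only [sub_div, add_div, mul_div_assoc] at this ⊢
  linarith

lemma pay_strictConcaveOn : StrictConcaveOn ℝ (Iio 0) E.pay := by
  refine ⟨convex_Iio _, fun x hx y hy hxy a b ha hb hab => ?_⟩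
  have := strictConcaveOn_log_one_sub_exp.2 hx hy hxy ha hb hab
  simp only [smul_eq_mul] at this ⊢
  unfold pay
  linarith

lemma IsMinimalFraction.exactValue_strictConcaveOn (H : E.IsMinimalFraction κ) (i : Fin (n + 1)) :
    StrictConcaveOn ℝ (Iic (E.ωmax i)) (E.exactValue i) := by
  refine ⟨convex_Iic _, fun x hx y hy hxy a b ha hb hab => ?_⟩
  have hx0 : x ∈ Iio 0 := lt_of_le_of_lt hx (H.ωmax_neg i)
  have hy0 : y ∈ Iio 0 := lt_of_le_of_lt hy (H.ωmax_neg i)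
  have h1 := (pay_strictConcaveOn (E := E)).2 hx0 hy0 hxy ha hb hab
  have h2 := (need_convexOn (E := E) i).2 hx0 hy0 ha.le hb.le hab
  have h3 := H.W_concaveOn.2 (H.need_le_Amax hx) (H.need_le_Amax hy) ha.le hb.le hab
  have hle : a • E.need i x + b • E.need i y ∈ Iic E.Amax :=
    convex_Iic _ (H.need_le_Amax hx) (H.need_le_Amax hy) ha.le hb.le hab
  have h4 := H.W_antitoneOn (h2.trans hle) hle h2
  have h5 := mul_le_mul_of_nonneg_left (h3.trans h4) E.δ_pos.le
  simp only [smul_eq_mul, exactValue] at h1 h5 ⊢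
  linarith

/-- The point `x₀` maximizes `exactValue`. A lower promise does not bind; a higher one binds,
because a concave function decreases to the right of its maximizer. -/
lemma IsMinimalFraction.exists_peak (H : E.IsMinimalFraction κ) (i : Fin (n + 1)) :
    ∃ x₀ ∈ Icc (E.ωmin i) (E.ωmax i), (∀ ω ≤ x₀, E.V i ω = E.V i x₀) ∧
      ∀ ω ∈ Icc x₀ (E.ωmax i), E.V i ω = E.exactValue i ω := by
  have hlt := H.ωmin_lt_ωmax i
  obtain ⟨x₀, -, hx₀, hV⟩ := H.exists_exactValue hlt.le
  have hmin : ∀ ω ≤ E.ωmax i, E.V i ω ≤ E.V i (E.ωmin i) := fun ω hω => by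
    obtain ⟨x, -, hx, hVx⟩ := H.exists_exactValue hω
    rw [hVx]
    exact H.exactValue_le hx.1 hx
  have hlow : ∀ ω ≤ x₀, E.V i ω = E.exactValue i x₀ := fun ω hω =>
    le_antisymm (hV ▸ hmin ω (hω.trans hx₀.2)) (H.exactValue_le hω hx₀)
  refine ⟨x₀, hx₀, fun ω hω => (hlow ω hω).trans (hlow x₀ le_rfl).symm, fun ω hω => ?_⟩
  refine le_antisymm ?_ (H.exactValue_le le_rfl ⟨hx₀.1.trans hω.1, hω.2⟩)
  obtain ⟨x, hωx, hx, hVx⟩ := H.exists_exactValue hω.2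
  rw [hVx]
  have hx' : E.exactValue i x ≤ E.exactValue i x₀ := by
    rw [← hV]
    exact H.exactValue_le hx.1 hx
  have hseg : ω ∈ segment ℝ x₀ x := by
    rw [segment_eq_Icc (hω.1.trans hωx)]
    exact ⟨hω.1, hωx⟩
  have := (H.exactValue_strictConcaveOn i).concaveOn.ge_on_segment hx₀.2 hx.2 hseg
  rwa [min_eq_right hx'] at this

lemma strictAntiOn_of_strictConcaveOn {f : ℝ → ℝ} {s : Set ℝ} (hf : StrictConcaveOn ℝ s f)
    (ha : AntitoneOn f s) : StrictAntiOn f s := fun x hx y hy hxy => by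
  refine lt_of_le_of_ne (ha hx hy hxy.le) fun he => ?_
  have h := hf.2 hx hy hxy.ne (by norm_num : (0 : ℝ) < 1 / 2) (by norm_num : (0 : ℝ) < 1 / 2)
    (by norm_num)
  have hm := hf.1 hx hy (by norm_num : (0 : ℝ) ≤ 1 / 2) (by norm_num : (0 : ℝ) ≤ 1 / 2)
    (by norm_num)
  have h2 := ha hx hm (by simp only [smul_eq_mul]; linarith)
  simp only [smul_eq_mul] at h h2
  linarith

/-- To the left of `x₀` the derivative is zero because `V` is constant; to the right it cannot be
zero because `V` is concave and has strictly fallen since `x₀`. Differentiability at `x₀` itself is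
not needed, as `ω0` is a supremum. -/
lemma IsMinimalFraction.ω0_eq_peak (H : E.IsMinimalFraction κ) {i : Fin (n + 1)} {x₀ : ℝ}
    (hx₀ : x₀ ∈ Icc (E.ωmin i) (E.ωmax i)) (hlow : ∀ ω ≤ x₀, E.V i ω = E.V i x₀)
    (hV : ∀ ω ∈ Icc x₀ (E.ωmax i), E.V i ω = E.exactValue i ω) : E.ω0 i = x₀ := by
  have hanti : StrictAntiOn (E.V i) (Icc x₀ (E.ωmax i)) := by
    refine strictAntiOn_of_strictConcaveOn ?_ ((H.V_antitoneOn i).mono Icc_subset_Iic_self)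
    exact ((H.exactValue_strictConcaveOn i).subset Icc_subset_Iic_self (convex_Icc _ _)).congr
      fun ω hω => (hV ω hω).symm
  have hup : ∀ ω ∈ E.Ω i, HasDerivWithinAt (E.V i) 0 (E.Ω i) ω → ω ≤ x₀ := fun ω hω hd => by
    by_contra! hlt
    have h1 := ((H.V_concaveOn i).subset Icc_subset_Iic_self
      (convex_Icc (E.ωmin i) (E.ωmax i))).le_slope_of_hasDerivWithinAt hx₀ hω hlt hd
    have h2 := hanti ⟨le_rfl, hx₀.2⟩ ⟨hlt.le, hω.2⟩ hlt
    rw [slope_def_field] at h1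
    exact absurd h1 (not_le.2 (div_neg_of_neg_of_pos (by linarith) (by linarith)))
  have hdn : ∀ ω < x₀, HasDerivWithinAt (E.V i) 0 (E.Ω i) ω := fun ω hω => by
    have : E.V i =ᶠ[𝓝 ω] fun _ => E.V i x₀ := by
      filter_upwards [Iio_mem_nhds hω] with y hy using hlow y (le_of_lt hy)
    exact ((hasDerivAt_const ω (E.V i x₀)).congr_of_eventuallyEq this).hasDerivWithinAt
  unfold ω0
  split_ifs with hd
  · refine le_antisymm (csSup_le ⟨E.ωmin i, ⟨⟨le_rfl, (H.ωmin_lt_ωmax i).le⟩, hd⟩⟩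
      fun ω hω => hup ω hω.1 hω.2) ?_
    have hbdd : BddAbove {ω | ω ∈ E.Ω i ∧ HasDerivWithinAt (E.V i) 0 (E.Ω i) ω} :=
      ⟨x₀, fun ω hω => hup ω hω.1 hω.2⟩
    have h0 : E.ωmin i ≤ sSup {ω | ω ∈ E.Ω i ∧ HasDerivWithinAt (E.V i) 0 (E.Ω i) ω} :=
      le_csSup hbdd ⟨⟨le_rfl, (H.ωmin_lt_ωmax i).le⟩, hd⟩
    refine le_of_forall_lt_imp_le_of_dense fun y hy => ?_
    rcases le_total y (E.ωmin i) with h | h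
    · exact h.trans h0
    · exact le_csSup hbdd ⟨⟨h, hy.le.trans hx₀.2⟩, hdn y hy⟩
  · by_contra hne
    exact hd (hdn _ (lt_of_le_of_ne hx₀.1 hne))

lemma IsMinimalFraction.ω0_spec (H : E.IsMinimalFraction κ) (i : Fin (n + 1)) :
    E.ω0 i ∈ Icc (E.ωmin i) (E.ωmax i) ∧ (∀ ω ≤ E.ω0 i, E.V i ω = E.V i (E.ω0 i)) ∧
      ∀ ω ∈ Icc (E.ω0 i) (E.ωmax i), E.V i ω = E.exactValue i ω := by
  obtain ⟨x₀, h1, h2, h3⟩ := H.exists_peak i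
  rw [H.ω0_eq_peak h1 h2 h3]
  exact ⟨h1, h2, h3⟩

lemma IsMinimalFraction.ωmin_le_ω0 (H : E.IsMinimalFraction κ) (i : Fin (n + 1)) :
    E.ωmin i ≤ E.ω0 i := (H.ω0_spec i).1.1

lemma IsMinimalFraction.ω0_le_ωmax (H : E.IsMinimalFraction κ) (i : Fin (n + 1)) :
    E.ω0 i ≤ E.ωmax i := (H.ω0_spec i).1.2

lemma IsMinimalFraction.V_le_V_ω0 (H : E.IsMinimalFraction κ) (i : Fin (n + 1)) {ω : ℝ}
    (hω : ω ≤ E.ωmax i) : E.V i ω ≤ E.V i (E.ω0 i) := by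
  rcases le_total ω (E.ω0 i) with h | h
  · exact ((H.ω0_spec i).2.1 ω h).le
  · exact H.V_antitoneOn i (H.ω0_le_ωmax i) hω h

lemma IsMinimalFraction.V_strictConcaveOn (H : E.IsMinimalFraction κ) (i : Fin (n + 1)) :
    StrictConcaveOn ℝ (Icc (E.ω0 i) (E.ωmax i)) (E.V i) :=
  ((H.exactValue_strictConcaveOn i).subset Icc_subset_Iic_self (convex_Icc _ _)).congr
    fun ω hω => ((H.ω0_spec i).2.2 ω hω).symm

lemma IsMinimalFraction.V_strictAntiOn (H : E.IsMinimalFraction κ) (i : Fin (n + 1)) :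
    StrictAntiOn (E.V i) (Icc (E.ω0 i) (E.ωmax i)) :=
  strictAntiOn_of_strictConcaveOn (H.V_strictConcaveOn i)
    ((H.V_antitoneOn i).mono Icc_subset_Iic_self)

lemma IsMinimalFraction.V_max_ω0 (H : E.IsMinimalFraction κ) (i : Fin (n + 1)) (ω : ℝ) :
    E.V i (max ω (E.ω0 i)) = E.V i ω := by
  rcases le_total ω (E.ω0 i) with h | h
  · rw [max_eq_right h, (H.ω0_spec i).2.1 ω h]
  · rw [max_eq_left h]

end Economy

namespace Economy

variable {n : ℕ} {E : Economy n} {κ : ℝ}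

open Filter Topology

/-! ### Optimal future promises and the policy functions -/

variable (E) in
/-- Expected value of the lowest promises that the planner ever makes. -/
noncomputable def A0 : ℝ := ∑ r, E.prob r * E.ω0 r

open Classical in
variable (E) in
/-- The largest optimal promises when the expected promise has to be at least `A`. -/
noncomputable def G (A : ℝ) : Fin (n + 1) → ℝ :=
  if h : E.A0 < A ∧ ∃ w, E.IsInner A w then h.2.choose else E.ω0

lemma sum_update (w : Fin (n + 1) → ℝ) (F : Fin (n + 1) → ℝ → ℝ) (p : Fin (n + 1)) (y : ℝ) :
    ∑ r, E.prob r * F r (Function.update w p y r) =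
      ∑ r, E.prob r * F r (w r) + E.prob p * (F p y - F p (w p)) := by
  rw [← sub_eq_iff_eq_add', ← Finset.sum_sub_distrib, Finset.sum_eq_single p]
  · simp only [Function.update_self]
    ring
  · intro r _ hr
    simp only [Function.update_of_ne hr, sub_self]
  · simp

lemma exists_lt_of_A0_lt {w : Fin (n + 1) → ℝ} (h : E.A0 < ∑ r, E.prob r * w r) :
    ∃ p, E.ω0 p < w p := by
  obtain ⟨p, -, hp⟩ := Finset.exists_lt_of_sum_lt h
  exact ⟨p, lt_of_mul_lt_mul_left hp (E.prob_pos p).le⟩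

lemma IsMinimalFraction.sum_eq_of_isInner (H : E.IsMinimalFraction κ) {A : ℝ}
    {w : Fin (n + 1) → ℝ} (hA : E.A0 ≤ A) (hw : E.IsInner A w) : ∑ r, E.prob r * w r = A := by
  refine le_antisymm ?_ hw.2.1
  by_contra! hlt
  obtain ⟨p, hp⟩ := exists_lt_of_A0_lt (hA.trans_lt hlt)
  -- Lower one promise that exceeds `ω0` until the slack is used up or `ω0` is reached; this raises
  -- the value.
  set y := max (E.ω0 p) (w p - (∑ r, E.prob r * w r - A) / E.prob p)
  have hdiv : 0 < (∑ r, E.prob r * w r - A) / E.prob p := div_pos (by linarith) (E.prob_pos p)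
  have hy : y < w p := max_lt hp (by linarith)
  have h1 := hw.2.2 (Function.update w p y) (fun r => by
    rcases eq_or_ne r p with rfl | hr
    · rw [Function.update_self]
      exact hy.le.trans (hw.1 _)
    · rw [Function.update_of_ne hr]
      exact hw.1 r) (by
    rw [sum_update w (fun _ x => x) p y]
    have h2 : w p - (∑ r, E.prob r * w r - A) / E.prob p ≤ y := le_max_right _ _
    have h3 := mul_le_mul_of_nonneg_left h2 (E.prob_pos p).le
    rw [mul_sub, mul_div_cancel₀ _ (E.prob_pos p).ne'] at h3
    linarith)
  rw [sum_update] at h1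
  have h2 : E.V p (w p) < E.V p y :=
    H.V_strictAntiOn p ⟨le_max_left _ _, hy.le.trans (hw.1 p)⟩ ⟨hp.le, hw.1 p⟩ hy
  linarith [mul_pos (E.prob_pos p) (sub_pos.2 h2)]

/-- Raising promises to `ω0` is free, since `V` is flat there. If this changed anything, another
optimum would have slack, contrary to `sum_eq_of_isInner`. -/
lemma IsMinimalFraction.ω0_le_of_isInner (H : E.IsMinimalFraction κ) {A : ℝ}
    {w : Fin (n + 1) → ℝ} (hA : E.A0 ≤ A) (hw : E.IsInner A w) (r) : E.ω0 r ≤ w r := by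
  by_contra! hlt
  have hlt' : ∑ r, E.prob r * w r < ∑ r, E.prob r * max (w r) (E.ω0 r) :=
    Finset.sum_lt_sum (fun q _ => mul_le_mul_of_nonneg_left (le_max_left _ _) (E.prob_pos q).le)
      ⟨r, Finset.mem_univ _, mul_lt_mul_of_pos_left (lt_max_of_lt_right hlt) (E.prob_pos r)⟩
  have h2 : E.IsInner A fun r => max (w r) (E.ω0 r) := by
    refine ⟨fun r => max_le (hw.1 r) (H.ω0_le_ωmax r), hw.2.1.trans hlt'.le, ?_⟩
    simp only [H.V_max_ω0]
    exact hw.2.2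
  have h3 := H.sum_eq_of_isInner hA h2
  linarith [hw.2.1]

lemma IsMinimalFraction.isInner_unique (H : E.IsMinimalFraction κ) {A : ℝ}
    {w w' : Fin (n + 1) → ℝ} (hA : E.A0 ≤ A) (hw : E.IsInner A w) (hw' : E.IsInner A w') :
    w = w' := by
  by_contra hne
  obtain ⟨p, hp⟩ := Function.ne_iff.1 hne
  have hI := fun r => (⟨H.ω0_le_of_isInner hA hw r, hw.1 r⟩ : w r ∈ Icc (E.ω0 r) (E.ωmax r))
  have hI' := fun r => (⟨H.ω0_le_of_isInner hA hw' r, hw'.1 r⟩ : w' r ∈ Icc (E.ω0 r) (E.ωmax r))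
  have hsum : ∀ f g : Fin (n + 1) → ℝ,
      (1 / 2 : ℝ) * ∑ r, E.prob r * f r + (1 / 2 : ℝ) * ∑ r, E.prob r * g r =
      ∑ r, E.prob r * ((1 / 2 : ℝ) * f r + (1 / 2 : ℝ) * g r) := fun f g => by
    rw [Finset.mul_sum, Finset.mul_sum, ← Finset.sum_add_distrib]
    exact Finset.sum_congr rfl fun r _ => by ring
  have h1 := hw.2.2 (fun r => (1 / 2 : ℝ) * w r + (1 / 2 : ℝ) * w' r)
    (fun r => by linarith [hw.1 r, hw'.1 r])
    (by rw [← hsum]; linarith [hw.2.1, hw'.2.1])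
  have heq := le_antisymm (hw'.2.2 w hw.1 hw.2.1) (hw.2.2 w' hw'.1 hw'.2.1)
  have hlt : ∑ r, E.prob r * ((1 / 2 : ℝ) * E.V r (w r) + (1 / 2 : ℝ) * E.V r (w' r)) <
      ∑ r, E.prob r * E.V r ((1 / 2 : ℝ) * w r + (1 / 2 : ℝ) * w' r) := by
    refine Finset.sum_lt_sum (fun r _ => mul_le_mul_of_nonneg_left ?_ (E.prob_pos r).le)
      ⟨p, Finset.mem_univ _, mul_lt_mul_of_pos_left ?_ (E.prob_pos p)⟩
    · exact (H.V_strictConcaveOn r).concaveOn.2 (hI r) (hI' r) (by norm_num) (by norm_num)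
        (by norm_num)
    · exact (H.V_strictConcaveOn p).2 (hI p) (hI' p) hp (by norm_num) (by norm_num) (by norm_num)
  rw [← hsum] at hlt
  linarith

lemma IsMinimalFraction.G_isInner (H : E.IsMinimalFraction κ) {A : ℝ} (hA : A ≤ E.Amax) :
    E.IsInner A (E.G A) := by
  unfold G
  split_ifs with h
  · exact h.2.choose_spec
  · have hle : A ≤ E.A0 := by
      by_contra! hlt
      exact h ⟨hlt, H.exists_isInner hA⟩
    exact ⟨H.ω0_le_ωmax, hle, fun w' hw' _ => Finset.sum_le_sum fun r _ =>
      mul_le_mul_of_nonneg_left (H.V_le_V_ω0 r (hw' r)) (E.prob_pos r).le⟩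

lemma G_of_le_A0 {A : ℝ} (hA : A ≤ E.A0) : E.G A = E.ω0 :=
  dif_neg fun h => not_lt.2 hA h.1

lemma IsMinimalFraction.ω0_le_G (H : E.IsMinimalFraction κ) {A : ℝ} (hA : A ≤ E.Amax) (r) :
    E.ω0 r ≤ E.G A r := by
  rcases le_total A E.A0 with h | h
  · rw [G_of_le_A0 h]
  · exact H.ω0_le_of_isInner h (H.G_isInner hA) r

lemma IsMinimalFraction.G_le_ωmax (H : E.IsMinimalFraction κ) {A : ℝ} (hA : A ≤ E.Amax) (r) :
    E.G A r ≤ E.ωmax r := (H.G_isInner hA).1 r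

lemma IsMinimalFraction.sum_G (H : E.IsMinimalFraction κ) {A : ℝ} (hA : A ≤ E.Amax) :
    ∑ r, E.prob r * E.G A r = max A E.A0 := by
  rcases le_total A E.A0 with h | h
  · rw [G_of_le_A0 h, max_eq_right h, A0]
  · rw [H.sum_eq_of_isInner h (H.G_isInner hA), max_eq_left h]

/-- This justifies the tie-break. For `A ≥ A0` the solution is unique. For smaller `A` the flat
parts of `V` allow many solutions, but going above `ω0` in any state loses value. -/
lemma IsMinimalFraction.isInner_le_G (H : E.IsMinimalFraction κ) {A : ℝ} (hA : A ≤ E.Amax)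
    {w : Fin (n + 1) → ℝ} (hw : E.IsInner A w) (r) : w r ≤ E.G A r := by
  rcases le_total E.A0 A with h | h
  · rw [H.isInner_unique h hw (H.G_isInner hA)]
  · rw [G_of_le_A0 h]
    by_contra! hlt
    have h1 := (H.G_isInner hA)
    rw [G_of_le_A0 h] at h1
    have h2 : ∑ r, E.prob r * E.V r (w r) < ∑ r, E.prob r * E.V r (E.ω0 r) :=
      Finset.sum_lt_sum (fun q _ => mul_le_mul_of_nonneg_left (H.V_le_V_ω0 q (hw.1 q))
        (E.prob_pos q).le) ⟨r, Finset.mem_univ _, mul_lt_mul_of_pos_left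
          (H.V_strictAntiOn r ⟨le_rfl, H.ω0_le_ωmax r⟩ ⟨hlt.le, hw.1 r⟩ hlt) (E.prob_pos r)⟩
    exact absurd (hw.2.2 _ h1.1 h1.2.1) (not_le.2 h2)

lemma IsMinimalFraction.G_Amax (H : E.IsMinimalFraction κ) (r) : E.G E.Amax r = E.ωmax r := by
  have h1 : E.IsInner E.Amax E.ωmax := by
    refine ⟨fun _ => le_rfl, le_rfl, fun w' hw' hA => Finset.sum_le_sum fun r _ => ?_⟩
    have heq := (Finset.sum_eq_sum_iff_of_le fun r _ =>
      mul_le_mul_of_nonneg_left (hw' r) (E.prob_pos r).le).1 (le_antisymm (sum_le_Amax hw') hA) r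
      (Finset.mem_univ r)
    rw [mul_left_cancel₀ (E.prob_pos r).ne' heq]
  exact le_antisymm (H.G_le_ωmax le_rfl r) (H.isInner_le_G le_rfl h1 r)

lemma IsMinimalFraction.max_mem (H : E.IsMinimalFraction κ) {i : Fin (n + 1)} {ω : ℝ}
    (hω : ω ∈ E.Ω i) : max ω (E.ω0 i) ∈ Icc (E.ωmin i) (E.ωmax i) :=
  ⟨hω.1.trans (le_max_left _ _), max_le hω.2 (H.ω0_le_ωmax i)⟩

lemma IsMinimalFraction.V_eq_exactValue_max (H : E.IsMinimalFraction κ) {i : Fin (n + 1)} {ω : ℝ}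
    (hω : ω ∈ E.Ω i) : E.V i ω = E.exactValue i (max ω (E.ω0 i)) := by
  rw [← H.V_max_ω0, (H.ω0_spec i).2.2 _ ⟨le_max_right _ _, (H.max_mem hω).2⟩]

lemma IsMinimalFraction.objective_eq {c : ℝ} {w : Fin (n + 1) → ℝ} (hc : c < 1) :
    E.objective c w = E.pay (Real.log (1 - c)) + E.δ * ∑ r, E.prob r * E.V r (w r) := by
  rw [← periodPayoff_eq hc, objective, periodPayoff]

lemma Feasible.lt_one {i : Fin (n + 1)} {ω c : ℝ} {w : Fin (n + 1) → ℝ}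
    (h : E.Feasible i ω c w) : c < 1 := h.old_participation.trans_lt (E.s_lt_one i)

lemma Feasible.need_le {i : Fin (n + 1)} {ω c : ℝ} {w : Fin (n + 1) → ℝ}
    (h : E.Feasible i ω c w) : E.need i (Real.log (1 - c)) ≤ ∑ r, E.prob r * w r :=
  (need_le_iff i h.lt_one _).2 h.young_participation

lemma IsMinimalFraction.feasible_mem (H : E.IsMinimalFraction κ) {i : Fin (n + 1)} {ω c : ℝ}
    {w : Fin (n + 1) → ℝ} (h : E.Feasible i ω c w) :
    Real.log (1 - c) ∈ Icc (E.ωmin i) (E.ωmax i) := by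
  refine ⟨Real.log_le_log (E.one_sub_s_pos i) (by linarith [h.old_participation]), ?_⟩
  have h1 := h.need_le.trans (sum_le_Amax h.le_ωmax)
  rw [← H.need_ωmax i] at h1
  have hneg : Real.log (1 - c) < 0 :=
    Real.log_neg (by linarith [h.lt_one]) (by linarith [h.c_pos])
  exact ((need_strictMonoOn i).le_iff_le hneg (H.ωmax_neg i)).1 h1

lemma IsMinimalFraction.feasible_le (H : E.IsMinimalFraction κ) {i : Fin (n + 1)} {ω c : ℝ}
    {w : Fin (n + 1) → ℝ} (h : E.Feasible i ω c w) :
    E.objective c w ≤ E.exactValue i (Real.log (1 - c)) := by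
  rw [objective_eq h.lt_one, exactValue]
  have := mul_le_mul_of_nonneg_left (H.le_W h.le_ωmax h.need_le) E.δ_pos.le
  linarith

lemma IsMinimalFraction.isOptimal_policy (H : E.IsMinimalFraction κ) {i : Fin (n + 1)} {ω : ℝ}
    (hω : ω ∈ E.Ω i) :
    E.IsOptimal i ω (1 - Real.exp (max ω (E.ω0 i))) (E.G (E.need i (max ω (E.ω0 i)))) ∧
      E.objective (1 - Real.exp (max ω (E.ω0 i))) (E.G (E.need i (max ω (E.ω0 i)))) = E.V i ω := by
  set x := max ω (E.ω0 i)
  have hx : x ∈ Icc (E.ωmin i) (E.ωmax i) := H.max_mem hω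
  have hlog : Real.log (1 - (1 - Real.exp x)) = x := by simp
  have hx1 : 1 - Real.exp x < 1 := by linarith [Real.exp_pos x]
  have hA := H.need_le_Amax hx.2
  have hobj : E.objective (1 - Real.exp x) (E.G (E.need i x)) = E.V i ω := by
    rw [objective_eq hx1, hlog, H.V_eq_exactValue_max hω, exactValue, (H.G_isInner hA).W_eq]
  have hexp := Real.exp_le_exp.2 hx.1
  rw [ωmin, Real.exp_log (E.one_sub_s_pos i)] at hexp
  refine ⟨⟨⟨sub_pos.2 (Real.exp_lt_one_iff.2 (hx.2.trans_lt (H.ωmax_neg i))), ?_, by linarith,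
    H.G_le_ωmax hA, fun r => (H.ωmin_le_ω0 r).trans (H.ω0_le_G hA r), ?_⟩, fun c' w' h => ?_⟩, hobj⟩
  · rw [hlog]
    exact le_max_left _ _
  · rw [← need_le_iff i hx1, hlog]
    exact (H.G_isInner hA).2.1
  · rw [hobj]
    exact (H.feasible_le h).trans (H.exactValue_le h.promise_keeping (H.feasible_mem h))

lemma IsMinimalFraction.isOptimal_unique (H : E.IsMinimalFraction κ) {i : Fin (n + 1)} {ω c : ℝ}
    {w : Fin (n + 1) → ℝ} (hω : ω ∈ E.Ω i) (h : E.IsOptimal i ω c w) :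
    c = 1 - Real.exp (max ω (E.ω0 i)) ∧ E.IsInner (E.need i (max ω (E.ω0 i))) w := by
  obtain ⟨hopt, hobj⟩ := H.isOptimal_policy hω
  have hx := H.max_mem hω
  have hf := h.1
  have hy := H.feasible_mem hf
  have hval : E.objective c w = E.V i ω :=
    le_antisymm (hobj ▸ hopt.2 c w hf) (hobj ▸ h.2 _ _ hopt.1)
  have hex : E.exactValue i (Real.log (1 - c)) = E.V i ω :=
    le_antisymm (H.exactValue_le hf.promise_keeping hy) (hval ▸ H.feasible_le hf)
  have hlog : Real.log (1 - c) = max ω (E.ω0 i) := by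
    -- The midpoint of two different maximizers of `exactValue` would do strictly better.
    by_contra hne
    have h1 := (H.exactValue_strictConcaveOn i).2 hy.2 hx.2 hne
      (by norm_num : (0 : ℝ) < 1 / 2) (by norm_num : (0 : ℝ) < 1 / 2) (by norm_num)
    rw [hex, ← H.V_eq_exactValue_max hω] at h1
    have h2 := H.exactValue_le (i := i) (ω := ω)
      (x := (1 / 2 : ℝ) • Real.log (1 - c) + (1 / 2 : ℝ) • max ω (E.ω0 i))
      (by
        simp only [smul_eq_mul]
        linarith [hf.promise_keeping, le_max_left ω (E.ω0 i)])
      (convex_Icc _ _ hy hx (by norm_num) (by norm_num) (by norm_num))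
    simp only [smul_eq_mul] at h1 h2
    linarith
  refine ⟨by rw [← hlog, Real.exp_log (by linarith [hf.lt_one]), sub_sub_cancel], hf.le_ωmax,
    hlog ▸ hf.need_le, fun w' h1 h2 => ?_⟩
  have h3 := H.le_W h1 h2
  rw [objective_eq hf.lt_one, hlog] at hval
  have h4 := H.V_eq_exactValue_max hω
  rw [exactValue, ← hval] at h4
  have := E.δ_pos
  have h5 : ∑ r, E.prob r * E.V r (w r) = E.W (E.need i (max ω (E.ω0 i))) :=
    mul_left_cancel₀ this.ne' (by linarith)
  rw [h5]
  exact h3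

lemma IsMinimalFraction.isPolicyChoice_iff (H : E.IsMinimalFraction κ) {i : Fin (n + 1)} {ω c : ℝ}
    {w : Fin (n + 1) → ℝ} (hω : ω ∈ E.Ω i) : E.IsPolicyChoice i ω c w ↔
      c = 1 - Real.exp (max ω (E.ω0 i)) ∧ w = E.G (E.need i (max ω (E.ω0 i))) := by
  have hA := H.need_le_Amax (H.max_mem hω).2
  constructor
  · intro h
    obtain ⟨h1, h2⟩ := H.isOptimal_unique hω h.1
    refine ⟨h1, funext fun r => le_antisymm (H.isInner_le_G hA h2 r) ?_⟩
    exact h.2 _ _ (H.isOptimal_policy hω).1 r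
  · rintro ⟨rfl, rfl⟩
    exact ⟨(H.isOptimal_policy hω).1, fun c' w' h r =>
      H.isInner_le_G hA (H.isOptimal_unique hω h).2 r⟩

lemma IsMinimalFraction.exists_unique_policyChoice (H : E.IsMinimalFraction κ) {i : Fin (n + 1)}
    {ω : ℝ} (hω : ω ∈ E.Ω i) :
    (∃! p : ℝ × (Fin (n + 1) → ℝ), E.IsPolicyChoice i ω p.1 p.2) ∧
      ∀ c w, E.IsPolicyChoice i ω c w → E.V i ω = E.objective c w := by
  refine ⟨⟨(_, _), (H.isPolicyChoice_iff hω).2 ⟨rfl, rfl⟩, fun p hp => ?_⟩, fun c w h => ?_⟩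
  · obtain ⟨h1, h2⟩ := (H.isPolicyChoice_iff hω).1 hp
    exact Prod.ext h1 h2
  · obtain ⟨rfl, rfl⟩ := (H.isPolicyChoice_iff hω).1 h
    exact (H.isOptimal_policy hω).2.symm

end Economy

open Filter Topology

/-! ### One-sided derivatives of concave functions -/

section OneSided

variable {F K : ℝ → ℝ} {b x y : ℝ}

lemma ConcaveOn.hasDerivWithinAt_Ioi (hF : ConcaveOn ℝ (Iic b) F) (hx : x < b) :
    HasDerivWithinAt F (derivWithin F (Ioi x) x) (Ioi x) x := by
  have h := (hF.neg.differentiableWithinAt_Ioi_of_mem_interior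
    (x := x) (by rw [interior_Iic]; exact hx)).neg
  rw [neg_neg] at h
  exact h.hasDerivWithinAt

lemma ConcaveOn.hasDerivWithinAt_Iio (hF : ConcaveOn ℝ (Iic b) F) (hx : x < b) :
    HasDerivWithinAt F (derivWithin F (Iio x) x) (Iio x) x := by
  have h := (hF.neg.differentiableWithinAt_Iio_of_mem_interior
    (x := x) (by rw [interior_Iic]; exact hx)).neg
  rw [neg_neg] at h
  exact h.hasDerivWithinAt

lemma ConcaveOn.slope_le_derivWithin_Ioi (hF : ConcaveOn ℝ (Iic b) F) (hxy : x < y) (hy : y ≤ b) :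
    slope F x y ≤ derivWithin F (Ioi x) x :=
  hF.slope_le_of_hasDerivWithinAt_Ioi (hxy.le.trans hy) hy hxy
    (hF.hasDerivWithinAt_Ioi (hxy.trans_le hy))

lemma ConcaveOn.derivWithin_Iio_le_slope (hF : ConcaveOn ℝ (Iic b) F) (hxy : x < y) (hy : y < b) :
    derivWithin F (Iio y) y ≤ slope F x y :=
  hF.le_slope_of_hasDerivWithinAt_Iio (hxy.le.trans hy.le) hy.le hxy
    (hF.hasDerivWithinAt_Iio hy)

lemma ConcaveOn.derivWithin_Iio_le_Ioi (hF : ConcaveOn ℝ (Iic b) F) (hxy : x < y) (hy : y < b) :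
    derivWithin F (Iio y) y ≤ derivWithin F (Ioi x) x :=
  (hF.derivWithin_Iio_le_slope hxy hy).trans (hF.slope_le_derivWithin_Ioi hxy hy.le)

lemma ConcaveOn.derivWithin_Ioi_le_Iio (hF : ConcaveOn ℝ (Iic b) F) (hx : x < b) :
    derivWithin F (Ioi x) x ≤ derivWithin F (Iio x) x := by
  have h1 := hasDerivWithinAt_iff_tendsto_slope' self_notMem_Iio |>.1 (hF.hasDerivWithinAt_Iio hx)
  have h2 := hasDerivWithinAt_iff_tendsto_slope' self_notMem_Ioi |>.1 (hF.hasDerivWithinAt_Ioi hx)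
  refine ge_of_tendsto h1 ?_
  filter_upwards [self_mem_nhdsWithin] with z (hz : z < x)
  refine le_of_tendsto h2 ?_
  filter_upwards [Ioo_mem_nhdsGT hx] with y hy
  have := hF.slope_anti_adjacent (hz.le.trans hx.le) hy.2.le hz hy.1
  rw [slope_comm F x z, slope_def_field, slope_def_field]
  exact this

lemma StrictConcaveOn.derivWithin_Iio_lt_Ioi (hF : ConcaveOn ℝ (Iic b) F) {s : Set ℝ}
    (hs : StrictConcaveOn ℝ s F) (hxs : x ∈ s) (hys : y ∈ s) (hxy : x < y) (hy : y < b) :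
    derivWithin F (Iio y) y < derivWithin F (Ioi x) x := by
  have h1 := hF.slope_le_derivWithin_Ioi (by linarith : x < (x + y) / 2) (by linarith)
  have h2 := hF.derivWithin_Iio_le_slope (by linarith : (x + y) / 2 < y) hy
  have h3 := hs.slope_anti_adjacent hxs hys (by linarith : x < (x + y) / 2)
    (by linarith : (x + y) / 2 < y)
  rw [slope_def_field] at h1 h2
  linarith

/-- Envelope argument without smoothness: `exactValue` lies below `V` and touches it, which orders
the one-sided derivatives. -/
lemma derivWithin_Ioi_le_of_touch {k f : ℝ} (hK : HasDerivWithinAt K k (Ioi x) x)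
    (hF : HasDerivWithinAt F f (Ioi x) x) (hx : K x = F x) (h : ∀ᶠ y in 𝓝[>] x, K y ≤ F y) :
    k ≤ f := by
  have h1 := hasDerivWithinAt_iff_tendsto_slope' self_notMem_Ioi |>.1 hK
  have h2 := hasDerivWithinAt_iff_tendsto_slope' self_notMem_Ioi |>.1 hF
  refine le_of_tendsto_of_tendsto h1 h2 ?_
  filter_upwards [h, self_mem_nhdsWithin] with y hy (hxy : x < y)
  rw [slope_def_field, slope_def_field, hx]
  exact div_le_div_of_nonneg_right (by linarith) (by linarith)

lemma derivWithin_Iio_le_of_touch {k f : ℝ} (hK : HasDerivWithinAt K k (Iio x) x)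
    (hF : HasDerivWithinAt F f (Iio x) x) (hx : K x = F x) (h : ∀ᶠ y in 𝓝[<] x, K y ≤ F y) :
    f ≤ k := by
  have h1 := hasDerivWithinAt_iff_tendsto_slope' self_notMem_Iio |>.1 hK
  have h2 := hasDerivWithinAt_iff_tendsto_slope' self_notMem_Iio |>.1 hF
  refine le_of_tendsto_of_tendsto h2 h1 ?_
  filter_upwards [h, self_mem_nhdsWithin] with y hy (hxy : y < x)
  rw [slope_def_field, slope_def_field, hx]
  exact div_le_div_of_nonpos_of_le (by linarith) (by linarith)

lemma derivWithin_Iio_nonpos (hF : ConcaveOn ℝ (Iic b) F) (ha : AntitoneOn F (Iic b)) (hx : x < b) :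
    derivWithin F (Iio x) x ≤ 0 := by
  refine (hF.derivWithin_Iio_le_slope (by linarith : x - 1 < x) hx).trans ?_
  rw [slope_def_field]
  have := ha (by simp only [mem_Iic]; linarith) hx.le (by linarith : x - 1 ≤ x)
  exact div_nonpos_of_nonpos_of_nonneg (by linarith) (by linarith)

end OneSided

namespace Economy

variable {n : ℕ} {E : Economy n} {κ : ℝ}

/-! ### Multipliers -/

variable (E) in
/-- Multiplier of the promise, normalized to one when the promise does not bind, from the right
derivative of a value function. -/
noncomputable def νr (F : ℝ → ℝ) (x : ℝ) : ℝ := 1 - E.δ / E.β * derivWithin F (Ioi x) x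

variable (E) in
/-- Multiplier of the promise from the left derivative of a value function. -/
noncomputable def νl (F : ℝ → ℝ) (x : ℝ) : ℝ := 1 - E.δ / E.β * derivWithin F (Iio x) x

lemma δ_div_β_pos : 0 < E.δ / E.β := div_pos E.δ_pos E.β_pos

lemma one_sub_mul_le {a b : ℝ} (h : a ≤ b) : 1 - E.δ / E.β * b ≤ 1 - E.δ / E.β * a :=
  sub_le_sub_left (mul_le_mul_of_nonneg_left h δ_div_β_pos.le) 1

lemma one_sub_mul_lt {a b : ℝ} (h : a < b) : 1 - E.δ / E.β * b < 1 - E.δ / E.β * a :=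
  sub_lt_sub_left (mul_lt_mul_of_pos_left h δ_div_β_pos) 1

lemma νl_le_νr {F : ℝ → ℝ} {b x : ℝ} (hF : ConcaveOn ℝ (Iic b) F) (hx : x < b) :
    E.νl F x ≤ E.νr F x := one_sub_mul_le (hF.derivWithin_Ioi_le_Iio hx)

lemma νr_le_νl {F : ℝ → ℝ} {b x y : ℝ} (hF : ConcaveOn ℝ (Iic b) F) (hxy : x < y) (hy : y < b) :
    E.νr F x ≤ E.νl F y := one_sub_mul_le (hF.derivWithin_Iio_le_Ioi hxy hy)

lemma νl_mono {F : ℝ → ℝ} {b x y : ℝ} (hF : ConcaveOn ℝ (Iic b) F) (hxy : x ≤ y) (hy : y < b) :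
    E.νl F x ≤ E.νl F y := by
  rcases hxy.eq_or_lt with rfl | h
  · exact le_rfl
  · exact (νl_le_νr hF (h.trans hy)).trans (νr_le_νl hF h hy)

lemma νr_mono {F : ℝ → ℝ} {b x y : ℝ} (hF : ConcaveOn ℝ (Iic b) F) (hxy : x ≤ y) (hy : y < b) :
    E.νr F x ≤ E.νr F y := by
  rcases hxy.eq_or_lt with rfl | h
  · exact le_rfl
  · exact (νr_le_νl hF h hy).trans (νl_le_νr hF hy)

lemma one_le_νl {F : ℝ → ℝ} {b x : ℝ} (hF : ConcaveOn ℝ (Iic b) F) (ha : AntitoneOn F (Iic b))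
    (hx : x < b) : 1 ≤ E.νl F x := by
  have := one_sub_mul_le (E := E) (derivWithin_Iio_nonpos hF ha hx)
  rwa [mul_zero, sub_zero] at this

lemma IsMinimalFraction.one_le_νl_W (H : E.IsMinimalFraction κ) {A : ℝ} (hA : A < E.Amax) :
    1 ≤ E.νl E.W A := one_le_νl H.W_concaveOn H.W_antitoneOn hA

lemma IsMinimalFraction.one_le_νr_W (H : E.IsMinimalFraction κ) {A : ℝ} (hA : A < E.Amax) :
    1 ≤ E.νr E.W A := (H.one_le_νl_W hA).trans (νl_le_νr H.W_concaveOn hA)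

lemma IsMinimalFraction.one_le_νr_V (H : E.IsMinimalFraction κ) {i : Fin (n + 1)} {x : ℝ}
    (hx : x < E.ωmax i) : 1 ≤ E.νr (E.V i) x :=
  (one_le_νl (H.V_concaveOn i) (H.V_antitoneOn i) hx).trans (νl_le_νr (H.V_concaveOn i) hx)

lemma IsMinimalFraction.νr_V_lt_νl_V (H : E.IsMinimalFraction κ) {i : Fin (n + 1)} {x y : ℝ}
    (hx : E.ω0 i ≤ x) (hxy : x < y) (hy : y < E.ωmax i) : E.νr (E.V i) x < E.νl (E.V i) y :=
  one_sub_mul_lt (StrictConcaveOn.derivWithin_Iio_lt_Ioi (H.V_concaveOn i)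
    (H.V_strictConcaveOn i) ⟨hx, (hxy.trans hy).le⟩ ⟨hx.trans hxy.le, hy.le⟩ hxy hy)

/-! ### Ratio of marginal utilities and the first best -/

variable (E) in
/-- Ratio of the marginal utilities of the young and the old relative to the first best, when the
old get utility `x`. -/
noncomputable def R (x : ℝ) : ℝ := E.δ / E.β * (Real.exp x / (1 - Real.exp x))

lemma one_sub_exp_pos {x : ℝ} (hx : x < 0) : 0 < 1 - Real.exp x :=
  sub_pos.2 (Real.exp_lt_one_iff.2 hx)

lemma R_pos {x : ℝ} (hx : x < 0) : 0 < E.R x :=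
  mul_pos δ_div_β_pos (div_pos (Real.exp_pos x) (one_sub_exp_pos hx))

lemma R_strictMonoOn : StrictMonoOn E.R (Iio 0) := fun x hx y hy hxy => by
  refine mul_lt_mul_of_pos_left ?_ δ_div_β_pos
  have := Real.exp_lt_exp.2 hxy
  exact div_lt_div₀ this (by linarith) (Real.exp_pos y).le (one_sub_exp_pos hy)

variable (E) in
/-- Utility of the old in the unconstrained first best. -/
noncomputable def ωfb : ℝ := Real.log (E.β / (E.β + E.δ))

lemma exp_ωfb : Real.exp E.ωfb = E.β / (E.β + E.δ) :=
  Real.exp_log (div_pos E.β_pos (add_pos E.β_pos E.δ_pos))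

lemma ωfb_neg : E.ωfb < 0 := by
  have := E.δ_pos
  have := E.β_pos
  exact Real.log_neg (by positivity) ((div_lt_one (by positivity)).2 (by linarith))

lemma R_ωfb : E.R E.ωfb = 1 := by
  have := E.δ_pos
  have := E.β_pos
  rw [R, exp_ωfb]
  have : 1 - E.β / (E.β + E.δ) = E.δ / (E.β + E.δ) := by
    field_simp
    ring
  rw [this]
  field_simp

lemma hasDerivAt_log_one_sub_exp {x : ℝ} (hx : x < 0) :
    HasDerivAt (fun x => Real.log (1 - Real.exp x)) (-(Real.exp x / (1 - Real.exp x))) x := by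
  have h := (((Real.hasDerivAt_exp x).const_sub 1).log (one_sub_exp_pos hx).ne')
  exact h.congr_deriv (neg_div _ _)

lemma hasDerivAt_pay {x : ℝ} (hx : x < 0) :
    HasDerivAt E.pay (E.β / E.δ * (1 - E.R x)) x := by
  have h := ((hasDerivAt_id x).const_mul (E.β / E.δ)).add (hasDerivAt_log_one_sub_exp hx)
  refine h.congr_deriv ?_
  have := E.δ_pos.ne'
  have := E.β_pos.ne'
  have := (one_sub_exp_pos hx).ne'
  unfold R
  field_simp
  ring

lemma hasDerivAt_need (i : Fin (n + 1)) {x : ℝ} (hx : x < 0) :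
    HasDerivAt (E.need i) (E.R x / E.δ) x := by
  have h := ((((hasDerivAt_log_one_sub_exp hx).const_sub (Real.log (E.s i))).div_const
    E.β).const_add E.Amin)
  refine h.congr_deriv ?_
  have := E.δ_pos.ne'
  have := E.β_pos.ne'
  have := (one_sub_exp_pos hx).ne'
  unfold R
  field_simp

/-! ### Envelope inequalities between the multipliers of current and future promises -/

lemma IsMinimalFraction.need_lt_Amax (H : E.IsMinimalFraction κ) {i : Fin (n + 1)} {x : ℝ}
    (hx : x < E.ωmax i) : E.need i x < E.Amax := by
  rw [← H.need_ωmax i]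
  exact need_strictMonoOn i (hx.trans (H.ωmax_neg i)) (H.ωmax_neg i) hx

/-- The bracket is the derivative of `exactValue` when `W` has derivative `d` and `R x = ρ`. The
normalization of the multipliers turns the chain rule into a pure multiplication by `R`. -/
lemma multiplier_identity (ρ d : ℝ) :
    1 - E.δ / E.β * (E.β / E.δ * (1 - ρ) + E.δ * (d * (ρ / E.δ))) = ρ * (1 - E.δ / E.β * d) := by
  have := E.δ_pos.ne'
  have := E.β_pos.ne'
  field_simp
  ring

/-- The multiplier of the current promise is at most `R` times the multiplier of the future
promises. -/
lemma IsMinimalFraction.νr_V_le (H : E.IsMinimalFraction κ) {i : Fin (n + 1)} {x : ℝ}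
    (h0 : E.ω0 i ≤ x) (hx : x < E.ωmax i) :
    E.νr (E.V i) x ≤ E.R x * E.νr E.W (E.need i x) := by
  have hneg := hx.trans (H.ωmax_neg i)
  have hW := H.W_concaveOn.hasDerivWithinAt_Ioi (H.need_lt_Amax hx)
  have hmaps : MapsTo (E.need i) (Ioo x (E.ωmax i)) (Ioi (E.need i x)) := fun y hy =>
    need_strictMonoOn i hneg (hy.2.trans (H.ωmax_neg i)) hy.1
  have hWn := ((hW.comp x (hasDerivAt_need i hneg).hasDerivWithinAt hmaps).mono_of_mem_nhdsWithin
    (Ioo_mem_nhdsGT hx)).const_mul E.δ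
  have hK := (hasDerivAt_pay (E := E) hneg).hasDerivWithinAt.add hWn
  have hle := derivWithin_Ioi_le_of_touch (K := E.exactValue i) hK
    ((H.V_concaveOn i).hasDerivWithinAt_Ioi hx) ((H.ω0_spec i).2.2 x ⟨h0, hx.le⟩).symm (by
      filter_upwards [Ioo_mem_nhdsGT hx] with y hy
      exact H.exactValue_le le_rfl ⟨((H.ωmin_le_ω0 i).trans h0).trans hy.1.le, hy.2.le⟩)
  rw [νr, νr, ← multiplier_identity]
  exact one_sub_mul_le hle

lemma IsMinimalFraction.le_νl_V (H : E.IsMinimalFraction κ) {i : Fin (n + 1)} {x : ℝ}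
    (h0 : E.ω0 i ≤ x) (hmin : E.ωmin i < x) (hx : x < E.ωmax i) :
    E.R x * E.νl E.W (E.need i x) ≤ E.νl (E.V i) x := by
  have hneg := hx.trans (H.ωmax_neg i)
  have hW := H.W_concaveOn.hasDerivWithinAt_Iio (H.need_lt_Amax hx)
  have hmaps : MapsTo (E.need i) (Iio x) (Iio (E.need i x)) := fun y hy =>
    need_strictMonoOn i (lt_trans hy hneg) hneg hy
  have hWn := (hW.comp x (hasDerivAt_need i hneg).hasDerivWithinAt hmaps).const_mul E.δ
  have hK := (hasDerivAt_pay (E := E) hneg).hasDerivWithinAt.add hWn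
  have hle := derivWithin_Iio_le_of_touch (K := E.exactValue i) hK
    ((H.V_concaveOn i).hasDerivWithinAt_Iio hx) ((H.ω0_spec i).2.2 x ⟨h0, hx.le⟩).symm (by
      filter_upwards [Ioo_mem_nhdsLT hmin] with y hy
      exact H.exactValue_le le_rfl ⟨hy.1.le, hy.2.le.trans hx.le⟩)
  rw [νl, νl, ← multiplier_identity]
  exact one_sub_mul_le hle

/-- Effect on the continuation value of changing one optimal promise. -/
lemma IsMinimalFraction.le_W_perturb (H : E.IsMinimalFraction κ) {A : ℝ} (hA : A ≤ E.Amax)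
    (r : Fin (n + 1)) {z : ℝ} (hz : z ≤ E.ωmax r) :
    E.W A + E.prob r * (E.V r z - E.V r (E.G A r)) ≤ E.W (A + E.prob r * (z - E.G A r)) ∧
      A + E.prob r * (z - E.G A r) ≤ E.Amax := by
  have hG := H.G_isInner hA
  have hw : ∀ q, Function.update (E.G A) r z q ≤ E.ωmax q := fun q => by
    rcases eq_or_ne q r with rfl | hq
    · rwa [Function.update_self]
    · rw [Function.update_of_ne hq]
      exact hG.1 q
  have hs : A + E.prob r * (z - E.G A r) ≤ ∑ q, E.prob q * Function.update (E.G A) r z q := by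
    rw [sum_update (E.G A) (fun _ x => x) r z]
    linarith [hG.2.1]
  have h := H.le_W hw hs
  rw [sum_update, ← hG.W_eq] at h
  exact ⟨h, hs.trans (sum_le_Amax hw)⟩

/-- Moving one promise changes both the expected promise and the expected value by a factor `prob
r`, which cancels in the slope. -/
lemma IsMinimalFraction.derivWithin_W_le_slope (H : E.IsMinimalFraction κ) {A : ℝ}
    (hA : A < E.Amax) {r : Fin (n + 1)} {z : ℝ} (hz : z < E.G A r) :
    derivWithin E.W (Iio A) A ≤ slope (E.V r) z (E.G A r) := by
  have hp := E.prob_pos r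
  have hpz := mul_pos hp (sub_pos.2 hz)
  have h1 := (H.le_W_perturb hA.le r (hz.le.trans (H.G_le_ωmax hA.le r))).1
  refine (H.W_concaveOn.derivWithin_Iio_le_slope
    (by linarith : A + E.prob r * (z - E.G A r) < A) hA).trans ?_
  rw [slope_def_field, slope_def_field,
    show A - (A + E.prob r * (z - E.G A r)) = E.prob r * (E.G A r - z) by ring,
    div_le_div_iff₀ hpz (sub_pos.2 hz)]
  nlinarith [sub_pos.2 hz]

lemma IsMinimalFraction.slope_le_derivWithin_W (H : E.IsMinimalFraction κ) {A : ℝ}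
    (hA : A < E.Amax) {r : Fin (n + 1)} {z : ℝ} (hz : E.G A r < z) (hz' : z ≤ E.ωmax r) :
    slope (E.V r) (E.G A r) z ≤ derivWithin E.W (Ioi A) A := by
  have hp := E.prob_pos r
  have hpz := mul_pos hp (sub_pos.2 hz)
  obtain ⟨h1, h2⟩ := H.le_W_perturb hA.le r hz'
  refine le_trans ?_ (H.W_concaveOn.slope_le_derivWithin_Ioi
    (by linarith : A < A + E.prob r * (z - E.G A r)) h2)
  rw [slope_def_field, slope_def_field,
    show A + E.prob r * (z - E.G A r) - A = E.prob r * (z - E.G A r) by ring,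
    div_le_div_iff₀ (sub_pos.2 hz) hpz]
  nlinarith [sub_pos.2 hz]

lemma IsMinimalFraction.νr_W_le (H : E.IsMinimalFraction κ) {A : ℝ} (hA : A < E.Amax)
    {r : Fin (n + 1)} (hr : E.G A r < E.ωmax r) : E.νr E.W A ≤ E.νr (E.V r) (E.G A r) := by
  refine one_sub_mul_le (le_of_tendsto (hasDerivWithinAt_iff_tendsto_slope' self_notMem_Ioi |>.1
    ((H.V_concaveOn r).hasDerivWithinAt_Ioi hr)) ?_)
  filter_upwards [Ioo_mem_nhdsGT hr] with z hz
  exact H.slope_le_derivWithin_W hA hz.1 hz.2.le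

lemma IsMinimalFraction.νl_V_le (H : E.IsMinimalFraction κ) {A : ℝ} (hA : A < E.Amax)
    {r : Fin (n + 1)} (hr : E.G A r < E.ωmax r) : E.νl (E.V r) (E.G A r) ≤ E.νl E.W A := by
  refine one_sub_mul_le (ge_of_tendsto (hasDerivWithinAt_iff_tendsto_slope' self_notMem_Iio |>.1
    ((H.V_concaveOn r).hasDerivWithinAt_Iio hr)) ?_)
  filter_upwards [self_mem_nhdsWithin] with z hz
  rw [slope_comm]
  exact H.derivWithin_W_le_slope hA hz

lemma IsMinimalFraction.νl_V_le_of_lt (H : E.IsMinimalFraction κ) {A : ℝ} (hA : A < E.Amax)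
    {r : Fin (n + 1)} {y : ℝ} (hy : y < E.G A r) : E.νl (E.V r) y ≤ E.νl E.W A :=
  one_sub_mul_le ((H.derivWithin_W_le_slope hA hy).trans
    (((H.V_concaveOn r).slope_le_derivWithin_Ioi hy (H.G_le_ωmax hA.le r)).trans
      ((H.V_concaveOn r).derivWithin_Ioi_le_Iio (hy.trans_le (H.G_le_ωmax hA.le r)))))

end Economy

namespace Economy

variable {n : ℕ} {E : Economy n} {κ : ℝ}

open Filter Topology

/-! ### Standing assumptions in terms of the utility of the old -/

variable (E) in
/-- The assumptions on the economy, in terms of the utility of the old. -/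
structure Regular (κ : ℝ) : Prop extends E.IsMinimalFraction κ where
  low : E.ωfb ≤ E.ωmin 0
  last : E.ωmin (Fin.last n) < E.ωfb
  nofb : ∑ r, E.prob r * E.ωstar r < E.need (Fin.last n) E.ωfb

lemma one_sub_fb : 1 - E.δ / (E.β + E.δ) = E.β / (E.β + E.δ) := by
  have := E.δ_pos
  have := E.β_pos
  field_simp
  ring

lemma log_one_sub_cstar (i : Fin (n + 1)) : Real.log (1 - E.cstar i) = E.ωstar i := by
  have h1 : 0 < E.β / (E.β + E.δ) := div_pos E.β_pos (add_pos E.β_pos E.δ_pos)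
  unfold cstar ωstar ωmin
  rcases le_total (E.δ / (E.β + E.δ)) (E.s i) with h | h
  · rw [min_eq_left h, one_sub_fb, max_eq_right]
    rw [← one_sub_fb] at h1 ⊢
    exact Real.log_le_log (E.one_sub_s_pos i) (by linarith)
  · rw [min_eq_right h, max_eq_left]
    rw [← one_sub_fb] at h1 ⊢
    exact Real.log_le_log h1 (by linarith)

lemma regular_of_assumptions (H : E.IsMinimalFraction κ)
    (h_low : E.s 0 ≤ E.δ / (E.β + E.δ))
    (h_nofb : Real.log (E.cstar (Fin.last n)) + E.β * ∑ r, E.prob r * Real.log (1 - E.cstar r) <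
      Real.log (E.s (Fin.last n)) + E.β * ∑ r, E.prob r * Real.log (1 - E.s r)) :
    E.Regular κ := by
  have h1 : 0 < E.β / (E.β + E.δ) := div_pos E.β_pos (add_pos E.β_pos E.δ_pos)
  have hlast : E.δ / (E.β + E.δ) < E.s (Fin.last n) := by
    by_contra! hle
    have hc : E.cstar = E.s := funext fun r =>
      min_eq_right ((E.s_strictMono.monotone (Fin.le_last r)).trans hle)
    rw [hc] at h_nofb
    exact lt_irrefl _ h_nofb
  refine ⟨H, ?_, ?_, ?_⟩
  · exact Real.log_le_log h1 (by rw [← one_sub_fb]; linarith)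
  · exact Real.log_lt_log (E.one_sub_s_pos _) (by rw [← one_sub_fb]; linarith)
  · have hc : E.cstar (Fin.last n) = E.δ / (E.β + E.δ) := min_eq_left hlast.le
    simp only [log_one_sub_cstar] at h_nofb
    rw [hc] at h_nofb
    have hfb1 : E.δ / (E.β + E.δ) < 1 := hlast.trans (E.s_lt_one _)
    have := (not_congr (need_le_iff (Fin.last n) hfb1 (∑ r, E.prob r * E.ωstar r))).2
      (not_le.2 h_nofb)
    rw [one_sub_fb] at this
    exact not_le.1 this

/-! ### Bounds on the lowest promises -/

lemma pay_strictAntiOn : StrictAntiOn E.pay (Ico E.ωfb 0) := by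
  refine strictAntiOn_of_deriv_neg (convex_Ico _ _)
    (fun x hx => (hasDerivAt_pay hx.2).continuousAt.continuousWithinAt) fun x hx => ?_
  rw [interior_Ico] at hx
  rw [(hasDerivAt_pay hx.2).deriv]
  have := R_strictMonoOn (E := E) ωfb_neg hx.2 hx.1
  rw [R_ωfb] at this
  exact mul_neg_of_pos_of_neg (div_pos E.β_pos E.δ_pos) (by linarith)

/-- Beyond the first best, a larger transfer lowers `pay` and tightens the constraint on future
promises, so the peak cannot lie there. -/
lemma IsMinimalFraction.ω0_le_ωstar (H : E.IsMinimalFraction κ) (i : Fin (n + 1)) :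
    E.ω0 i ≤ E.ωstar i := by
  by_contra! hlt
  have hmax := H.ω0_le_ωmax i
  have hneg := hmax.trans_lt (H.ωmax_neg i)
  have hfb : E.ωfb ≤ E.ωstar i := le_max_right _ _
  have hmin : E.ωmin i ≤ E.ωstar i := le_max_left _ _
  have h1 := pay_strictAntiOn (E := E) ⟨hfb, hlt.trans hneg⟩ ⟨hfb.trans hlt.le, hneg⟩ hlt
  have h2 := H.W_antitoneOn (H.need_le_Amax (hlt.le.trans hmax)) (H.need_le_Amax hmax)
    ((need_strictMonoOn i).monotoneOn (hlt.trans hneg) hneg hlt.le)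
  have h3 := H.exactValue_le (i := i) (ω := E.ωmin i) hmin ⟨hmin, hlt.le.trans hmax⟩
  rw [(H.ω0_spec i).2.1 _ (H.ωmin_le_ω0 i), (H.ω0_spec i).2.2 _ ⟨le_rfl, hmax⟩] at h3
  unfold exactValue at h3
  linarith [mul_le_mul_of_nonneg_left h2 E.δ_pos.le]

lemma Regular.ω0_zero (H : E.Regular κ) : E.ω0 0 = E.ωmin 0 := by
  refine le_antisymm ?_ (H.ωmin_le_ω0 0)
  have h1 := H.ω0_le_ωstar 0
  have h2 : E.ωstar 0 = E.ωmin 0 := max_eq_left H.low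
  rwa [h2] at h1

lemma IsMinimalFraction.Amin_lt_Amax (H : E.IsMinimalFraction κ) : E.Amin < E.Amax :=
  Finset.sum_lt_sum_of_nonempty Finset.univ_nonempty fun r _ =>
    mul_lt_mul_of_pos_left (H.ωmin_lt_ωmax r) (E.prob_pos r)

lemma IsMinimalFraction.exists_lt_need (H : E.IsMinimalFraction κ) (i : Fin (n + 1)) {A y : ℝ}
    (hA : A < E.Amax) (hy : y < E.ωmax i) : ∃ ω ∈ Ioo y (E.ωmax i), A < E.need i ω := by
  have h1 := (hasDerivAt_need (E := E) i (H.ωmax_neg i)).continuousAt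
  rw [← H.need_ωmax i] at hA
  have h2 := (h1.eventually_const_lt hA).filter_mono (nhdsWithin_le_nhds (s := Iio (E.ωmax i)))
  obtain ⟨ω, h3, h4⟩ := (h2.and (Ioo_mem_nhdsLT hy)).exists
  exact ⟨ω, h4, h3⟩

lemma IsMinimalFraction.le_G (H : E.IsMinimalFraction κ) {A : ℝ} (hA : A ≤ E.Amax)
    (r : Fin (n + 1)) : E.Amax - A ≥ E.prob r * (E.ωmax r - E.G A r) := by
  have h1 := H.G_isInner hA
  have h2 : ∑ q, E.prob q * (E.ωmax q - E.G A q) ≤ E.Amax - A := by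
    simp only [mul_sub, Finset.sum_sub_distrib]
    exact sub_le_sub_left h1.2.1 _
  refine le_trans ?_ h2
  exact Finset.single_le_sum (f := fun q => E.prob q * (E.ωmax q - E.G A q))
    (fun q _ => mul_nonneg (E.prob_pos q).le (sub_nonneg.2 (h1.1 q))) (Finset.mem_univ r)

lemma IsMinimalFraction.exists_lt_G (H : E.IsMinimalFraction κ) (r : Fin (n + 1)) {y : ℝ}
    (hy : y < E.ωmax r) : ∃ A < E.Amax, y < E.G A r := by
  have hp := E.prob_pos r
  have hpy := mul_pos hp (sub_pos.2 hy)
  refine ⟨E.Amax - E.prob r * (E.ωmax r - y) / 2, by linarith, ?_⟩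
  have h := H.le_G (by linarith : E.Amax - E.prob r * (E.ωmax r - y) / 2 ≤ E.Amax) r
  by_contra! hle
  nlinarith

/-! ### Multipliers are unbounded near the largest promises -/

/-- Close to its largest promise, state `0` has `R` at least some constant greater than one. There
the multiplier of the next required promise, times this constant, is again at most a multiplier of
`W`. A finite supremum would be at least a constant multiple of itself greater than one. -/
lemma Regular.exists_lt_νl_W (H : E.Regular κ) (M : ℝ) : ∃ A < E.Amax, M < E.νl E.W A := by
  by_contra! hM
  set S := E.νl E.W '' Iio E.Amax
  have hbdd : BddAbove S := ⟨M, by rintro _ ⟨A, hA, rfl⟩; exact hM A hA⟩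
  have hle : ∀ A < E.Amax, E.νl E.W A ≤ sSup S := fun A hA => le_csSup hbdd ⟨A, hA, rfl⟩
  obtain ⟨y, hy1, hy2⟩ := exists_between (H.ωmin_lt_ωmax 0)
  have hyneg := hy2.trans (H.ωmax_neg 0)
  have hR : 1 < E.R y := by
    rw [← R_ωfb (E := E)]
    exact R_strictMonoOn ωfb_neg hyneg (H.low.trans_lt hy1)
  have hstep : ∀ ω ∈ Ioo y (E.ωmax 0), E.R y * E.νl E.W (E.need 0 ω) ≤ sSup S := fun ω hω => by
    obtain ⟨A, hA, hGA⟩ := H.exists_lt_G 0 hω.2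
    have h1 := H.νl_V_le_of_lt hA hGA
    have h2 := H.le_νl_V (i := 0) (H.ω0_zero ▸ (hy1.trans hω.1).le) (hy1.trans hω.1) hω.2
    have h3 := R_strictMonoOn (E := E) hyneg (hω.2.trans (H.ωmax_neg 0)) hω.1
    have h4 := H.one_le_νl_W (H.need_lt_Amax hω.2)
    nlinarith [hle A hA]
  have hall : ∀ A < E.Amax, E.νl E.W A ≤ sSup S / E.R y := fun A hA => by
    obtain ⟨ω, hω, hAω⟩ := H.exists_lt_need 0 hA hy2
    rw [le_div_iff₀ (by linarith), mul_comm]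
    refine le_trans ?_ (hstep ω hω)
    exact mul_le_mul_of_nonneg_left
      (νl_mono H.W_concaveOn hAω.le (H.need_lt_Amax hω.2)) (by linarith)
  have hne : S.Nonempty := ⟨_, E.Amin, H.Amin_lt_Amax, rfl⟩
  have h1 : sSup S ≤ sSup S / E.R y := csSup_le hne (by rintro _ ⟨A, hA, rfl⟩; exact hall A hA)
  have h2 : 1 ≤ sSup S := (H.one_le_νl_W H.Amin_lt_Amax).trans (hle _ H.Amin_lt_Amax)
  rw [le_div_iff₀ (by linarith)] at h1
  nlinarith

lemma need_secant (i : Fin (n + 1)) {x y z : ℝ} (hxy : x < y) (hyz : y < z) (hz : z < 0) :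
    (E.need i z - E.need i x) / (z - x) * (z - y) ≤ E.need i z - E.need i y := by
  have h := (need_convexOn (E := E) i).secant_mono (a := z) (x := x) (y := y) hz
    ((hxy.trans hyz).trans hz) (hyz.trans hz) (hxy.trans hyz).ne hyz.ne hxy.le
  rw [← neg_div_neg_eq, neg_sub, neg_sub, ← neg_div_neg_eq (E.need i y - E.need i z), neg_sub,
    neg_sub, le_div_iff₀ (by linarith)] at h
  exact h

/-- If the peak were at the top, the last step up to `ωmax` would not lose value. Its current gain
is at most linear in the step, but `W` falls arbitrarily steeply near `Amax`. -/
lemma Regular.ω0_lt_ωmax (H : E.Regular κ) (i : Fin (n + 1)) : E.ω0 i < E.ωmax i := by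
  refine lt_of_le_of_ne (H.ω0_le_ωmax i) fun he => ?_
  have hlt := H.ωmin_lt_ωmax i
  have hneg := H.ωmax_neg i
  set m := (E.need i (E.ωmax i) - E.need i (E.ωmin i)) / (E.ωmax i - E.ωmin i)
  have hm : 0 < m := div_pos (sub_pos.2 (need_strictMonoOn i (hlt.trans hneg) hneg hlt))
    (sub_pos.2 hlt)
  have hδ := E.δ_pos
  have hβ := E.β_pos
  -- Here `m` bounds from below the slope of `need` up to `ωmax`. The bound on the multiplier makes
  -- the continuation loss exceed twice the largest possible current gain; the `1` undoes the
  -- normalization of the multiplier.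
  obtain ⟨A, hA, hν⟩ := H.exists_lt_νl_W (1 + 2 / (E.δ * m))
  obtain ⟨ω, hω, hAω⟩ := H.exists_lt_need i hA hlt
  have hB := H.need_lt_Amax hω.2
  have h1 : E.exactValue i ω ≤ E.exactValue i (E.ωmax i) := by
    rw [← (H.ω0_spec i).2.2 (E.ωmax i) ⟨H.ω0_le_ωmax i, le_rfl⟩, ← he,
      ← (H.ω0_spec i).2.1 ω (he ▸ hω.2.le)]
    exact H.exactValue_le le_rfl ⟨hω.1.le, hω.2.le⟩
  have h2 := H.W_concaveOn.slope_le_derivWithin_Ioi hB le_rfl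
  have h3 := H.W_concaveOn.derivWithin_Iio_le_Ioi hAω hB
  have h4 := H.W_concaveOn.derivWithin_Ioi_le_Iio hA
  have h6 := νl_mono (E := E) H.W_concaveOn hAω.le hB
  have h7 := H.W_concaveOn.derivWithin_Ioi_le_Iio hB
  have h8 : 2 / (E.δ * m) < -(E.δ / E.β * slope E.W (E.need i ω) E.Amax) := by
    have := mul_le_mul_of_nonneg_left (h2.trans h7) (δ_div_β_pos (E := E)).le
    unfold νl at h6 hν
    linarith
  have h9 : E.W (E.need i ω) - E.W E.Amax =
      -slope E.W (E.need i ω) E.Amax * (E.Amax - E.need i ω) := by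
    rw [slope_def_field]
    field_simp [(sub_pos.2 hB).ne']
    ring
  have h10 : E.δ * (E.W (E.need i ω) - E.W E.Amax) ≤ E.β / E.δ * (E.ωmax i - ω) := by
    have hlog := Real.log_le_log (one_sub_exp_pos hneg)
      (by linarith [Real.exp_lt_exp.2 hω.2] : 1 - Real.exp (E.ωmax i) ≤ 1 - Real.exp ω)
    unfold exactValue pay at h1
    rw [H.need_ωmax] at h1
    linarith
  have hgap : 0 < E.Amax - E.need i ω := sub_pos.2 hB
  have h11 : m * (E.ωmax i - ω) ≤ E.Amax - E.need i ω := by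
    rw [← H.need_ωmax i]
    exact need_secant i hω.1 hω.2 hneg
  set sl := -slope E.W (E.need i ω) E.Amax
  have h12 : 2 / (E.δ * m) < E.δ / E.β * sl := by
    simp only [sl]
    linarith
  have h13 : 2 * E.β < E.δ * sl * (E.δ * m) := by
    rw [div_lt_iff₀ (by positivity)] at h12
    have := mul_lt_mul_of_pos_left h12 hβ
    have e : E.β * (E.δ / E.β * sl * (E.δ * m)) = E.δ * sl * (E.δ * m) := by field_simp
    rw [e] at this
    linarith
  rw [h9] at h10
  have h14 : E.δ * (sl * (E.Amax - E.need i ω)) * (E.δ * m) ≤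
      E.β * (m * (E.ωmax i - ω)) := by
    have := mul_le_mul_of_nonneg_right h10 (mul_pos hδ hm).le
    have e : E.β / E.δ * (E.ωmax i - ω) * (E.δ * m) = E.β * (m * (E.ωmax i - ω)) := by field_simp
    rwa [e] at this
  have h15 := mul_lt_mul_of_pos_right h13 hgap
  have h16 := mul_le_mul_of_nonneg_left h11 hβ.le
  nlinarith [mul_pos hβ hgap]

/-- A promise at its upper bound would bound the multipliers of `V r` below `ωmax r` by that of `W`
at `A`. But they dominate `R` times multipliers of `W` near `Amax`, which are unbounded. -/
lemma Regular.G_lt_ωmax (H : E.Regular κ) {A : ℝ} (hA : A < E.Amax) (r : Fin (n + 1)) :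
    E.G A r < E.ωmax r := by
  refine lt_of_le_of_ne (H.G_le_ωmax hA.le r) fun he => ?_
  obtain ⟨y, hy1, hy2⟩ := exists_between (H.ω0_lt_ωmax r)
  have hyneg := hy2.trans (H.ωmax_neg r)
  have hR := R_pos (E := E) hyneg
  obtain ⟨B, hB, hν⟩ := H.exists_lt_νl_W (E.νl E.W A / E.R y)
  obtain ⟨ω, hω, hBω⟩ := H.exists_lt_need r hB hy2
  have h1 := H.νl_V_le_of_lt hA (he ▸ hω.2)
  have h2 := H.le_νl_V (hy1.trans hω.1).le (((H.ωmin_le_ω0 r).trans_lt hy1).trans hω.1) hω.2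
  have h3 := R_strictMonoOn (E := E) hyneg (hω.2.trans (H.ωmax_neg r)) hω.1
  have h4 := νl_mono (E := E) H.W_concaveOn hBω.le (H.need_lt_Amax hω.2)
  rw [div_lt_iff₀ hR] at hν
  have h5 := H.one_le_νl_W hB
  nlinarith

/-! ### Monotonicity and continuity of the optimal promises -/

/-- A tighter requirement has a larger multiplier, while a smaller promise for `r` would, by strict
concavity of `V r`, have a strictly smaller one. -/
lemma Regular.G_mono (H : E.Regular κ) {A B : ℝ} (hAB : A ≤ B) (hB : B ≤ E.Amax)
    (r : Fin (n + 1)) : E.G A r ≤ E.G B r := by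
  rcases hAB.eq_or_lt with rfl | hlt
  · exact le_rfl
  rcases hB.eq_or_lt with rfl | hB'
  · rw [H.G_Amax]
    exact H.G_le_ωmax hAB r
  by_contra! hG
  have hA := hlt.trans hB'
  have h1 := H.νr_V_lt_νl_V (H.ω0_le_G hB r) hG (H.G_lt_ωmax hA r)
  have h2 := H.νl_V_le hA (H.G_lt_ωmax hA r)
  have h3 := H.νr_W_le hB' (H.G_lt_ωmax hB' r)
  have h4 := (νl_le_νr (E := E) H.W_concaveOn hA).trans
    (νr_mono H.W_concaveOn hlt.le hB')
  linarith

/-- No promise falls and their expectation rises by at most `B - A`. Hence each promise is Lipschitz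
in `A` with constant `1 / prob r`. -/
lemma Regular.sum_prob_mul_sub (H : E.Regular κ) {A B : ℝ} (hAB : A ≤ B) (hB : B ≤ E.Amax)
    (r : Fin (n + 1)) : E.prob r * (E.G B r - E.G A r) ≤ B - A := by
  have h1 : ∑ q, E.prob q * (E.G B q - E.G A q) = max B E.A0 - max A E.A0 := by
    simp only [mul_sub, Finset.sum_sub_distrib]
    rw [H.sum_G hB, H.sum_G (hAB.trans hB)]
  have h2 : max B E.A0 - max A E.A0 ≤ B - A := by
    rcases le_total A E.A0 with h | h <;> rcases le_total B E.A0 with h' | h'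
    · rw [max_eq_right h, max_eq_right h']; linarith
    · rw [max_eq_right h, max_eq_left h']; linarith
    · rw [max_eq_left h, max_eq_right h']; linarith
    · rw [max_eq_left h, max_eq_left h']
  refine le_trans ?_ (h1.le.trans h2)
  exact Finset.single_le_sum (f := fun q => E.prob q * (E.G B q - E.G A q))
    (fun q _ => mul_nonneg (E.prob_pos q).le (sub_nonneg.2 (H.G_mono hAB hB q)))
    (Finset.mem_univ r)

lemma Regular.continuousOn_G (H : E.Regular κ) (r : Fin (n + 1)) :
    ContinuousOn (fun A => E.G A r) (Iic E.Amax) := by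
  have hp := E.prob_pos r
  have key : ∀ A B, A ≤ B → B ≤ E.Amax →
      dist (E.G A r) (E.G B r) ≤ (E.prob r)⁻¹ * dist A B := fun A B hAB hB => by
    have h1 := H.sum_prob_mul_sub hAB hB r
    have h2 := H.G_mono hAB hB r
    rw [dist_comm, dist_comm A, Real.dist_eq, Real.dist_eq, abs_of_nonneg (by linarith),
      abs_of_nonneg (by linarith), ← div_eq_inv_mul, le_div_iff₀ hp]
    linarith
  refine (LipschitzOnWith.of_dist_le' (K := (E.prob r)⁻¹) fun A hA B hB => ?_).continuousOn
  rcases le_total A B with h | h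
  · exact key A B h hB
  · rw [dist_comm, dist_comm A]
    exact key B A h hA

lemma IsMinimalFraction.Amin_le_A0 (H : E.IsMinimalFraction κ) : E.Amin ≤ E.A0 :=
  Finset.sum_le_sum fun r _ => mul_le_mul_of_nonneg_left (H.ωmin_le_ω0 r) (E.prob_pos r).le

/-- If `ω0` were autarky, the multiplier of `W` at `Amin` would be at most `R (ωmin i) < 1` times
itself. -/
lemma Regular.ωmin_lt_ω0 (H : E.Regular κ) {i : Fin (n + 1)} (hi : E.ωmin i < E.ωfb) :
    E.ωmin i < E.ω0 i := by
  refine lt_of_le_of_ne (H.ωmin_le_ω0 i) fun he => ?_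
  have hG : E.G E.Amin i = E.ω0 i := by rw [G_of_le_A0 H.Amin_le_A0]
  have h1 := H.νr_W_le H.Amin_lt_Amax (H.G_lt_ωmax H.Amin_lt_Amax i)
  have h2 := H.νr_V_le (i := i) le_rfl (H.ω0_lt_ωmax i)
  rw [hG] at h1
  rw [← he, need_ωmin] at h2
  rw [← he] at h1
  have h3 := R_strictMonoOn (E := E) (ωmin_neg i) ωfb_neg hi
  rw [R_ωfb] at h3
  have h4 := H.one_le_νr_W H.Amin_lt_Amax
  nlinarith

lemma Regular.Amin_lt_A0 (H : E.Regular κ) : E.Amin < E.A0 :=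
  Finset.sum_lt_sum (fun r _ => mul_le_mul_of_nonneg_left (H.ωmin_le_ω0 r) (E.prob_pos r).le)
    ⟨Fin.last n, Finset.mem_univ _, mul_lt_mul_of_pos_left (H.ωmin_lt_ω0 H.last) (E.prob_pos _)⟩

/-! ### Dynamics in a constant state -/

/-- If the promise did not rise, the chain `ν_W ≤ ν_V(G) ≤ ν_V(ω) ≤ R(ω) ν_W` would contradict `R(ω)
< 1`. Above the first best the left multipliers give the reverse chain. -/
lemma Regular.lt_G_need (H : E.Regular κ) {i : Fin (n + 1)} {ω : ℝ} (h0 : E.ω0 i ≤ ω)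
    (hω : ω < E.ωmax i) (hfb : ω < E.ωfb) : ω < E.G (E.need i ω) i := by
  by_contra! hG
  have hA := H.need_lt_Amax hω
  have h1 := H.νr_W_le hA (H.G_lt_ωmax hA i)
  have h2 := νr_mono (E := E) (H.V_concaveOn i) hG hω
  have h3 := H.νr_V_le h0 hω
  have h4 := R_strictMonoOn (E := E) (hω.trans (H.ωmax_neg i)) ωfb_neg hfb
  rw [R_ωfb] at h4
  have h5 := H.one_le_νr_W hA
  nlinarith

lemma Regular.G_need_lt (H : E.Regular κ) {i : Fin (n + 1)} {ω : ℝ} (hmin : E.ωmin i < ω)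
    (hω : ω < E.ωmax i) (hfb : E.ωfb < ω) : E.G (E.need i ω) i < ω := by
  by_contra! hG
  have hA := H.need_lt_Amax hω
  have h0 : E.ω0 i ≤ ω := (H.ω0_le_ωstar i).trans (max_le hmin.le hfb.le)
  have h1 := H.νl_V_le hA (H.G_lt_ωmax hA i)
  have h2 := νl_mono (E := E) (H.V_concaveOn i) hG (H.G_lt_ωmax hA i)
  have h3 := H.le_νl_V h0 hmin hω
  have h4 := R_strictMonoOn (E := E) ωfb_neg (hω.trans (H.ωmax_neg i)) hfb
  rw [R_ωfb] at h4
  have h5 := H.one_le_νl_W hA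
  nlinarith

lemma Regular.A0_lt_need_last (H : E.Regular κ) : E.A0 < E.need (Fin.last n) E.ωfb :=
  lt_of_le_of_lt (Finset.sum_le_sum fun r _ =>
    mul_le_mul_of_nonneg_left (H.ω0_le_ωstar r) (E.prob_pos r).le) H.nofb

lemma Regular.ωstar_last (H : E.Regular κ) : E.ωstar (Fin.last n) = E.ωfb :=
  max_eq_right H.last.le

end Economy

namespace Economy

variable {n : ℕ} {E : Economy n} {κ : ℝ}

open Filter Topology

/-! ### Comparative statics of the promises -/

/-- Some promise must rise strictly, and the strict concavity of its `V` passes to `W`. -/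
lemma Regular.νr_lt_νl_W (H : E.Regular κ) {A B : ℝ} (hAB : A < B) (hB0 : E.A0 < B)
    (hB : B < E.Amax) : E.νr E.W A < E.νl E.W B := by
  have hA := hAB.trans hB
  have hsum : ∑ r, E.prob r * E.G A r < ∑ r, E.prob r * E.G B r := by
    rw [H.sum_G hA.le, H.sum_G hB.le, max_eq_left hB0.le]
    exact max_lt hAB hB0
  obtain ⟨r, -, hr⟩ := Finset.exists_lt_of_sum_lt hsum
  have hr := lt_of_mul_lt_mul_left hr (E.prob_pos r).le
  have h1 := H.νr_W_le hA (H.G_lt_ωmax hA r)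
  have h2 := H.νl_V_le hB (H.G_lt_ωmax hB r)
  have h3 := H.νr_V_lt_νl_V (H.ω0_le_G hA.le r) hr (H.G_lt_ωmax hB r)
  linarith

lemma Regular.one_lt_νl_W (H : E.Regular κ) {A : ℝ} (hA0 : E.A0 < A) (hA : A < E.Amax) :
    1 < E.νl E.W A :=
  (H.one_le_νr_W (hA0.trans hA)).trans_lt (H.νr_lt_νl_W hA0 hA0 hA)

lemma IsMinimalFraction.νl_V_ω0 (H : E.IsMinimalFraction κ) (i : Fin (n + 1)) :
    E.νl (E.V i) (E.ω0 i) = 1 := by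
  have h : HasDerivWithinAt (E.V i) 0 (Iio (E.ω0 i)) (E.ω0 i) :=
    (hasDerivWithinAt_const _ _ (E.V i (E.ω0 i))).congr
      (fun y hy => (H.ω0_spec i).2.1 y (le_of_lt hy)) rfl
  rw [νl, h.derivWithin (uniqueDiffWithinAt_Iio _), mul_zero, sub_zero]

/-- At `ω0` the left multiplier is one because `V` is flat to its left. At the first best it would
be at least that of `W` at the required promise, which exceeds one because assumption (c) makes the
requirement exceed `A0`. -/
lemma Regular.ω0_last_lt_ωfb (H : E.Regular κ) : E.ω0 (Fin.last n) < E.ωfb := by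
  have h1 := H.ω0_le_ωstar (Fin.last n)
  rw [H.ωstar_last] at h1
  refine lt_of_le_of_ne h1 fun he => ?_
  have hlt := H.ω0_lt_ωmax (Fin.last n)
  have h2 := H.le_νl_V (i := Fin.last n) le_rfl (H.ωmin_lt_ω0 H.last) hlt
  rw [H.νl_V_ω0, he, R_ωfb, one_mul] at h2
  rw [he] at hlt
  exact absurd (H.one_lt_νl_W H.A0_lt_need_last (H.need_lt_Amax hlt)) (not_lt.2 h2)

/-- Both promises equate their multipliers to that of `W` at `A`. A promise to the higher state that
is no smaller would raise both `R` and the next requirement, hence its multiplier; this drives the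
comparison across next states. -/
lemma Regular.R_mul_lt (H : E.Regular κ) {A w w' : ℝ} (hA : A < E.Amax) {i j : Fin (n + 1)}
    (hij : i < j) (hw : E.G A i = w) (hw' : E.G A j = w') (hle : w ≤ w') :
    E.R w' * E.νl E.W (E.need j w') ≤ E.R w * E.νr E.W (E.need i w) ∧
      E.need i w < E.need j w' ∧ E.need j w' < E.Amax := by
  subst hw hw'
  have hi := H.G_lt_ωmax hA i
  have hj := H.G_lt_ωmax hA j
  have h1 := H.νr_W_le hA hi
  have h2 := H.νr_V_le (H.ω0_le_G hA.le i) hi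
  have h3 := H.νl_V_le hA hj
  have hmin : E.ωmin j < E.G A j := (ωmin_strictAnti hij).trans_le
    (((H.ωmin_le_ω0 i).trans (H.ω0_le_G hA.le i)).trans hle)
  have h4 := H.le_νl_V (H.ω0_le_G hA.le j) hmin hj
  have h5 := νl_le_νr (E := E) H.W_concaveOn hA
  refine ⟨by linarith, (need_lt_need hij _).trans_le ?_, H.need_lt_Amax hj⟩
  exact (need_strictMonoOn j).monotoneOn (hi.trans (H.ωmax_neg i)) (hj.trans (H.ωmax_neg j)) hle

lemma Regular.G_anti (H : E.Regular κ) {A : ℝ} (hA : A ≤ E.Amax) {i j : Fin (n + 1)}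
    (hij : i < j) : E.G A j ≤ E.G A i := by
  rcases hA.eq_or_lt with rfl | hA
  · rw [H.G_Amax, H.G_Amax]
    exact (H.ωmax_strictAnti hij).le
  by_contra! hlt
  obtain ⟨h1, h2, h3⟩ := H.R_mul_lt hA hij rfl rfl hlt.le
  have hneg := (H.G_lt_ωmax hA j).trans (H.ωmax_neg j)
  have h4 := R_strictMonoOn (E := E) (hlt.trans hneg) hneg hlt
  have h5 := νr_le_νl (E := E) H.W_concaveOn h2 h3
  have h6 := H.one_le_νl_W h3
  have h7 := R_pos (E := E) (hlt.trans hneg)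
  nlinarith

lemma Regular.G_last_lt (H : E.Regular κ) (hn : 1 ≤ n) {A : ℝ} (hA : A ≤ E.Amax) :
    E.G A (Fin.last n) < E.G A 0 := by
  have h0 : (0 : Fin (n + 1)) < Fin.last n := by
    rw [Fin.lt_def]
    exact hn
  rcases hA.eq_or_lt with rfl | hA
  · rw [H.G_Amax, H.G_Amax]
    exact H.ωmax_strictAnti h0
  by_contra! hle
  obtain ⟨h1, h2, h3⟩ := H.R_mul_lt hA h0 rfl rfl hle
  have hneg := (H.G_lt_ωmax hA (Fin.last n)).trans (H.ωmax_neg (Fin.last n))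
  have h4 := R_strictMonoOn (E := E).monotoneOn (hle.trans_lt hneg) hneg hle
  have hfb : E.ωfb ≤ E.G A (Fin.last n) :=
    ((H.low.trans (H.ωmin_le_ω0 0)).trans (H.ω0_le_G hA.le 0)).trans hle
  have h5 := H.νr_lt_νl_W h2 (H.A0_lt_need_last.trans_le
    ((need_strictMonoOn _).monotoneOn ωfb_neg hneg hfb)) h3
  have h6 := H.one_le_νl_W h3
  have h7 := R_pos (E := E) (hle.trans_lt hneg)
  nlinarith

/-- The delicate case is a promise that does not bind in the lower state. If that state still
required more, its optimal utility would be larger and its `R` and future multiplier no smaller; yet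
its own left multiplier is one, and that of the higher state is at least one. -/
lemma Regular.need_max_le (H : E.Regular κ) {p q : Fin (n + 1)} (hpq : p < q) {ω : ℝ}
    (hω : ω ∈ Ioo (E.ωmin p) (E.ωmax q)) :
    E.need p (max ω (E.ω0 p)) ≤ E.need q (max ω (E.ω0 q)) := by
  set x := max ω (E.ω0 q)
  have hx : x < E.ωmax q := max_lt hω.2 (H.ω0_lt_ωmax q)
  have hxneg := hx.trans (H.ωmax_neg q)
  rcases le_total (E.ω0 p) ω with h | h
  · rw [max_eq_left h]
    have hle : ω ≤ x := le_max_left _ _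
    exact (need_lt_need hpq ω).le.trans
      ((need_strictMonoOn q).monotoneOn (hle.trans_lt hxneg) hxneg hle)
  rw [max_eq_right h]
  by_contra! hlt
  have hp := H.ω0_lt_ωmax p
  have hpneg := hp.trans (H.ωmax_neg p)
  have hxp : x < E.ω0 p := by
    by_contra! hle
    exact absurd (((need_strictMonoOn (E := E) p).monotoneOn hpneg hxneg hle).trans
      (need_lt_need hpq x).le) (not_le.2 hlt)
  have h1 := H.le_νl_V (i := p) le_rfl (hω.1.trans_le h) hp
  rw [H.νl_V_ω0] at h1
  have h2 := H.νr_V_le (i := q) (le_max_right ω (E.ω0 q)) hx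
  have h3 := H.one_le_νr_V hx
  have h4 := νr_le_νl (E := E) H.W_concaveOn hlt (H.need_lt_Amax hp)
  have h5 := R_strictMonoOn (E := E) hxneg hpneg hxp
  have h6 := H.one_le_νr_W (H.need_lt_Amax hx)
  have h7 := R_pos (E := E) hxneg
  change E.νr (E.V q) x ≤ E.R x * E.νr E.W (E.need q x) at h2
  nlinarith

/-! ### The policy functions for promises -/

variable (E) in
/-- Promise for state `r` when the current state is `i` and the current promise is `ω`. -/
noncomputable def promise (r i : Fin (n + 1)) (ω : ℝ) : ℝ := E.G (E.need i (max ω (E.ω0 i))) r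

lemma IsMinimalFraction.need_max_le_Amax (H : E.IsMinimalFraction κ) {i : Fin (n + 1)} {ω : ℝ}
    (hω : ω ∈ E.Ω i) : E.need i (max ω (E.ω0 i)) ≤ E.Amax := H.need_le_Amax (H.max_mem hω).2

lemma continuousOn_need (i : Fin (n + 1)) : ContinuousOn (E.need i) (Iio 0) := fun _ hx =>
  (hasDerivAt_need i hx).continuousAt.continuousWithinAt

lemma Regular.continuousOn_promise (H : E.Regular κ) (r i : Fin (n + 1)) :
    ContinuousOn (E.promise r i) (E.Ω i) := by
  have h1 : ContinuousOn (fun ω => max ω (E.ω0 i)) (E.Ω i) := by fun_prop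
  have h2 := (continuousOn_need (E := E) i).comp h1
    fun ω hω => (H.max_mem hω).2.trans_lt (H.ωmax_neg i)
  exact (H.continuousOn_G r).comp h2 fun ω hω => H.need_max_le_Amax hω

lemma Regular.monotoneOn_promise (H : E.Regular κ) (r i : Fin (n + 1)) :
    MonotoneOn (E.promise r i) (E.Ω i) := fun x hx y hy hxy => by
  refine H.G_mono ((need_strictMonoOn i).monotoneOn ((H.max_mem hx).2.trans_lt (H.ωmax_neg i))
    ((H.max_mem hy).2.trans_lt (H.ωmax_neg i)) ?_) (H.need_max_le_Amax hy) r
  exact max_le_max_right _ hxy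

lemma Regular.promise_mem (H : E.Regular κ) (r i : Fin (n + 1)) :
    MapsTo (E.promise r i) (E.Ω i) (Icc (E.ω0 r) (E.ωmax r)) := fun _ hω =>
  ⟨H.ω0_le_G (H.need_max_le_Amax hω) r, H.G_le_ωmax (H.need_max_le_Amax hω) r⟩

lemma Regular.ωf_mem (H : E.Regular κ) (i : Fin (n + 1)) : E.ωf i ∈ E.Ω i :=
  ⟨le_min (le_max_left _ _) (H.ωmin_lt_ωmax i).le, min_le_right _ _⟩

lemma Regular.lt_promise (H : E.Regular κ) {i : Fin (n + 1)} {ω : ℝ} (hω : ω ∈ E.Ω i)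
    (hf : ω < E.ωf i) : ω < E.promise i i ω := by
  rcases lt_or_ge ω (E.ω0 i) with h | h
  · exact h.trans_le (H.promise_mem i i hω).1
  · rw [promise, max_eq_left h]
    refine H.lt_G_need h (hf.trans_le (min_le_right _ _)) ?_
    exact (lt_max_iff.1 (hf.trans_le (min_le_left _ _) : ω < max _ _)).resolve_left (not_lt.2 hω.1)

lemma Regular.promise_lt (H : E.Regular κ) {i : Fin (n + 1)} {ω : ℝ} (hf : E.ωf i < ω)
    (hmax : ω < E.ωmax i) : E.promise i i ω < ω := by
  have hstar : E.ωstar i < ω := (min_lt_iff.1 hf).resolve_right (not_lt.2 hmax.le)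
  obtain ⟨h1, h2⟩ := max_lt_iff.1 (hstar : max _ _ < ω)
  rw [promise, max_eq_left ((H.ω0_le_ωstar i).trans hstar.le)]
  exact H.G_need_lt h1 hmax h2

lemma Regular.promise_ωmax (H : E.Regular κ) (r i : Fin (n + 1)) :
    E.promise r i (E.ωmax i) = E.ωmax r := by
  rw [promise, max_eq_left (H.ω0_le_ωmax i), H.need_ωmax, H.G_Amax]

/-- The promise rises below `ωf` and falls above it, so continuity fixes `ωf`; at an endpoint of `Ω`
the range of the map replaces the missing side. -/
lemma Regular.promise_ωf (H : E.Regular κ) (i : Fin (n + 1)) :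
    E.promise i i (E.ωf i) = E.ωf i := by
  rcases (H.ωf_mem i).2.eq_or_lt with he | hlt
  · rw [he, H.promise_ωmax]
  have hstar : E.ωf i = E.ωstar i := by
    rcases min_choice (E.ωstar i) (E.ωmax i) with h | h
    · exact h
    · exact absurd h hlt.ne
  refine le_antisymm ?_ ?_
  · have hc := (H.continuousOn_promise i i (E.ωf i) (H.ωf_mem i)).mono
      (fun ω hω => ⟨(H.ωf_mem i).1.trans hω.1.le, hω.2.le⟩ : Ioo (E.ωf i) (E.ωmax i) ⊆ E.Ω i)
    have hc' : Tendsto (E.promise i i) (𝓝[>] (E.ωf i)) (𝓝 (E.promise i i (E.ωf i))) := by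
      rw [← nhdsWithin_Ioo_eq_nhdsGT hlt]
      exact hc
    refine le_of_tendsto_of_tendsto hc' (tendsto_nhdsWithin_of_tendsto_nhds tendsto_id) ?_
    filter_upwards [Ioo_mem_nhdsGT hlt] with ω hω using (H.promise_lt hω.1 hω.2).le
  · rcases (H.ωf_mem i).1.eq_or_lt with he | hmin
    · rw [← he]
      exact ((H.ωmin_le_ω0 i).trans (H.promise_mem i i (H.ωf_mem i)).1).trans_eq (by rw [← he])
    · have hc := (H.continuousOn_promise i i (E.ωf i) (H.ωf_mem i)).mono
        (fun ω hω => ⟨hω.1.le, hω.2.le.trans hlt.le⟩ : Ioo (E.ωmin i) (E.ωf i) ⊆ E.Ω i)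
      have hc' : Tendsto (E.promise i i) (𝓝[<] (E.ωf i)) (𝓝 (E.promise i i (E.ωf i))) := by
        rw [← nhdsWithin_Ioo_eq_nhdsLT hmin]
        exact hc
      refine le_of_tendsto_of_tendsto (tendsto_nhdsWithin_of_tendsto_nhds tendsto_id) hc' ?_
      filter_upwards [Ioo_mem_nhdsLT hmin] with ω hω
      exact (H.lt_promise ⟨hω.1.le, hω.2.le.trans hlt.le⟩ hω.2).le

lemma Regular.ω0_last_lt_ωf (H : E.Regular κ) : E.ω0 (Fin.last n) < E.ωf (Fin.last n) :=
  lt_min (H.ωstar_last ▸ H.ω0_last_lt_ωfb) (H.ω0_lt_ωmax _)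

/-- In state `0` the lowest promise is autarky, which requires only `Amin < A0`. By continuity the
requirement stays below `A0` for slightly larger promises. -/
lemma Regular.exists_constant_range (H : E.Regular κ) : ∃ ωc, E.ω0 0 < ωc ∧ ωc ≤ E.ωmax 0 ∧
    ∀ ω ∈ Icc (E.ω0 0) ωc, ∀ r, E.promise r 0 ω = E.ω0 r := by
  have h1 := (hasDerivAt_need (E := E) 0 (ωmin_neg (E := E) 0)).continuousAt
  have h2 : E.need 0 (E.ωmin 0) < E.A0 := by
    rw [need_ωmin]
    exact H.Amin_lt_A0
  have h3 := (h1.eventually_lt_const h2).filter_mono (nhdsWithin_le_nhds (s := Ioi (E.ωmin 0)))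
  obtain ⟨ωc, h4, h5⟩ := (h3.and (Ioo_mem_nhdsGT (H.ωmin_lt_ωmax 0))).exists
  rw [H.ω0_zero]
  refine ⟨ωc, h5.1, h5.2.le, fun ω hω r => ?_⟩
  rw [promise, H.ω0_zero, max_eq_left hω.1, G_of_le_A0]
  have hneg := h5.2.trans (H.ωmax_neg 0)
  exact ((need_strictMonoOn 0).monotoneOn (hω.2.trans_lt hneg) hneg hω.2).trans h4.le

end Economy

namespace Economy

variable {n : ℕ} {E : Economy n} {κ : ℝ}

open Filter Topology

/-! ### Differentiability of the value functions

At a kink of `W` the multiplier is not unique. The dynamics move the interval of multipliers at one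
kink into the interval at another one by a multiplicative shift. Recurrence with an arbitrarily
small but nonzero shift is impossible, because distinct intervals do not overlap. -/

variable (E) in
/-- Expected promise required after state `r` follows an expected promise `A`. -/
noncomputable def step (r : Fin (n + 1)) (A : ℝ) : ℝ := E.need r (E.G A r)

variable (E) in
/-- Logarithmic shift of the multiplier when state `r` follows an expected promise `A`. -/
noncomputable def shift (r : Fin (n + 1)) (A : ℝ) : ℝ := -Real.log (E.R (E.G A r))

variable (E) in
/-- The multipliers at `A`, shifted by the factor `exp ε`, are multipliers at `B`. -/
def Reach (A B ε : ℝ) : Prop :=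
  B < E.Amax ∧ E.νl E.W B ≤ Real.exp ε * E.νl E.W A ∧ Real.exp ε * E.νr E.W A ≤ E.νr E.W B

variable (E) in
/-- The ratio of the multipliers from the right and from the left is at least `q`. -/
def Kink (q A : ℝ) : Prop := A < E.Amax ∧ q * E.νl E.W A ≤ E.νr E.W A

lemma Reach.trans {A B C ε ε' : ℝ} (h : E.Reach A B ε) (h' : E.Reach B C ε') :
    E.Reach A C (ε + ε') := by
  have hp := (Real.exp_pos ε').le
  refine ⟨h'.1, ?_, ?_⟩
  · refine h'.2.1.trans ((mul_le_mul_of_nonneg_left h.2.1 hp).trans_eq ?_)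
    rw [Real.exp_add]
    ring
  · refine (Eq.trans_le ?_ (mul_le_mul_of_nonneg_left h.2.2 hp)).trans h'.2.2
    rw [Real.exp_add]
    ring

lemma Reach.refl {A : ℝ} (hA : A < E.Amax) : E.Reach A A 0 := by
  refine ⟨hA, ?_, ?_⟩ <;> simp

lemma Reach.kink {q A B ε : ℝ} (h : E.Reach A B ε) (hq : 0 ≤ q) (hA : E.Kink q A) :
    E.Kink q B := by
  refine ⟨h.1, le_trans ?_ h.2.2⟩
  have h1 := mul_le_mul_of_nonneg_left h.2.1 hq
  have h2 := mul_le_mul_of_nonneg_left hA.2 (Real.exp_pos ε).le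
  calc q * E.νl E.W B ≤ q * (Real.exp ε * E.νl E.W A) := h1
    _ = Real.exp ε * (q * E.νl E.W A) := by ring
    _ ≤ _ := h2

lemma Regular.reach_step (H : E.Regular κ) {r : Fin (n + 1)} {A : ℝ} (hA : A < E.Amax)
    (hr : E.ωmin r < E.G A r) : E.Reach A (E.step r A) (E.shift r A) := by
  have hmax := H.G_lt_ωmax hA r
  have h0 := H.ω0_le_G hA.le r
  have hR := R_pos (E := E) (hmax.trans (H.ωmax_neg r))
  have h1 := (H.le_νl_V h0 hr hmax).trans (H.νl_V_le hA hmax)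
  have h2 := (H.νr_W_le hA hmax).trans (H.νr_V_le h0 hmax)
  have he : Real.exp (E.shift r A) = (E.R (E.G A r))⁻¹ := by
    rw [shift, Real.exp_neg, Real.exp_log hR]
  refine ⟨H.need_lt_Amax hmax, ?_, ?_⟩
  · rwa [he, ← div_eq_inv_mul, le_div_iff₀' hR]
  · rwa [he, ← div_eq_inv_mul, div_le_iff₀' hR]

/-- A kink cannot reach another kink, or itself, with a small nonzero shift. -/
lemma Regular.reach_small (H : E.Regular κ) {q A B ε : ℝ} (hq : 1 < q) (hA : E.Kink q A)
    (h : E.Reach A B ε) (hε : |ε| < Real.log q) : B = A ∧ ε = 0 := by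
  have hq0 : 0 < q := by linarith
  obtain ⟨hε1, hε2⟩ := abs_lt.1 hε
  have hl := H.one_le_νl_W hA.1
  have hexp := Real.exp_pos ε
  have h1 : Real.exp ε < q := by rwa [← Real.lt_log_iff_exp_lt hq0]
  have h2 : 1 < q * Real.exp ε := by
    have := Real.exp_lt_exp.2 (by linarith : -ε < Real.log q)
    rw [Real.exp_log hq0, Real.exp_neg, inv_lt_iff_one_lt_mul₀ hexp] at this
    linarith
  have hr := hA.2
  -- The shift is shorter than the logarithmic length of the interval at `A`. The shifted interval
  -- therefore overlaps the original one, whereas intervals at different points are ordered.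
  have hBA : B = A := by
    rcases lt_trichotomy A B with hlt | heq | hlt
    · have h3 := νr_le_νl (E := E) H.W_concaveOn hlt h.1
      nlinarith [h.2.1]
    · exact heq.symm
    · have h3 := νr_le_νl (E := E) H.W_concaveOn hlt hA.1
      have h4 := mul_le_mul_of_nonneg_left hr hexp.le
      nlinarith [h.2.2]
  subst hBA
  have hr1 : 1 ≤ E.νr E.W B := H.one_le_νr_W hA.1
  have e1 : 1 ≤ Real.exp ε := by nlinarith [h.2.1]
  have e2 : Real.exp ε ≤ 1 := by nlinarith [h.2.2]
  exact ⟨rfl, Real.exp_eq_one_iff ε |>.1 (le_antisymm e2 e1)⟩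

lemma Regular.lt_G_last (H : E.Regular κ) {A : ℝ} (hA : A ≤ E.Amax) :
    E.ωmin (Fin.last n) < E.G A (Fin.last n) :=
  (H.ωmin_lt_ω0 H.last).trans_le (H.ω0_le_G hA _)

/-- In a constant state the promise converges to the fixed point `ωf`, unless it is maximal. -/
lemma Regular.tendsto_iterate_promise (H : E.Regular κ) {i : Fin (n + 1)} {y : ℝ}
    (hy : y ∈ E.Ω i) (hmax : y < E.ωmax i) :
    Tendsto (fun k => (E.promise i i)^[k] y) atTop (𝓝 (E.ωf i)) := by
  set g := E.promise i i
  have hmaps : MapsTo g (E.Ω i) (E.Ω i) := fun ω hω =>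
    ⟨(H.ωmin_le_ω0 i).trans (H.promise_mem i i hω).1, (H.promise_mem i i hω).2⟩
  have hmem : ∀ k, g^[k] y ∈ E.Ω i := fun k => hmaps.iterate k hy
  have hmono : MonotoneOn g (E.Ω i) := H.monotoneOn_promise i i
  have hfix : g (E.ωf i) = E.ωf i := H.promise_ωf i
  have hlim : ∀ L ∈ E.Ω i, Tendsto (fun k => g^[k] y) atTop (𝓝 L) → g L = L := fun L hL hT => by
    have hT' : Tendsto (fun k => g^[k] y) atTop (𝓝[E.Ω i] L) :=
      tendsto_nhdsWithin_iff.2 ⟨hT, Eventually.of_forall hmem⟩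
    have h1 := (H.continuousOn_promise i i L hL).tendsto.comp hT'
    have h2 := hT.comp (tendsto_add_atTop_nat 1)
    refine tendsto_nhds_unique h1 (h2.congr fun k => ?_)
    simp only [Function.comp_apply, Function.iterate_succ_apply']
    rfl
  rcases le_total y (E.ωf i) with hle | hle
  · have hb : ∀ k, g^[k] y ≤ E.ωf i := fun k => by
      induction k with
      | zero => exact hle
      | succ k ih =>
        rw [Function.iterate_succ_apply']
        exact (hmono (hmem k) (H.ωf_mem i) ih).trans_eq hfix
    have hm : Monotone fun k => g^[k] y := monotone_nat_of_le_succ fun k => by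
      rw [Function.iterate_succ_apply']
      rcases (hb k).eq_or_lt with h | h
      · rw [h, hfix]
      · exact (H.lt_promise (hmem k) h).le
    have hbdd : BddAbove (range fun k => g^[k] y) := ⟨E.ωf i, by rintro _ ⟨k, rfl⟩; exact hb k⟩
    have hT := tendsto_atTop_ciSup hm hbdd
    set L := ⨆ k, g^[k] y
    have hL1 : L ≤ E.ωf i := ciSup_le hb
    have hL : L ∈ E.Ω i := ⟨hy.1.trans (le_ciSup hbdd 0), hL1.trans (H.ωf_mem i).2⟩
    rcases hL1.eq_or_lt with h | h
    · exact h ▸ hT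
    · exact absurd (hlim L hL hT) (H.lt_promise hL h).ne'
  · have hb : ∀ k, E.ωf i ≤ g^[k] y := fun k => by
      induction k with
      | zero => exact hle
      | succ k ih =>
        rw [Function.iterate_succ_apply']
        exact hfix.symm.trans_le (hmono (H.ωf_mem i) (hmem k) ih)
    have hm : Antitone fun k => g^[k] y := antitone_nat_of_succ_le fun k => by
      rw [Function.iterate_succ_apply']
      rcases (hb k).eq_or_lt with h | h
      · rw [← h, hfix]
      · rcases (hmem k).2.eq_or_lt with h' | h'
        · rw [h']
          exact (hmaps ⟨(H.ωmin_lt_ωmax i).le, le_rfl⟩).2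
        · exact (H.promise_lt h h').le
    have hbdd : BddBelow (range fun k => g^[k] y) := ⟨E.ωf i, by rintro _ ⟨k, rfl⟩; exact hb k⟩
    have hT := tendsto_atTop_ciInf hm hbdd
    set L := ⨅ k, g^[k] y
    have hL1 : E.ωf i ≤ L := le_ciInf hb
    have hLy : L ≤ y := ciInf_le hbdd 0
    have hL : L ∈ E.Ω i := ⟨(H.ωf_mem i).1.trans hL1, hLy.trans hy.2⟩
    rcases hL1.eq_or_lt with h | h
    · exact h ▸ hT
    · exact absurd (hlim L hL hT) (H.promise_lt h (hLy.trans_lt hmax)).ne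

/-- Path of required promises when the highest state recurs forever. -/
lemma Regular.G_iterate_step (H : E.Regular κ) {A : ℝ} (hA : A < E.Amax) (i : Fin (n + 1)) (k : ℕ) :
    (E.step i)^[k] A < E.Amax ∧
      E.G ((E.step i)^[k] A) i = (E.promise i i)^[k] (E.G A i) := by
  induction k with
  | zero => exact ⟨hA, rfl⟩
  | succ k ih =>
    rw [Function.iterate_succ_apply', Function.iterate_succ_apply', ← ih.2]
    refine ⟨H.need_lt_Amax (H.G_lt_ωmax ih.1 i), ?_⟩
    rw [step, promise, max_eq_left (H.ω0_le_G ih.1.le i)]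

lemma Regular.tendsto_G_iterate (H : E.Regular κ) {A : ℝ} (hA : A < E.Amax) (i : Fin (n + 1)) :
    Tendsto (fun k => E.G ((E.step i)^[k] A) i) atTop (𝓝 (E.ωf i)) := by
  have h1 : E.G A i ∈ E.Ω i :=
    ⟨(H.ωmin_le_ω0 i).trans (H.ω0_le_G hA.le i), H.G_le_ωmax hA.le i⟩
  exact (H.tendsto_iterate_promise h1 (H.G_lt_ωmax hA i)).congr fun k =>
    (H.G_iterate_step hA i k).2.symm

lemma Regular.kink_iterate (H : E.Regular κ) {q A : ℝ} (hq : 1 < q) (hA : E.Kink q A) (k : ℕ) :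
    E.Kink q ((E.step (Fin.last n))^[k] A) := by
  induction k with
  | zero => exact hA
  | succ k ih =>
    rw [Function.iterate_succ_apply']
    exact (H.reach_step ih.1 (H.lt_G_last ih.1.le)).kink (by linarith) ih

lemma continuousAt_log_R {x : ℝ} (hx : x < 0) : ContinuousAt (fun x => -Real.log (E.R x)) x := by
  refine (ContinuousAt.log ?_ (R_pos hx).ne').neg
  unfold R
  exact continuousAt_const.mul (Real.continuous_exp.continuousAt.div
    (continuousAt_const.sub Real.continuous_exp.continuousAt) (one_sub_exp_pos hx).ne')

lemma log_R_lt {x y : ℝ} (hxy : x < y) (hy : y < 0) : Real.log (E.R x) < Real.log (E.R y) :=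
  Real.log_lt_log (R_pos (hxy.trans hy)) (R_strictMonoOn (hxy.trans hy) hy hxy)

lemma eq_ωfb_of_log_R {x : ℝ} (hx : x < 0) (h : Real.log (E.R x) = 0) : x = E.ωfb := by
  have hfb : Real.log (E.R E.ωfb) = 0 := by rw [R_ωfb, Real.log_one]
  rcases lt_trichotomy x E.ωfb with hlt | heq | hlt
  · linarith [log_R_lt (E := E) hlt ωfb_neg]
  · exact heq
  · linarith [log_R_lt (E := E) hlt hx]

/-- If the first best is feasible in the highest state, then there is at most one kink. -/
lemma Regular.kink_eq (H : E.Regular κ) {q A : ℝ} (hq : 1 < q) (hA : E.Kink q A)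
    (hfb : E.ωfb < E.ωmax (Fin.last n)) : A = E.need (Fin.last n) E.ωfb := by
  by_contra hne
  set I := Fin.last n
  set a : ℕ → ℝ := fun k => (E.step I)^[k] A
  have hk : ∀ k, E.Kink q (a k) := H.kink_iterate hq hA
  have hsucc : ∀ k, a (k + 1) = E.step I (a k) := fun k => Function.iterate_succ_apply' _ _ _
  have hreach : ∀ k, E.Reach (a k) (a (k + 1)) (E.shift I (a k)) := fun k =>
    hsucc k ▸ H.reach_step (hk k).1 (H.lt_G_last (hk k).1.le)
  have hlog : 0 < Real.log q := Real.log_pos hq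
  -- A promise equal to the first best has zero shift, so the kink must return to itself; the
  -- requirement is then that of the first best.
  have hG : ∀ k, a k ≠ E.need I E.ωfb → E.G (a k) I ≠ E.ωfb := fun k hak hG => by
    have hs : E.shift I (a k) = 0 := by rw [shift, hG, R_ωfb, Real.log_one, neg_zero]
    have := (H.reach_small hq (hk k) (hreach k) (by rwa [hs, abs_zero])).1
    rw [hsucc, step, hG] at this
    exact hak this.symm
  have ha : ∀ k, a k ≠ E.need I E.ωfb := fun k => by
    induction k with
    | zero => exact hne
    | succ k ih =>
      intro he
      rw [hsucc, step] at he
      exact hG k ih ((need_strictMonoOn I).injOn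
        ((H.G_lt_ωmax (hk k).1 I).trans (H.ωmax_neg I)) ωfb_neg he)
  have hωf : E.ωf I = E.ωfb := by rw [ωf, H.ωstar_last, min_eq_left hfb.le]
  have hT := H.tendsto_G_iterate hA.1 I
  rw [hωf] at hT
  have hT' := (continuousAt_log_R (E := E) ωfb_neg).tendsto.comp hT
  rw [R_ωfb, Real.log_one, neg_zero] at hT'
  -- Along the constant state the promises tend to `ωfb`, so the shifts tend to zero; a small shift
  -- must vanish.
  obtain ⟨k, hk'⟩ := (hT'.abs.eventually_lt_const (by rwa [abs_zero])).exists
  have h0 := (H.reach_small hq (hk k) (hreach k) hk').2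
  exact hG k (ha k) (eq_ωfb_of_log_R ((H.G_lt_ωmax (hk k).1 I).trans (H.ωmax_neg I))
    (neg_eq_zero.1 h0))

lemma Regular.no_kink_of_fb_lt (H : E.Regular κ) {q A : ℝ} (hq : 1 < q) (hA : E.Kink q A)
    (hfb : E.ωfb < E.ωmax (Fin.last n)) : False := by
  have hAf := H.kink_eq hq hA hfb
  -- By assumption (c) some state receives more than its first best. After it the requirement is
  -- again the only kink `A`, so the promise repeats, although above the first best it must fall.
  have hsum : ∑ r, E.prob r * E.ωstar r < ∑ r, E.prob r * E.G A r := by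
    rw [H.sum_G hA.1.le, hAf, max_eq_left H.A0_lt_need_last.le]
    exact H.nofb
  obtain ⟨r, -, hr⟩ := Finset.exists_lt_of_sum_lt hsum
  have hr := lt_of_mul_lt_mul_left hr (E.prob_pos r).le
  obtain ⟨h1, h2⟩ := max_lt_iff.1 (hr : max _ _ < _)
  have hstep := H.kink_eq hq ((H.reach_step hA.1 h1).kink (by linarith) hA) hfb
  have h3 := H.G_need_lt h1 (H.G_lt_ωmax hA.1 r) h2
  rw [← hAf, step] at hstep
  rw [hstep] at h3
  exact lt_irrefl _ h3

/-- Repeating a state from required promises close to the maximum. -/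
lemma Regular.exists_reach (H : E.Regular κ) (r : Fin (n + 1)) {a : ℕ → ℝ}
    (ha : ∀ m, a m < E.Amax) (hlim : Tendsto a atTop (𝓝 E.Amax)) (k : ℕ) :
    ∃ b e : ℕ → ℝ, (∀ m, b m < E.Amax) ∧ Tendsto b atTop (𝓝 E.Amax) ∧
      Tendsto e atTop (𝓝 (k * -Real.log (E.R (E.ωmax r)))) ∧
      (∀ m, k * -Real.log (E.R (E.ωmax r)) ≤ e m ∧
        (0 < k → k * -Real.log (E.R (E.ωmax r)) < e m)) ∧
      ∀ᶠ m in atTop, E.Reach (a m) (b m) (e m) := by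
  induction k with
  | zero =>
    refine ⟨a, fun _ => 0, ha, hlim, ?_, fun m => ?_, Eventually.of_forall fun m => Reach.refl (ha m)⟩
    · simp
    · simp
  | succ k ih =>
    obtain ⟨b, e, hb, hbl, hel, he, hreach⟩ := ih
    have hb' : Tendsto b atTop (𝓝[Iic E.Amax] E.Amax) :=
      tendsto_nhdsWithin_iff.2 ⟨hbl, Eventually.of_forall fun m => (hb m).le⟩
    have hG : Tendsto (fun m => E.G (b m) r) atTop (𝓝 (E.ωmax r)) := by
      have := (H.continuousOn_G r E.Amax self_mem_Iic).tendsto.comp hb'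
      rwa [H.G_Amax] at this
    have hneg := H.ωmax_neg r
    have hlt : ∀ m, -Real.log (E.R (E.ωmax r)) < E.shift r (b m) := fun m =>
      neg_lt_neg (log_R_lt (H.G_lt_ωmax (hb m) r) hneg)
    refine ⟨fun m => E.step r (b m), fun m => e m + E.shift r (b m),
      fun m => H.need_lt_Amax (H.G_lt_ωmax (hb m) r), ?_, ?_, fun m => ?_, ?_⟩
    · have := (hasDerivAt_need (E := E) r hneg).continuousAt.tendsto.comp hG
      rwa [H.need_ωmax] at this
    · have := hel.add ((continuousAt_log_R (E := E) hneg).tendsto.comp hG)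
      push_cast
      rw [add_mul, one_mul]
      exact this
    · push_cast
      have h1 := (he m).1
      have h2 := hlt m
      exact ⟨by linarith, fun _ => by linarith⟩
    · filter_upwards [hreach, hG.eventually_const_lt (H.ωmin_lt_ωmax r)] with m h1 h2
      exact h1.trans (H.reach_step (hb m) h2)

/-- Dirichlet approximation of `α / γ` with denominator at most `N > γ / η`. Positivity of `a` is
what later makes a shift strict. -/
lemma exists_nat_abs_mul_sub_mul_lt {α γ η : ℝ} (hα : 0 ≤ α) (hγ : 0 < γ) (hη : 0 < η) :
    ∃ a b : ℕ, 0 < a ∧ |(a : ℝ) * α - b * γ| < η := by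
  obtain ⟨N, hN⟩ := exists_nat_gt (γ / η)
  have hN0 : 0 < N := by
    have : (0 : ℝ) < N := (div_pos hγ hη).trans hN
    exact_mod_cast this
  obtain ⟨a, ha, -, h⟩ := Real.exists_nat_abs_mul_sub_round_le (α / γ) hN0
  have hnn : 0 ≤ round ((a : ℝ) * (α / γ)) := by
    rw [round_eq]
    exact Int.floor_nonneg.2 (by positivity)
  refine ⟨a, (round ((a : ℝ) * (α / γ))).toNat, ha, ?_⟩
  have hcast : (((round ((a : ℝ) * (α / γ))).toNat : ℕ) : ℝ) =
      (round ((a : ℝ) * (α / γ)) : ℝ) := by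
    exact_mod_cast congrArg (Int.cast : ℤ → ℝ) (Int.toNat_of_nonneg hnn)
  rw [hcast]
  have e : (a : ℝ) * α - (round ((a : ℝ) * (α / γ)) : ℝ) * γ =
      ((a : ℝ) * (α / γ) - (round ((a : ℝ) * (α / γ)) : ℝ)) * γ := by
    field_simp
  rw [e, abs_mul, abs_of_pos hγ]
  have h1 := mul_le_mul_of_nonneg_right h hγ.le
  refine h1.trans_lt ?_
  rw [one_div, inv_mul_lt_iff₀ (by positivity)]
  rw [div_lt_iff₀ hη] at hN
  linarith

lemma Regular.no_kink (H : E.Regular κ) {q A : ℝ} (hq : 1 < q) (hA : E.Kink q A) : False := by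
  rcases lt_or_ge E.ωfb (E.ωmax (Fin.last n)) with hfb | hfb
  · exact H.no_kink_of_fb_lt hq hA hfb
  set I := Fin.last n
  -- The first best exceeds every promise feasible in the highest state or equals the largest one,
  -- so the promises there tend to the maximum. The offset writes each term as `need` of such a
  -- promise.
  set a : ℕ → ℝ := fun k => (E.step I)^[k + 1] A
  have hk : ∀ m, E.Kink q (a m) := fun m => H.kink_iterate hq hA (m + 1)
  have hlog : 0 < Real.log q := Real.log_pos hq
  have hωf : E.ωf I = E.ωmax I := by rw [ωf, H.ωstar_last, min_eq_right hfb]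
  have hlim : Tendsto a atTop (𝓝 E.Amax) := by
    have hT := H.tendsto_G_iterate hA.1 I
    rw [hωf] at hT
    have := (hasDerivAt_need (E := E) I (H.ωmax_neg I)).continuousAt.tendsto.comp hT
    rw [H.need_ωmax] at this
    exact this.congr fun k => (Function.iterate_succ_apply' (E.step I) k A).symm
  have hfb0 : Real.log (E.R E.ωfb) = 0 := by rw [R_ωfb, Real.log_one]
  have hα : 0 ≤ -Real.log (E.R (E.ωmax I)) := by
    rcases hfb.eq_or_lt with h | h
    · rw [h, hfb0, neg_zero]
    · linarith [log_R_lt (E := E) h ωfb_neg]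
  have hγ : 0 < Real.log (E.R (E.ωmax 0)) := by
    rw [← hfb0]
    exact log_R_lt (H.low.trans_lt (H.ωmin_lt_ωmax 0)) (H.ωmax_neg 0)
  -- Near the maximum the highest state shifts multipliers up or not at all, and state `0` shifts
  -- them down. Suitable numbers of visits nearly cancel in the limit.
  obtain ⟨k, l, hk0, hkl⟩ := exists_nat_abs_mul_sub_mul_lt hα hγ hlog
  obtain ⟨b, e, hb, hbl, hel, he, hreach⟩ := H.exists_reach I (fun m => (hk m).1) hlim k
  obtain ⟨b', e', hb', hbl', hel', he', hreach'⟩ := H.exists_reach 0 hb hbl l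
  have hsum := hel.add hel'
  set S := (k : ℝ) * -Real.log (E.R (E.ωmax I)) + l * -Real.log (E.R (E.ωmax 0))
  have hS : |S| < Real.log q := by
    have : S = (k : ℝ) * -Real.log (E.R (E.ωmax I)) - l * Real.log (E.R (E.ωmax 0)) := by
      simp only [S]
      ring
    rwa [this]
  have hzero : ∀ᶠ m in atTop, e m + e' m = 0 := by
    filter_upwards [hreach, hreach', hsum.abs.eventually_lt_const hS] with m h1 h2 h3
    exact (H.reach_small hq (hk m) (h1.trans h2) h3).2
  -- The total shift is eventually zero, so its limit `S` is zero. But promises below the maximum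
  -- make every actual shift strictly larger than its limit.
  have hS0 : S = 0 := tendsto_nhds_unique (hsum.congr' hzero) tendsto_const_nhds
  obtain ⟨m, hm⟩ := hzero.exists
  have h1 := (he m).2 hk0
  have h2 := (he' m).1
  simp only [S] at hS0
  linarith

/-- The multiplier of the expected promise is unique. -/
lemma Regular.νl_eq_νr (H : E.Regular κ) {A : ℝ} (hA : A < E.Amax) : E.νl E.W A = E.νr E.W A := by
  by_contra hne
  have hlt := lt_of_le_of_ne (νl_le_νr (E := E) H.W_concaveOn hA) hne
  have h1 : 0 < E.νl E.W A := by linarith [H.one_le_νl_W hA]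
  exact H.no_kink ((one_lt_div h1).2 hlt) ⟨hA, by rw [div_mul_cancel₀ _ h1.ne']⟩

lemma Regular.νr_V_le_νl_V (H : E.Regular κ) {i : Fin (n + 1)} {x : ℝ} (h0 : E.ω0 i ≤ x)
    (hmin : E.ωmin i < x) (hx : x < E.ωmax i) : E.νr (E.V i) x ≤ E.νl (E.V i) x := by
  refine (H.νr_V_le h0 hx).trans (le_trans ?_ (H.le_νl_V h0 hmin hx))
  rw [H.νl_eq_νr (H.need_lt_Amax hx)]

/-- If an interior promise did not move, its unique multiplier would be that of `W` at both `A` and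
`B`. Without differentiability, a kink of `V r` could absorb the change. -/
lemma Regular.G_strictMono (H : E.Regular κ) {A B : ℝ} (hAB : A < B) (hB : B ≤ E.Amax)
    {r : Fin (n + 1)} (h0 : E.ω0 r < E.G A r) (hmax : E.G B r < E.ωmax r) :
    E.G A r < E.G B r := by
  refine lt_of_le_of_ne (H.G_mono hAB.le hB r) fun he => ?_
  have hB' : B < E.Amax := lt_of_le_of_ne hB fun h => by
    rw [h, H.G_Amax] at hmax
    exact lt_irrefl _ hmax
  have hA := hAB.trans hB'
  have hA0 : E.A0 < A := by
    by_contra! hle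
    rw [G_of_le_A0 hle] at h0
    exact lt_irrefl _ h0
  have h1 := H.νr_W_le hB' hmax
  have h2 := H.νl_V_le hA (he ▸ hmax)
  have h3 := H.νr_V_le_νl_V h0.le ((H.ωmin_le_ω0 r).trans_lt h0) (he ▸ hmax)
  have h4 := H.νr_lt_νl_W hAB (hA0.trans hAB) hB'
  have h5 := νl_le_νr (E := E) H.W_concaveOn hA
  have h6 := νl_le_νr (E := E) H.W_concaveOn hB'
  rw [← he] at h1
  linarith

end Economy

namespace Economy

variable {n : ℕ} {E : Economy n} {κ : ℝ}

open Filter Topology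

/-! ### Promises after the highest state -/

lemma log_R {x : ℝ} (hx : x < 0) :
    Real.log (E.R x) = Real.log (E.δ / E.β) + (x - Real.log (1 - Real.exp x)) := by
  have h1 := one_sub_exp_pos hx
  rw [R, Real.log_mul (δ_div_β_pos (E := E)).ne' (div_pos (Real.exp_pos x) h1).ne',
    Real.log_div (Real.exp_pos x).ne' h1.ne', Real.log_exp]

/-- Beyond the first best, the utility of the old changes by less than `δ / (β + δ)` times the
change of the logarithmic ratio of marginal utilities. -/
lemma mul_sub_le_log_R {x y : ℝ} (hx : E.ωfb ≤ x) (hxy : x ≤ y) (hy : y < 0) :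
    (E.β + E.δ) * (y - x) ≤ E.δ * (Real.log (E.R y) - Real.log (E.R x)) := by
  have h := (pay_strictAntiOn (E := E)).antitoneOn ⟨hx, hxy.trans_lt hy⟩ ⟨hx.trans hxy, hy⟩ hxy
  rw [log_R (hxy.trans_lt hy), log_R hy]
  unfold pay at h
  have := mul_le_mul_of_nonneg_left h E.δ_pos.le
  have e : ∀ z l : ℝ, E.δ * (E.β / E.δ * z + l) = E.β * z + E.δ * l := fun z l => by
    have := E.δ_pos.ne'
    field_simp
  rw [e, e] at this
  linarith

lemma Regular.νr_W_le_one (H : E.Regular κ) {A : ℝ} (hA : A ≤ E.A0) (hA' : A < E.Amax) :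
    E.νr E.W A ≤ 1 := by
  have h1 := H.νr_W_le hA' (H.G_lt_ωmax hA' (Fin.last n))
  rw [G_of_le_A0 hA] at h1
  have h2 := H.νr_V_le_νl_V le_rfl (H.ωmin_lt_ω0 H.last) (H.ω0_lt_ωmax (Fin.last n))
  rw [H.νl_V_ω0] at h2
  linarith

lemma Regular.one_le_R_ωmin_zero (H : E.Regular κ) : 1 ≤ E.R (E.ωmin 0) := by
  rw [← R_ωfb (E := E)]
  exact R_strictMonoOn.monotoneOn ωfb_neg (ωmin_neg 0) H.low

/-- A promise at its lower bound has multiplier at most one if it exceeds autarky, by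
differentiability. At autarky the bound is `R (ωmin r)`, which is largest in state `0`. -/
lemma Regular.νr_W_le_of_G_eq (H : E.Regular κ) {A : ℝ} (hA : A < E.Amax) {r : Fin (n + 1)}
    (hr : E.G A r = E.ω0 r) : E.νr E.W A ≤ E.R (E.ωmin 0) := by
  have h1 := H.νr_W_le hA (H.G_lt_ωmax hA r)
  rw [hr] at h1
  refine h1.trans ?_
  rcases (H.ωmin_le_ω0 r).eq_or_lt with he | hlt
  · have h2 := H.νr_V_le (i := r) le_rfl (H.ω0_lt_ωmax r)
    rw [← he, need_ωmin] at h2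
    rw [← he]
    have h3 := H.νr_W_le_one H.Amin_le_A0 H.Amin_lt_Amax
    have h4 := (R_strictMonoOn (E := E)).monotoneOn (ωmin_neg (E := E) r)
      (ωmin_neg (E := E) 0) ((ωmin_strictAnti (E := E)).antitone (Fin.zero_le r))
    have h5 := R_pos (E := E) (ωmin_neg (E := E) r)
    nlinarith
  · have h2 := H.νr_V_le_νl_V le_rfl hlt (H.ω0_lt_ωmax r)
    rw [H.νl_V_ω0] at h2
    exact h2.trans H.one_le_R_ωmin_zero

/-- The increase of the promises is limited by the multiplier. -/
lemma Regular.mul_sub_G_le (H : E.Regular κ) {A B ρ : ℝ} (hAB : A ≤ B) (hB : B < E.Amax)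
    (hρ : 1 ≤ ρ) (hνB : E.νr E.W B ≤ ρ) {q : Fin (n + 1)} (hfb : E.ωfb ≤ E.G A q) :
    (E.β + E.δ) * (E.G B q - E.G A q) ≤ E.δ * Real.log ρ := by
  have hA := hAB.trans_lt hB
  have hGB := H.G_lt_ωmax hB q
  have hGA := H.G_lt_ωmax hA q
  have hnegB := hGB.trans (H.ωmax_neg q)
  rcases (H.G_mono hAB hB.le q).eq_or_lt with he | hlt
  · rw [he, sub_self, mul_zero]
    exact mul_nonneg E.δ_pos.le (Real.log_nonneg hρ)
  have hnegA := hlt.trans hnegB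
  refine (mul_sub_le_log_R hfb hlt.le hnegB).trans (mul_le_mul_of_nonneg_left ?_ E.δ_pos.le)
  have h0A := H.ω0_le_G hA.le q
  have h0B := H.ω0_le_G hB.le q
  have h1 := (H.le_νl_V h0B (((H.ωmin_le_ω0 q).trans h0A).trans_lt hlt) hGB).trans
    (H.νl_V_le hB hGB)
  have h2 := (H.νr_W_le hA hGA).trans (H.νr_V_le h0A hGA)
  have h3 := νr_le_νl (E := E) H.W_concaveOn (need_strictMonoOn q hnegA hnegB hlt)
    (H.need_lt_Amax hGB)
  have h4 := H.one_le_νr_W hA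
  have h5 := νl_le_νr (E := E) H.W_concaveOn hB
  have h6 := H.one_le_νl_W (H.need_lt_Amax hGB)
  have hRA := R_pos (E := E) hnegA
  have hRB := R_pos (E := E) hnegB
  -- The two chains share the multiplier at the next requirement after `B`. Cancelling it bounds the
  -- ratio of the two values of `R` by `ρ`.
  have h7 : 1 ≤ E.R (E.G A q) * E.νl E.W (E.need q (E.G B q)) := by nlinarith
  have h8 : E.R (E.G B q) ≤ ρ * E.R (E.G A q) := by
    refine le_of_mul_le_mul_right ?_ (by linarith : 0 < E.νl E.W (E.need q (E.G B q)))
    nlinarith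
  rw [sub_le_iff_le_add, ← Real.log_mul (by positivity) hRA.ne']
  exact Real.log_le_log hRB h8

/-- If the highest state has a promise above the largest autarky utility of the old, then all
promises for the next period exceed their lower bounds. -/
lemma Regular.ω0_lt_G_need_last (H : E.Regular κ) {ω : ℝ} (h0 : E.ωmin 0 < ω)
    (hmax : ω < E.ωmax (Fin.last n)) (r : Fin (n + 1)) :
    E.ω0 r < E.G (E.need (Fin.last n) ω) r := by
  set I := Fin.last n
  have hneg := hmax.trans (H.ωmax_neg I)
  have hfbω := H.low.trans_lt h0
  have hA := H.need_lt_Amax hmax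
  have hlt := need_strictMonoOn (E := E) I ωfb_neg hneg hfbω
  have hAf := hlt.trans hA
  refine lt_of_le_of_ne (H.ω0_le_G hA.le r) fun he => ?_
  have hν := H.νr_W_le_of_G_eq hA he.symm
  have hρ := H.one_le_R_ωmin_zero
  have hωf : E.ωf I = E.ωfb := by rw [ωf, H.ωstar_last, min_eq_left (hfbω.trans hmax).le]
  have hGI : E.G (E.need I E.ωfb) I = E.ωfb := by
    have h := H.promise_ωf I
    rwa [hωf, promise, max_eq_left H.ω0_last_lt_ωfb.le] at h
  have hGq : ∀ q, E.ωfb ≤ E.G (E.need I E.ωfb) q := fun q => by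
    rcases (Fin.le_last q).eq_or_lt with h | h
    · rw [h, hGI]
    · exact hGI.symm.trans_le (H.G_anti hAf.le h)
  -- If one promise were at its bound, the multiplier would be small and no promise could rise much
  -- between the requirements at `ωfb` and at `ω`. Yet the expected promise must rise by their whole
  -- difference.
  have hbound := fun q => H.mul_sub_G_le hlt.le hA hρ hν (hGq q)
  have hsum : ∑ q, E.prob q * (E.G (E.need I ω) q - E.G (E.need I E.ωfb) q) =
      E.need I ω - E.need I E.ωfb := by
    simp only [mul_sub, Finset.sum_sub_distrib]
    rw [H.sum_G hA.le, H.sum_G hAf.le, max_eq_left H.A0_lt_need_last.le,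
      max_eq_left (H.A0_lt_need_last.trans hlt).le]
  have hle : (E.β + E.δ) * (E.need I ω - E.need I E.ωfb) ≤
      E.δ * Real.log (E.R (E.ωmin 0)) := by
    rw [← hsum, Finset.mul_sum]
    calc ∑ q, (E.β + E.δ) * (E.prob q * (E.G (E.need I ω) q - E.G (E.need I E.ωfb) q))
        ≤ ∑ q, E.prob q * (E.δ * Real.log (E.R (E.ωmin 0))) := by
          refine Finset.sum_le_sum fun q _ => ?_
          have := mul_le_mul_of_nonneg_left (hbound q) (E.prob_pos q).le
          linarith
      _ = _ := by rw [← Finset.sum_mul, E.prob_sum, one_mul]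
  set D := Real.log (1 - Real.exp E.ωfb) - Real.log (1 - Real.exp (E.ωmin 0))
  have hD0 : 0 ≤ D := sub_nonneg.2 (Real.log_le_log (one_sub_exp_pos (ωmin_neg 0))
    (by linarith [Real.exp_le_exp.2 H.low]))
  have hD : D < E.β * (E.need I ω - E.need I E.ωfb) := by
    have h1 := Real.log_lt_log (one_sub_exp_pos hneg)
      (by linarith [Real.exp_lt_exp.2 h0] : 1 - Real.exp ω < 1 - Real.exp (E.ωmin 0))
    have h2 : E.β * (E.need I ω - E.need I E.ωfb) =
        Real.log (1 - Real.exp E.ωfb) - Real.log (1 - Real.exp ω) := by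
      have := E.β_pos.ne'
      unfold need
      field_simp
      ring
    rw [h2]
    simp only [D]
    linarith
  have hpay := (pay_strictAntiOn (E := E)).antitoneOn ⟨le_rfl, ωfb_neg⟩
    ⟨H.low, ωmin_neg 0⟩ H.low
  have hlogR : Real.log (E.R (E.ωmin 0)) = E.ωmin 0 - E.ωfb + D := by
    have hz : Real.log (E.R E.ωfb) = 0 := by rw [R_ωfb, Real.log_one]
    rw [log_R ωfb_neg] at hz
    rw [log_R (ωmin_neg 0)]
    simp only [D]
    linarith
  have hδ := E.δ_pos
  have hβ := E.β_pos
  have hpay' : E.β * (E.ωmin 0 - E.ωfb) ≤ E.δ * D := by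
    unfold pay at hpay
    have := mul_le_mul_of_nonneg_left hpay hδ.le
    have e : ∀ z l : ℝ, E.δ * (E.β / E.δ * z + l) = E.β * z + E.δ * l := fun z l => by
      field_simp
    rw [e, e] at this
    simp only [D]
    linarith
  -- With `Δ` the increase in the requirement, the estimates give `(β + δ) D < β (β + δ) Δ ≤ δ β
  -- (ωmin 0 - ωfb + D) ≤ δ (β + δ) D`, impossible since `D ≥ 0` and `δ < 1`.
  rw [hlogR] at hle
  have h1 := mul_lt_mul_of_pos_left hD (add_pos hβ hδ)
  have h2 := mul_le_mul_of_nonneg_left hle hβ.le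
  have h3 := mul_le_mul_of_nonneg_left hpay' hδ.le
  have h4 : E.δ * ((E.β + E.δ) * D) ≤ (E.β + E.δ) * D :=
    mul_le_of_le_one_left (by positivity) E.δ_lt_one.le
  linarith

lemma Regular.promise_zero_lt_promise_last (H : E.Regular κ) (hn : 1 ≤ n) {ω : ℝ}
    (h0 : E.ωmin 0 < ω) (hmax : ω < E.ωmax (Fin.last n)) (r : Fin (n + 1)) :
    E.promise r 0 ω < E.promise r (Fin.last n) ω := by
  have hlt0 : (0 : Fin (n + 1)) < Fin.last n := by
    rw [Fin.lt_def]
    exact hn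
  have hA := H.need_lt_Amax hmax
  have hlow := H.ω0_lt_G_need_last h0 hmax r
  have hneed := need_lt_need (E := E) hlt0 ω
  rw [promise, promise, max_eq_left (H.ω0_zero ▸ h0.le),
    max_eq_left (H.ω0_last_lt_ωfb.trans (H.low.trans_lt h0)).le]
  rcases (H.ω0_le_G (hneed.trans hA).le r).eq_or_lt with he | hlt
  · rwa [← he]
  · exact H.G_strictMono hneed hA.le hlt (H.G_lt_ωmax hA r)

end Economy

/-! ### The lemma assembled from the properties of `promise` -/

theorem lemma2 {n : ℕ} (hn : 1 ≤ n) (E : Economy n)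
    -- the trace of the matrix of autarkic state prices exceeds one
    (h_sustain : 1 < ∑ i, E.prob i * (E.β * E.s i / (1 - E.s i)))
    -- the lowest share is at most the first-best share
    (h_low : E.s 0 ≤ E.δ / (E.β + E.δ))
    -- the first best violates the participation constraint of the young in the highest state
    (h_nofb : Real.log (E.cstar (Fin.last n)) + E.β * ∑ r, E.prob r * Real.log (1 - E.cstar r) <
      Real.log (E.s (Fin.last n)) + E.β * ∑ r, E.prob r * Real.log (1 - E.s r)) :
    -- the policy functions are well defined, and the value function solves the recursive problem
    (∀ i, ∀ ω ∈ E.Ω i,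
      (∃! p : ℝ × (Fin (n + 1) → ℝ), E.IsPolicyChoice i ω p.1 p.2) ∧
      ∀ c w, E.IsPolicyChoice i ω c w → E.V i ω = E.objective c w) ∧
    ∀ (f : Fin (n + 1) → ℝ → ℝ) (g : Fin (n + 1) → Fin (n + 1) → ℝ → ℝ), E.IsPolicy f g →
      -- (i)
      (∀ r i,
        MapsTo (g r i) (E.Ω i) (Icc (E.ω0 r) (E.ωmax r)) ∧
        ContinuousOn (g r i) (E.Ω i) ∧
        MonotoneOn (g r i) (E.Ω i) ∧
        StrictMonoOn (g r i)
          {ω | ω ∈ E.Ω i ∧ E.ω0 i ≤ ω ∧ g r i ω ∈ Ioo (E.ω0 r) (E.ωmax r)}) ∧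
      -- (ii), current share
      (∀ r, ∀ i : Fin n, ∀ ω ∈ Ioo (E.ωmin i.castSucc) (E.ωmax i.succ),
        g r i.castSucc ω ≤ g r i.succ ω) ∧
      (∀ r, ∀ ω, (∀ i : Fin n, ω ∈ Ioo (E.ωmin i.castSucc) (E.ωmax i.succ)) →
        ∃ i : Fin n, g r i.castSucc ω < g r i.succ ω) ∧
      -- (ii), next share
      (∀ j, ∀ ω ∈ E.Ω j,
        (∀ i : Fin n, g i.succ j ω ≤ g i.castSucc j ω) ∧
        ∃ i : Fin n, g i.succ j ω < g i.castSucc j ω) ∧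
      -- (iii)
      (∃ ωc, E.ω0 0 < ωc ∧ ωc ≤ E.ωmax 0 ∧
        ∀ ω ∈ Icc (E.ω0 0) ωc, ∀ r, g r 0 ω = E.ω0 r) ∧
      -- (iv)
      (∀ i,
        E.ωf i ∈ E.Ω i ∧
        g i i (E.ωf i) = E.ωf i ∧
        (∀ ω ∈ E.Ω i, g i i ω = ω → ω = E.ωf i ∨ ω = E.ωmax i) ∧
        (∀ ω ∈ E.Ω i, ω < E.ωf i → ω < g i i ω) ∧
        (∀ ω ∈ E.Ω i, E.ωf i < ω → ω < E.ωmax i → g i i ω < ω)) ∧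
      E.ω0 (Fin.last n) < E.ωf (Fin.last n) := by
  obtain ⟨κ, Hκ⟩ := Economy.exists_isMinimalFraction h_sustain
  have H := Economy.regular_of_assumptions Hκ h_low h_nofb
  refine ⟨fun i ω hω => H.exists_unique_policyChoice hω, fun f g hfg => ?_⟩
  have hg : ∀ r i, ∀ ω ∈ E.Ω i, g r i ω = E.promise r i ω := fun r i ω hω =>
    congrFun ((H.isPolicyChoice_iff hω).1 (hfg i ω hω)).2 r
  have hcast : ∀ (i : Fin n), ∀ ω ∈ Ioo (E.ωmin i.castSucc) (E.ωmax i.succ),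
      ω ∈ E.Ω i.castSucc ∧ ω ∈ E.Ω i.succ := fun i ω hω =>
    ⟨⟨hω.1.le, (hω.2.trans (H.ωmax_strictAnti i.castSucc_lt_succ)).le⟩,
      ⟨((Economy.ωmin_strictAnti i.castSucc_lt_succ).trans hω.1).le, hω.2.le⟩⟩
  refine ⟨fun r i => ⟨?_, ?_, ?_, ?_⟩, ?_, ?_, ?_, ?_, fun i => ⟨H.ωf_mem i, ?_, ?_, ?_, ?_⟩,
    H.ω0_last_lt_ωf⟩
  · exact (H.promise_mem r i).congr fun ω hω => (hg r i ω hω).symm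
  · exact (H.continuousOn_promise r i).congr (hg r i)
  · exact (H.monotoneOn_promise r i).congr fun ω hω => (hg r i ω hω).symm
  · rintro x ⟨hx, hx0, hgx⟩ y ⟨hy, hy0, hgy⟩ hxy
    rw [hg r i x hx] at hgx ⊢
    rw [hg r i y hy] at hgy ⊢
    rw [Economy.promise, max_eq_left hx0] at hgx ⊢
    rw [Economy.promise, max_eq_left hy0] at hgy ⊢
    exact H.G_strictMono (Economy.need_strictMonoOn i (hx.2.trans_lt (H.ωmax_neg i))
      (hy.2.trans_lt (H.ωmax_neg i)) hxy) (H.need_le_Amax hy.2) hgx.1 hgy.2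
  · intro r i ω hω
    obtain ⟨h1, h2⟩ := hcast i ω hω
    rw [hg r _ ω h1, hg r _ ω h2]
    exact H.G_mono (H.need_max_le i.castSucc_lt_succ hω) (H.need_max_le_Amax h2) r
  · intro r ω hω
    -- Without a strict increase between neighbours, the promise after the highest share would not
    -- exceed that after the lowest.
    by_contra! hcon
    have hanti : Antitone fun i => g r i ω := Fin.antitone_iff_succ_le.2 hcon
    obtain ⟨m, rfl⟩ : ∃ m, n = m + 1 := ⟨n - 1, by omega⟩
    have h0 := hω 0
    have hl := hω (Fin.last m)
    have hΩ0 : ω ∈ E.Ω 0 := (hcast 0 ω h0).1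
    have hΩl : ω ∈ E.Ω (Fin.last (m + 1)) := (hcast (Fin.last m) ω hl).2
    have hle := hanti (Fin.zero_le (Fin.last (m + 1)))
    simp only at hle
    rw [hg r _ ω hΩ0, hg r _ ω hΩl] at hle
    exact absurd (H.promise_zero_lt_promise_last hn h0.1 hl.2 r) (not_lt.2 hle)
  · intro j ω hω
    have hA := H.need_max_le_Amax hω
    simp only [fun r => hg r j ω hω]
    refine ⟨fun i => H.G_anti hA i.castSucc_lt_succ, ?_⟩
    by_contra! hcon
    have hmono : Monotone fun r => E.promise r j ω := Fin.monotone_iff_le_succ.2 hcon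
    exact absurd (H.G_last_lt hn hA) (not_lt.2 (hmono (Fin.zero_le (Fin.last n))))
  · obtain ⟨ωc, h1, h2, h3⟩ := H.exists_constant_range
    refine ⟨ωc, h1, h2, fun ω hω r => ?_⟩
    rw [hg r 0 ω ⟨(H.ωmin_le_ω0 0).trans hω.1, hω.2.trans h2⟩]
    exact h3 ω hω r
  · rw [hg i i _ (H.ωf_mem i)]
    exact H.promise_ωf i
  · intro ω hω he
    rw [hg i i ω hω] at he
    rcases lt_trichotomy ω (E.ωf i) with h | h | h
    · exact absurd he (H.lt_promise hω h).ne'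
    · exact Or.inl h
    · rcases hω.2.eq_or_lt with h' | h'
      · exact Or.inr h'
      · exact absurd he (H.promise_lt h h').ne
  · intro ω hω h
    rw [hg i i ω hω]
    exact H.lt_promise hω h
  · intro ω hω h h'
    rw [hg i i ω hω]
    exact H.promise_lt h h'
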